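/- Let $m\in\mathbb C$ with $\operatorname{Re} m>-1$. On $L^2(0,\infty)$ consider $L_{m^2}=-\partial_x^2+\left(m^2-\tfrac14\right)\frac1{x^2}$. Let $L_{m^2}^{\min}$ be the closure of $L_{m^2}$ on $C_c^\infty(0,\infty)$, and let $L_{m^2}^{\max}$ be $L_{m^2}$, taken in the sense of distributions on $(0,\infty)$, on the domain $\{f\in L^2(0,\infty): L_{m^2}f\in L^2(0,\infty)\}$. Let $\xi$ be any smooth compactly supported real cutoff equal to $1$ near $0$, and let $H_m$ be the restriction of $L_{m^2}^{\max}$ to $\operatorname{Dom}L_{m^2}^{\min}+\mathbb C\,x^{\frac12+m}\xi$. Let $0<a<b<\infty$. Then $H_m$ possesses a spectral projection $\mathbb 1_{[a,b]}(H_m)$, in the following sense: there are a self-adjoint operator $A$ on $L^2(0,\infty)$ and a bounded, boundedly invertible operator $S$ on $L^2(0,\infty)$ with $H_m=S^{-1}AS$ (equality of domains included), and one puts $\mathbb 1_{[a,b]}(H_m)=S^{-1}\,\mathbb 1_{[a,b]}(A)\,S$, where $\mathbb 1_{[a,b]}(A)$ is given by the projection-valued spectral measure of $A$. For every such choice of $A$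 and $S$, the operator $\mathbb 1_{[a,b]}(H_m)$ has the integral kernel $$ \mathbb 1_{[a,b]}(H_m)(x,y)=\int_{\sqrt a}^{\sqrt b}\sqrt{xy}\,J_m(kx)\,J_m(ky)\,k\,dk ,\qquad x,y>0, $$ where $J_m(z)=\sum_{n\ge0}\frac{(-1)^n}{n!\,\Gamma(n+m+1)}\left(\frac z2\right)^{2n+m}$ is the Bessel function. That is, for every $f\in L^2(0,\infty)$ and almost every $x>0$, $$ \left(\mathbb 1_{[a,b]}(H_m)f\right)(x)=\int_0^\infty \mathbb 1_{[a,b]}(H_m)(x,y)\,f(y)\,dy $$ with an absolutely convergent integral. -/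

import Mathlib

open MeasureTheory Set Filter Topology
open scoped ContDiff ENNReal

noncomputable section

/-! ### Bessel functions -/

/-- The Bessel function of the first kind
`J_ν(z) = ∑ₙ (-1)ⁿ / (n! Γ(n + ν + 1)) (z/2)^(2n + ν)`, with the principal branch of the power. -/
def besselJ (ν z : ℂ) : ℂ :=
  ∑' n : ℕ, (-1 : ℂ) ^ n / ((n.factorial : ℂ) * Complex.Gamma ((n : ℂ) + ν + 1)) *
    (z / 2) ^ (2 * (n : ℂ) + ν)

/-! ### The operators `-∂ₓ² + (α - 1/4) x⁻²` on the half-line -/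

/-- Lebesgue measure on the half-line. -/
abbrev halfLine : Measure ℝ := volume.restrict (Ioi (0 : ℝ))

/-- The Hilbert space `L²` of the half-line. -/
abbrev L2Half : Type := Lp ℂ 2 halfLine

/-- `φ ∈ C_c^∞(]0,∞[)`. -/
structure IsHalfLineTest (φ : ℝ → ℂ) : Prop where
  smooth : ContDiff ℝ ∞ φ
  compact : HasCompactSupport φ
  supp : tsupport φ ⊆ Ioi 0

/-- The differential expression `L_α φ = -φ'' + (α - 1/4) x⁻² φ`. -/
def diffExpr (α : ℂ) (φ : ℝ → ℂ) (x : ℝ) : ℂ :=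
  -deriv (deriv φ) x + (α - 1 / 4) / (x : ℂ) ^ 2 * φ x

theorem IsHalfLineTest.continuous_memLp {φ : ℝ → ℂ} (hc : Continuous φ)
    (hs : HasCompactSupport φ) : MemLp φ 2 halfLine :=
  (hc.memLp_of_hasCompactSupport hs).restrict _

theorem IsHalfLineTest.contDiff_coef {φ : ℝ → ℂ} (h : IsHalfLineTest φ) :
    ContDiff ℝ ∞ (fun x : ℝ => ((x : ℂ) ^ 2)⁻¹ * φ x) := by
  rw [contDiff_iff_contDiffAt]
  intro x
  by_cases hx : x ∈ tsupport φ
  · have hx0 : (x : ℂ) ≠ 0 := by exact_mod_cast (h.supp hx : (0 : ℝ) < x).ne'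
    have h1 : ContDiffAt ℝ ∞ (fun x : ℝ => (x : ℂ) ^ 2) x :=
      (Complex.ofRealCLM.contDiff.pow 2).contDiffAt
    exact (h1.inv (pow_ne_zero 2 hx0)).mul h.smooth.contDiffAt
  · have : (fun x : ℝ => ((x : ℂ) ^ 2)⁻¹ * φ x) =ᶠ[𝓝 x] fun _ => 0 := by
      filter_upwards [notMem_tsupport_iff_eventuallyEq.1 hx] with y hy
      simp [hy]
    exact contDiffAt_const.congr_of_eventuallyEq this

theorem IsHalfLineTest.deriv {φ : ℝ → ℂ} (h : IsHalfLineTest φ) : IsHalfLineTest (deriv φ) where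
  smooth := ((contDiff_infty_iff_deriv (𝕜 := ℝ)).1 h.smooth).2
  compact := h.compact.deriv
  supp := (tsupport_deriv_subset ..).trans h.supp

theorem IsHalfLineTest.memLp {φ : ℝ → ℂ} (h : IsHalfLineTest φ) : MemLp φ 2 halfLine :=
  continuous_memLp h.smooth.continuous h.compact

theorem IsHalfLineTest.diffExpr {φ : ℝ → ℂ} (h : IsHalfLineTest φ) (α : ℂ) :
    IsHalfLineTest (diffExpr α φ) := by
  have e : _root_.diffExpr α φ = fun x : ℝ => -_root_.deriv (_root_.deriv φ) x +
      (α - 1 / 4) * (((x : ℂ) ^ 2)⁻¹ * φ x) := by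
    funext x; simp only [_root_.diffExpr]; ring
  have hsub : tsupport (_root_.diffExpr α φ) ⊆ tsupport φ := by
    refine closure_minimal ?_ (isClosed_tsupport φ)
    intro x hx
    by_contra hn
    apply hx
    have h1 : φ x = 0 := image_eq_zero_of_notMem_tsupport hn
    have h2 : _root_.deriv (_root_.deriv φ) x = 0 := image_eq_zero_of_notMem_tsupport
      (fun hh => hn (((tsupport_deriv_subset ..).trans (tsupport_deriv_subset ..)) hh))
    simp [_root_.diffExpr, h1, h2]
  refine ⟨?_, ?_, hsub.trans h.supp⟩
  · rw [e]
    exact h.deriv.deriv.smooth.neg.add (contDiff_const.mul h.contDiff_coef)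
  · exact h.compact.of_isClosed_subset (isClosed_tsupport _) hsub

theorem IsHalfLineTest.integrable_mul {φ : ℝ → ℂ} (h : IsHalfLineTest φ) (f : L2Half) :
    Integrable (fun x => f x * φ x) halfLine :=
  (Lp.memLp f).integrable_mul h.memLp

/-- The graph of the maximal operator `L_α^max`: pairs `(f, g)` in `L²` with `L_α f = g` in the
sense of distributions on `]0,∞[`. -/
def maxGraph (α : ℂ) : Submodule ℂ (L2Half × L2Half) where
  carrier := {p | ∀ φ : ℝ → ℂ, IsHalfLineTest φ →
    ∫ x, p.1 x * diffExpr α φ x ∂halfLine = ∫ x, p.2 x * φ x ∂halfLine}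
  zero_mem' := by
    intro φ _
    have h0 : ((0 : L2Half) : ℝ → ℂ) =ᵐ[halfLine] 0 := Lp.coeFn_zero ..
    have key : ∀ ψ : ℝ → ℂ, ∫ x, (0 : L2Half) x * ψ x ∂halfLine = 0 := fun ψ =>
      integral_eq_zero_of_ae (by filter_upwards [h0] with x hx; rw [hx]; simp)
    exact (key _).trans (key _).symm
  add_mem' := by
    intro p q hp hq φ hφ
    have key : ∀ (f g : L2Half) (ψ : ℝ → ℂ), IsHalfLineTest ψ →
        ∫ x, (f + g : L2Half) x * ψ x ∂halfLine
          = ∫ x, f x * ψ x ∂halfLine + ∫ x, g x * ψ x ∂halfLine := by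
      intro f g ψ hψ
      rw [← integral_add (hψ.integrable_mul f) (hψ.integrable_mul g)]
      refine integral_congr_ae ?_
      filter_upwards [Lp.coeFn_add f g] with x hx
      rw [hx, Pi.add_apply, add_mul]
    have := congrArg₂ (· + ·) (hp φ hφ) (hq φ hφ)
    simpa only [Prod.fst_add, Prod.snd_add, key _ _ _ (hφ.diffExpr α), key _ _ _ hφ] using this
  smul_mem' := by
    intro c p hp φ hφ
    have key : ∀ (f : L2Half) (ψ : ℝ → ℂ),
        ∫ x, (c • f : L2Half) x * ψ x ∂halfLine = c * ∫ x, f x * ψ x ∂halfLine := by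
      intro f ψ
      rw [← integral_const_mul]
      refine integral_congr_ae ?_
      filter_upwards [Lp.coeFn_smul c f] with x hx
      simp [hx, mul_assoc]
    have := congrArg (c * ·) (hp φ hφ)
    simpa only [Prod.smul_fst, Prod.smul_snd, key] using this

theorem mem_maxGraph {α : ℂ} {f g : L2Half} : (f, g) ∈ maxGraph α ↔
    ∀ φ : ℝ → ℂ, IsHalfLineTest φ →
      ∫ x, f x * diffExpr α φ x ∂halfLine = ∫ x, g x * φ x ∂halfLine := Iff.rfl

/-- The graph of `L_α` on `C_c^∞(]0,∞[)`. -/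
def coreGraph (α : ℂ) : Submodule ℂ (L2Half × L2Half) where
  carrier := {p | ∃ φ : ℝ → ℂ, IsHalfLineTest φ ∧
    p.1 =ᵐ[halfLine] φ ∧ p.2 =ᵐ[halfLine] diffExpr α φ}
  zero_mem' := by
    refine ⟨fun _ => 0, ⟨contDiff_const, HasCompactSupport.zero, ?_⟩, ?_, ?_⟩
    · simp [tsupport]
    · exact Lp.coeFn_zero ..
    · have : diffExpr α (fun _ => 0) = 0 := by
        funext x; simp [diffExpr]
      rw [this]; exact Lp.coeFn_zero ..
  add_mem' := by
    rintro p q ⟨φ, hφ, h1, h2⟩ ⟨ψ, hψ, h3, h4⟩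
    refine ⟨φ + ψ, ⟨hφ.smooth.add hψ.smooth, hφ.compact.add hψ.compact,
      (tsupport_add φ ψ).trans (union_subset hφ.supp hψ.supp)⟩,
      (Lp.coeFn_add _ _).trans (h1.add h3), (Lp.coeFn_add _ _).trans ?_⟩
    have e : diffExpr α (φ + ψ) = diffExpr α φ + diffExpr α ψ := by
      have d1 : deriv (φ + ψ) = deriv φ + deriv ψ := by
        funext x
        exact deriv_add (hφ.smooth.differentiable (by simp) x)
          (hψ.smooth.differentiable (by simp) x)
      funext x
      have d2 : deriv (deriv φ + deriv ψ) x = deriv (deriv φ) x + deriv (deriv ψ) x :=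
        deriv_add (hφ.deriv.smooth.differentiable (by simp) x)
          (hψ.deriv.smooth.differentiable (by simp) x)
      simp only [diffExpr, d1, d2, Pi.add_apply]
      ring
    rw [e]
    exact h2.add h4
  smul_mem' := by
    rintro c p ⟨φ, hφ, h1, h2⟩
    refine ⟨c • φ, ⟨contDiff_const.smul hφ.smooth, hφ.compact.smul_left,
      (tsupport_smul_subset_right (fun _ => c) φ).trans hφ.supp⟩,
      (Lp.coeFn_smul _ _).trans (h1.const_smul c), (Lp.coeFn_smul _ _).trans ?_⟩
    have e : diffExpr α (c • φ) = c • diffExpr α φ := by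
      have d1 : deriv (c • φ) = c • deriv φ := by
        funext x
        exact deriv_const_smul c (hφ.smooth.differentiable (by simp) x)
      funext x
      have d2 : deriv (c • deriv φ) x = c • deriv (deriv φ) x :=
        deriv_const_smul c (hφ.deriv.smooth.differentiable (by simp) x)
      simp only [diffExpr, d1, d2, Pi.smul_apply, smul_eq_mul]
      ring
    rw [e]
    exact h2.const_smul c

/-- The graph of `L_α^min`, the closure of `L_α` on `C_c^∞(]0,∞[)`. -/
def minGraph (α : ℂ) : Submodule ℂ (L2Half × L2Half) := (coreGraph α).topologicalClosure

theorem maxGraph_snd_eq_zero (α : ℂ) (p : L2Half × L2Half) (hp : p ∈ maxGraph α)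
    (h0 : p.1 = 0) : p.2 = 0 := by
  obtain ⟨f, g⟩ := p
  obtain rfl : f = 0 := h0
  have hz : ((0 : L2Half) : ℝ → ℂ) =ᵐ[halfLine] 0 := Lp.coeFn_zero ..
  have hloc : LocallyIntegrableOn (g : ℝ → ℂ) (Ioi 0) volume := by
    have h : LocallyIntegrable (g : ℝ → ℂ) halfLine :=
      (Lp.memLp g).locallyIntegrable (by norm_num)
    rw [locallyIntegrableOn_iff isOpen_Ioi.isLocallyClosed]
    intro k hk hkc
    have := h.integrableOn_isCompact hkc
    rwa [IntegrableOn, Measure.restrict_restrict hkc.measurableSet,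
      inter_eq_left.2 hk] at this
  have key := isOpen_Ioi.ae_eq_zero_of_integral_contDiff_smul_eq_zero hloc (by
    intro φ hφ hc hs
    have ht : IsHalfLineTest (fun x => (φ x : ℂ)) := by
      have hsub : tsupport (fun x => (φ x : ℂ)) ⊆ tsupport φ := by
        refine closure_mono ?_
        intro x hx h
        exact hx (by simp [h])
      exact ⟨Complex.ofRealCLM.contDiff.comp hφ,
        hc.of_isClosed_subset (isClosed_tsupport _) hsub, hsub.trans hs⟩
    have h1 := mem_maxGraph.1 hp _ ht
    have h2 : ∫ x, (0 : L2Half) x * diffExpr α (fun x => (φ x : ℂ)) x ∂halfLine = 0 :=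
      integral_eq_zero_of_ae (by filter_upwards [hz] with x hx; rw [hx]; simp)
    rw [h2] at h1
    rw [← setIntegral_eq_integral_of_forall_compl_eq_zero (s := Ioi 0)]
    · rw [h1]
      refine integral_congr_ae (Eventually.of_forall fun x => ?_)
      simp [mul_comm]
    · intro x hx
      have : φ x = 0 := image_eq_zero_of_notMem_tsupport (fun h => hx (hs h))
      simp [this])
  have : (g : ℝ → ℂ) =ᵐ[halfLine] 0 := (ae_restrict_iff' measurableSet_Ioi).2 key
  exact Lp.ext (this.trans hz.symm)

theorem continuous_testPairing {ψ : ℝ → ℂ} (hψ : IsHalfLineTest ψ) :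
    Continuous (fun f : L2Half => ∫ x, f x * ψ x ∂halfLine) := by
  have hs : MemLp (fun x => (starRingEnd ℂ) (ψ x)) 2 halfLine := hψ.memLp.star
  have e : (fun f : L2Half => ∫ x, f x * ψ x ∂halfLine)
      = fun f => inner ℂ (hs.toLp _) f := by
    funext f
    rw [L2.inner_def]
    refine integral_congr_ae ?_
    filter_upwards [hs.coeFn_toLp] with x hx
    simp [hx]
  rw [e]
  fun_prop

theorem isClosed_maxGraph (α : ℂ) : IsClosed (maxGraph α : Set (L2Half × L2Half)) := by
  have e : (maxGraph α : Set (L2Half × L2Half)) = ⋂ (φ : ℝ → ℂ) (_ : IsHalfLineTest φ),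
      {p | ∫ x, p.1 x * diffExpr α φ x ∂halfLine = ∫ x, p.2 x * φ x ∂halfLine} := by
    ext p; simp [maxGraph]
  rw [e]
  refine isClosed_iInter fun φ => isClosed_iInter fun hφ => isClosed_eq ?_ ?_
  · exact (continuous_testPairing (hφ.diffExpr α)).comp continuous_fst
  · exact (continuous_testPairing hφ).comp continuous_snd

theorem minGraph_le_maxGraph (α : ℂ) : minGraph α ≤ maxGraph α := by
  refine Submodule.topologicalClosure_minimal _ ?_ (isClosed_maxGraph α)
  rintro ⟨f, g⟩ ⟨ψ, hψ, h1, h2⟩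
  rw [mem_maxGraph]
  intro φ hφ
  have e1 : ∫ x, f x * diffExpr α φ x ∂halfLine = ∫ x, ψ x * diffExpr α φ x := by
    rw [← setIntegral_eq_integral_of_forall_compl_eq_zero (s := Ioi 0)
      (f := fun x => ψ x * diffExpr α φ x)]
    · refine integral_congr_ae ?_
      filter_upwards [h1] with x hx
      rw [← hx]
    · intro x hx
      rw [image_eq_zero_of_notMem_tsupport (fun h => hx (hψ.supp h)), zero_mul]
  have e2 : ∫ x, g x * φ x ∂halfLine = ∫ x, diffExpr α ψ x * φ x := by
    rw [← setIntegral_eq_integral_of_forall_compl_eq_zero (s := Ioi 0)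
      (f := fun x => diffExpr α ψ x * φ x)]
    · refine integral_congr_ae ?_
      filter_upwards [h2] with x hx
      rw [← hx]
    · intro x hx
      rw [image_eq_zero_of_notMem_tsupport (fun h => hx (hφ.supp h)), mul_zero]
  rw [e1, e2]
  have int : ∀ {u v : ℝ → ℂ}, IsHalfLineTest u → IsHalfLineTest v →
      Integrable (u * v) := fun hu hv =>
    (hu.smooth.continuous.mul hv.smooth.continuous).integrable_of_hasCompactSupport
      hu.compact.mul_right
  have hd : ∀ {u : ℝ → ℂ}, IsHalfLineTest u → ∀ x, HasDerivAt u (deriv u x) x := fun hu x =>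
    (hu.smooth.differentiable (by simp) x).hasDerivAt
  have p1 : ∫ x, ψ x * deriv (deriv φ) x = -∫ x, deriv ψ x * deriv φ x :=
    integral_mul_deriv_eq_deriv_mul_of_integrable (fun x _ => hd hψ x) (fun x _ => hd hφ.deriv x)
      (int hψ hφ.deriv.deriv) (int hψ.deriv hφ.deriv) (int hψ hφ.deriv)
  have p2 : ∫ x, deriv ψ x * deriv φ x = -∫ x, deriv (deriv ψ) x * φ x :=
    integral_mul_deriv_eq_deriv_mul_of_integrable (fun x _ => hd hψ.deriv x) (fun x _ => hd hφ x)
      (int hψ.deriv hφ.deriv) (int hψ.deriv.deriv hφ) (int hψ.deriv hφ)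
  have p3 : ∫ x, ψ x * deriv (deriv φ) x = ∫ x, deriv (deriv ψ) x * φ x := by
    rw [p1, p2, neg_neg]
  have i1 := int hψ (hφ.diffExpr α)
  have i2 := int (hψ.diffExpr α) hφ
  have i3 := int hψ hφ.deriv.deriv
  have i4 := int hψ.deriv.deriv hφ
  have s1 : ∫ x, ψ x * diffExpr α φ x + ψ x * deriv (deriv φ) x
      = ∫ x, diffExpr α ψ x * φ x + deriv (deriv ψ) x * φ x := by
    refine integral_congr_ae (Eventually.of_forall fun x => ?_)
    simp only [diffExpr]; ring
  have t1 := integral_add i1 i3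
  have t2 := integral_add i2 i4
  simp only [Pi.mul_apply] at t1 t2
  rw [t1, t2, p3] at s1
  exact add_right_cancel s1

/-- The maximal operator `L_α^max`. -/
def maxOp (α : ℂ) : L2Half →ₗ.[ℂ] L2Half := (maxGraph α).toLinearPMap

theorem maxOp_graph (α : ℂ) : (maxOp α).graph = maxGraph α :=
  Submodule.toLinearPMap_graph_eq _ (maxGraph_snd_eq_zero α)

/-- The minimal operator `L_α^min`. -/
def minOp (α : ℂ) : L2Half →ₗ.[ℂ] L2Half := (minGraph α).toLinearPMap

theorem minOp_graph (α : ℂ) : (minOp α).graph = minGraph α :=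
  Submodule.toLinearPMap_graph_eq _
    (fun p hp => maxGraph_snd_eq_zero α p (minGraph_le_maxGraph α hp))

theorem minOp_le_maxOp (α : ℂ) : minOp α ≤ maxOp α :=
  LinearPMap.le_of_le_graph (by rw [minOp_graph, maxOp_graph]; exact minGraph_le_maxGraph α)

/-- A smooth compactly supported cutoff equal to `1` around `0`. -/
structure IsCutoffAtZero (ξ : ℝ → ℝ) : Prop where
  smooth : ContDiff ℝ ∞ ξ
  compact : HasCompactSupport ξ
  eq_one : ∀ᶠ x in 𝓝 0, ξ x = 1

/-- The line `ℂ x^(1/2 + m) ξ` in `L²` of the half-line (for `Re m > -1`). -/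
def powerLine (m : ℂ) (ξ : ℝ → ℝ) : Submodule ℂ L2Half :=
  Submodule.span ℂ {f | f =ᵐ[halfLine] fun x => (x : ℂ) ^ (1 / 2 + m) * (ξ x : ℂ)}

/-- The homogeneous Schrödinger operator `H_m`: the restriction of `L_{m²}^max` to
`Dom L_{m²}^min + ℂ x^(1/2 + m) ξ`. -/
def homSchrodinger (m : ℂ) (ξ : ℝ → ℝ) : L2Half →ₗ.[ℂ] L2Half :=
  (maxOp (m ^ 2)).domRestrict ((minOp (m ^ 2)).domain ⊔ powerLine m ξ)

/-! ### Spectral projections -/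

section Spectral

variable {H : Type*} [NormedAddCommGroup H] [InnerProductSpace ℂ H] [CompleteSpace H]

/-- A projection-valued measure on the Borel sets of `ℝ`: orthogonal projections, of total mass
`1`, countably additive in the strong operator topology. Values at non-Borel sets are
irrelevant. -/
structure IsProjectionValuedMeasure (E : Set ℝ → H →L[ℂ] H) : Prop where
  isStarProjection : ∀ B, MeasurableSet B → IsStarProjection (E B)
  univ : E univ = 1
  hasSum : ∀ B : ℕ → Set ℝ, (∀ i, MeasurableSet (B i)) → Pairwise (Function.onFun Disjoint B) →
    ∀ x, HasSum (fun i => E (B i) x) (E (⋃ i, B i) x)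

theorem IsProjectionValuedMeasure.norm_sq {E : Set ℝ → H →L[ℂ] H}
    (hE : IsProjectionValuedMeasure E) {B : Set ℝ} (hB : MeasurableSet B) (x : H) :
    ‖E B x‖ ^ 2 = RCLike.re (inner ℂ x (E B x)) := by
  have h := hE.isStarProjection B hB
  have h1 : E B (E B x) = E B x := congrArg (fun T : H →L[ℂ] H => T x) h.isIdempotentElem
  have h2 := (ContinuousLinearMap.isSelfAdjoint_iff_isSymmetric.1 h.isSelfAdjoint) x (E B x)
  simp only [ContinuousLinearMap.coe_coe, h1] at h2
  rw [← h2, inner_self_eq_norm_sq (𝕜 := ℂ)]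

theorem IsProjectionValuedMeasure.empty {E : Set ℝ → H →L[ℂ] H}
    (hE : IsProjectionValuedMeasure E) : E ∅ = 0 := by
  ext x
  have h := hE.hasSum (fun _ => ∅) (fun _ => MeasurableSet.empty)
    (fun _ _ _ => disjoint_bot_left) x
  simpa using (summable_const_iff (β := ℕ) (a := E ∅ x)).1 h.summable

/-- The scalar spectral measure `B ↦ ⟨x, E(B) x⟩ = ‖E(B) x‖²`. -/
def IsProjectionValuedMeasure.measure {E : Set ℝ → H →L[ℂ] H}
    (hE : IsProjectionValuedMeasure E) (x : H) : Measure ℝ :=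
  Measure.ofMeasurable (fun B _ => ENNReal.ofReal (‖E B x‖ ^ 2)) (by simp [hE.empty]) (by
    intro B hB hd
    have h1 : HasSum (fun i => ‖E (B i) x‖ ^ 2) (‖E (⋃ i, B i) x‖ ^ 2) := by
      rw [hE.norm_sq (MeasurableSet.iUnion hB)]
      simp_rw [fun i => hE.norm_sq (hB i) x]
      exact (RCLike.reCLM (K := ℂ)).hasSum
        ((hE.hasSum B hB hd x).mapL (innerSL ℂ x))
    rw [← h1.tsum_eq, ENNReal.ofReal_tsum_of_nonneg (fun i => sq_nonneg _) h1.summable])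

/-- `E` is the spectral measure of `A`, i.e. `A = ∫ t dE(t)`: the domain of `A` consists of the `x`
with `∫ t² d⟨x, E(t) x⟩ < ∞`, and `⟨x, A x⟩ = ∫ t d⟨x, E(t) x⟩` for such `x`. -/
def IsSpectralMeasureOf (E : Set ℝ → H →L[ℂ] H) (A : H →ₗ.[ℂ] H) : Prop :=
  ∃ hE : IsProjectionValuedMeasure E,
    (∀ x, x ∈ A.domain ↔ ∫⁻ t, ENNReal.ofReal (t ^ 2) ∂(hE.measure x) < ⊤) ∧
    ∀ x : A.domain, inner ℂ (x : H) (A x) = ∫ t, (t : ℂ) ∂(hE.measure x)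

/-- `P` is the spectral projection `1_B(T)` of an operator `T` similar to a self-adjoint one:
for some self-adjoint `A` with spectral measure `E` and some bounded, boundedly invertible `S`,
`T = S⁻¹ A S` (domains included) and `P = S⁻¹ E(B) S`. -/
def IsSpectralProjection (T : H →ₗ.[ℂ] H) (B : Set ℝ) (P : H →L[ℂ] H) : Prop :=
  ∃ (S : H ≃L[ℂ] H) (A : H →ₗ.[ℂ] H) (E : Set ℝ → H →L[ℂ] H),
    IsSelfAdjoint A ∧ IsSpectralMeasureOf E A ∧
    (∀ f g : H, (f, g) ∈ T.graph ↔ (S f, S g) ∈ A.graph) ∧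
    ∀ f : H, P f = S.symm (E B (S f))

end Spectral

/-! ### Integral kernels -/

/-- The bounded operator `P` on `L²` of the half-line has the integral kernel `K`:
`(P f)(x) = ∫₀^∞ K(x,y) f(y) dy`, absolutely convergent, for every `f ∈ L²` and almost every
`x > 0`. -/
def HasIntegralKernel (P : L2Half →L[ℂ] L2Half) (K : ℝ → ℝ → ℂ) : Prop :=
  ∀ f : L2Half, ∀ᵐ x ∂halfLine,
    Integrable (fun y => K x y * f y) halfLine ∧ P f x = ∫ y, K x y * f y ∂halfLine

/-- The kernel `∫_{√a}^{√b} √(xy) J_m(kx) J_m(ky) k dk`. -/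
def besselKernel (m : ℂ) (a b x y : ℝ) : ℂ :=
  ∫ k in (√a)..(√b), (√(x * y) : ℂ) * besselJ m (k * x : ℝ) * besselJ m (k * y : ℝ) * (k : ℂ)

end

/-! The Hankel transform F, with kernel √(kx) J_m(kx), diagonalises H_m: it is bounded on L²(0,∞),
F² = 1, and H_m = F k² F. So F 1_[a,b](k²) F is a spectral projection of H_m, and its kernel is the
product of two Hankel kernels integrated over a ≤ k² ≤ b. For complex m the transform F need not be
unitary. Duality is therefore taken in the bilinear pairing ∫ f g, for which F is symmetric.

F is not defined by its integral. In the variable v = log x the Mellin transform becomes a Fourier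
transform, and F becomes a reflection followed by multiplication by a quotient of Gamma functions.
Using the inverse Fourier transform twice builds the reflection in. Boundedness of F is a comparison
of Gamma at two points of one vertical line (`exists_norm_Gamma_le`). All further identities are
checked on the Gaussians g_s = x^(m+1/2) exp(-s x²/2), where F g_s = s^(-m-1) g_(1/s)
(`hankel_gaussL2`). Gaussians suffice because a function is determined by its integrals against
them, which is uniqueness of Laplace transforms (`ae_eq_zero_of_integral_mul_exp_eq_zero`). This
gives F² = 1, the symmetry of F, and the Bessel integral for F on functions supported in a ≤ k² ≤ b
(`hankel_sqProj_ae_eq`).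

H_m = F k² F is proved as an equality of closed graphs (`homSchrodinger_graph`). A function that is
smooth, vanishes far out and equals c x^(m+1/2) near 0 can be integrated by parts against g_s with
no boundary term, so it lies in the domain of F k² F. Conversely the span of the g_s is a core for
k², and each pair (g_s, L g_s) is a limit of such functions, hence lies in the closed space spanned
by the graph of L^min and one further vector.

Independence of A and S rests on a description of spectral subspaces by growth: if ‖(A - c)^n x‖ ≤ C
r^n for all n, then x lies in the range of E([c - r, c + r]). A similarity changes only C. Functions
supported in |k² - c| ≤ r satisfy the bound for multiplication by k², so S F maps them into the
matching spectral subspace of A. Applied to [a,b] and to intervals exhausting its complement, this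
determines E([a,b]) on all of L² (`IsSpectralMeasureOf.apply_similar`). -/

noncomputable section

/-! ### Projection-valued measures and approximate eigenvectors -/

section SpectralUniqueness

variable {H : Type*} [NormedAddCommGroup H] [InnerProductSpace ℂ H] [CompleteSpace H]

namespace IsProjectionValuedMeasure

variable {E : Set ℝ → H →L[ℂ] H}

theorem measure_apply (hE : IsProjectionValuedMeasure E) (x : H) {B : Set ℝ}
    (hB : MeasurableSet B) : hE.measure x B = ENNReal.ofReal (‖E B x‖ ^ 2) :=
  Measure.ofMeasurable_apply B hB

theorem measure_univ (hE : IsProjectionValuedMeasure E) (x : H) :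
    hE.measure x Set.univ = ENNReal.ofReal (‖x‖ ^ 2) := by
  rw [hE.measure_apply x MeasurableSet.univ, hE.univ]; rfl

theorem isFiniteMeasure_measure (hE : IsProjectionValuedMeasure E) (x : H) :
    IsFiniteMeasure (hE.measure x) :=
  ⟨by rw [hE.measure_univ]; exact ENNReal.ofReal_lt_top⟩

theorem apply_eq_zero_iff (hE : IsProjectionValuedMeasure E) {B : Set ℝ} (hB : MeasurableSet B)
    (x : H) : E B x = 0 ↔ hE.measure x B = 0 := by
  rw [hE.measure_apply x hB, ENNReal.ofReal_eq_zero]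
  constructor
  · intro h; simp [h]
  · intro h
    have : ‖E B x‖ ^ 2 = 0 := le_antisymm h (sq_nonneg _)
    simpa using this

theorem idem (hE : IsProjectionValuedMeasure E) {B : Set ℝ} (hB : MeasurableSet B) (x : H) :
    E B (E B x) = E B x :=
  congrArg (fun T : H →L[ℂ] H => T x) (hE.isStarProjection B hB).isIdempotentElem

theorem inner_left (hE : IsProjectionValuedMeasure E) {B : Set ℝ} (hB : MeasurableSet B)
    (x y : H) : inner ℂ (E B x) y = inner ℂ x (E B y) :=
  (ContinuousLinearMap.isSelfAdjoint_iff_isSymmetric.1 (hE.isStarProjection B hB).isSelfAdjoint) x y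

theorem union (hE : IsProjectionValuedMeasure E) {B C : Set ℝ} (hB : MeasurableSet B)
    (hC : MeasurableSet C) (hd : Disjoint B C) (x : H) : E (B ∪ C) x = E B x + E C x := by
  let D : ℕ → Set ℝ := fun n => if n = 0 then B else if n = 1 then C else ∅
  have hD : ∀ i, MeasurableSet (D i) := by
    intro i; simp only [D]; split_ifs <;> simp [hB, hC]
  have hdis : Pairwise (Function.onFun Disjoint D) := by
    intro i j hij
    simp only [Function.onFun, D]
    split_ifs <;> first | exact hd | exact hd.symm | simp_all
  have h := hE.hasSum D hD hdis x
  have hU : (⋃ i, D i) = B ∪ C := by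
    ext t
    simp only [mem_iUnion, mem_union, D]
    constructor
    · rintro ⟨i, hi⟩
      split_ifs at hi <;> simp_all
    · rintro (h | h)
      · exact ⟨0, by simpa using h⟩
      · exact ⟨1, by simpa using h⟩
  rw [hU] at h
  have h2 : HasSum (fun i => E (D i) x) (∑ i ∈ Finset.range 2, E (D i) x) :=
    hasSum_sum_of_ne_finset_zero (by
    intro i hi
    have h0 : i ≠ 0 := by rintro rfl; simp at hi
    have h1 : i ≠ 1 := by rintro rfl; simp at hi
    simp [D, h0, h1, hE.empty])
  refine (h.unique h2).trans ?_
  simp [Finset.sum_range_succ, D]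

/-- Multiplicativity is not an axiom of `IsProjectionValuedMeasure`; it comes from contractivity.
For z = E(B)x additivity gives ‖E(B ∪ C)z‖² = ‖z‖² + ‖E(C)z‖², while E(B ∪ C) is a projection and
cannot increase the norm. -/
theorem apply_apply_of_disjoint (hE : IsProjectionValuedMeasure E) {B C : Set ℝ}
    (hB : MeasurableSet B) (hC : MeasurableSet C) (hd : Disjoint B C) (x : H) :
    E C (E B x) = 0 := by
  have h1 := hE.norm_sq (hB.union hC) (E B x)
  rw [hE.union hB hC hd, inner_add_right, map_add, ← hE.norm_sq hB, ← hE.norm_sq hC,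
    hE.idem hB] at h1
  have h2 : ‖E (B ∪ C) (E B x)‖ ≤ ‖E B x‖ := by
    have := (hE.isStarProjection _ (hB.union hC)).norm_le
    calc _ ≤ ‖E (B ∪ C)‖ * ‖E B x‖ := ContinuousLinearMap.le_opNorm _ _
      _ ≤ 1 * ‖E B x‖ := by gcongr
      _ = _ := one_mul _
  rw [hE.union hB hC hd, hE.idem hB] at h2
  have h3 : ‖E C (E B x)‖ ^ 2 ≤ 0 := by
    have := pow_le_pow_left₀ (norm_nonneg _) h2 2
    linarith
  have : ‖E C (E B x)‖ ^ 2 = 0 := le_antisymm h3 (sq_nonneg _)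
  simpa using this

/-- Split both B and C along C ∩ B; the cross terms vanish by the disjoint case. -/
theorem apply_apply (hE : IsProjectionValuedMeasure E) {B C : Set ℝ}
    (hB : MeasurableSet B) (hC : MeasurableSet C) (x : H) :
    E C (E B x) = E (C ∩ B) x := by
  have hCB := hC.inter hB
  have e1 : E C (E B x) = E (C ∩ B) (E B x) := by
    have := hE.union hCB (hC.diff hB) (disjoint_sdiff_inter.symm) (E B x)
    rw [inter_union_sdiff] at this
    rw [this, hE.apply_apply_of_disjoint hB (hC.diff hB) disjoint_sdiff_right, add_zero]
  have e2 : E B x = E (C ∩ B) x + E (B \ C) x := by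
    have := hE.union hCB (hB.diff hC)
      (by rw [inter_comm]; exact disjoint_sdiff_inter.symm) x
    rwa [inter_comm, inter_union_sdiff, inter_comm] at this
  rw [e1, e2, map_add, hE.idem hCB,
    hE.apply_apply_of_disjoint (hB.diff hC) hCB, add_zero]
  exact (disjoint_sdiff_left).mono_right inter_subset_left

theorem measure_apply_restrict (hE : IsProjectionValuedMeasure E) {B : Set ℝ}
    (hB : MeasurableSet B) (x : H) : hE.measure (E B x) = (hE.measure x).restrict B := by
  ext C hC
  rw [Measure.restrict_apply hC, hE.measure_apply _ hC, hE.measure_apply _ (hC.inter hB),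
    hE.apply_apply hB hC]

theorem add_compl (hE : IsProjectionValuedMeasure E) {B : Set ℝ} (hB : MeasurableSet B) (x : H) :
    E B x + E Bᶜ x = x := by
  rw [← hE.union hB hB.compl disjoint_compl_right, union_compl_self, hE.univ]; rfl

/-- Pythagoras: after applying any E(C), the two vectors still lie in the orthogonal ranges of E(B)
and E(Bᶜ). -/
theorem measure_add (hE : IsProjectionValuedMeasure E) {B : Set ℝ} (hB : MeasurableSet B)
    (x y : H) :
    hE.measure (E B x + E Bᶜ y) = hE.measure (E B x) + hE.measure (E Bᶜ y) := by
  ext C hC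
  rw [Measure.add_apply, hE.measure_apply _ hC, hE.measure_apply _ hC, hE.measure_apply _ hC,
    ← ENNReal.ofReal_add (sq_nonneg _) (sq_nonneg _)]
  congr 1
  have h0 : inner ℂ (E C (E B x)) (E C (E Bᶜ y)) = 0 := by
    rw [hE.inner_left hC, hE.idem hC, hE.apply_apply hB.compl hC, hE.inner_left hB,
      hE.apply_apply (hC.inter hB.compl) hB]
    have : B ∩ (C ∩ Bᶜ) = ∅ := by ext t; simp; tauto
    simp [this, hE.empty]
  rw [map_add, @norm_add_sq ℂ, h0]
  simp

end IsProjectionValuedMeasure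

/-! ### Spectral subspaces are characterised by the growth of powers -/

namespace IsSpectralMeasureOf

variable {E : Set ℝ → H →L[ℂ] H} {A : H →ₗ.[ℂ] H}

theorem apply_mem_domain (h : IsSpectralMeasureOf E A) {B : Set ℝ} (hB : MeasurableSet B)
    {x : H} (hx : x ∈ A.domain) : E B x ∈ A.domain := by
  obtain ⟨hE, hdom, -⟩ := h
  rw [hdom] at hx ⊢
  rw [hE.measure_apply_restrict hB]
  exact (lintegral_mono' Measure.restrict_le_self le_rfl).trans_lt hx

theorem integrable_id (hE : IsProjectionValuedMeasure E)
    {x : H} (hx : ∫⁻ t, ENNReal.ofReal (t ^ 2) ∂(hE.measure x) < ⊤) :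
    Integrable (fun t : ℝ => t) (hE.measure x) := by
  have := hE.isFiniteMeasure_measure x
  refine MemLp.integrable (q := 2) (by norm_num) ?_
  refine (memLp_two_iff_integrable_sq measurable_id.aestronglyMeasurable).2 ?_
  refine ⟨by fun_prop, ?_⟩
  rw [hasFiniteIntegral_iff_ofReal (Eventually.of_forall fun t => sq_nonneg _)]
  exact hx

/-- Polarisation. The spectral formula is given only on the diagonal. Additivity of the scalar
measures makes the sum of the two cross terms vanish; replacing x by ix makes their difference
vanish, so each is zero. -/
theorem inner_compl (h : IsSpectralMeasureOf E A) {B : Set ℝ} (hB : MeasurableSet B)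
    (x y : H) (hx : E B x ∈ A.domain) (hy : E Bᶜ y ∈ A.domain) :
    inner ℂ (E B x) (A ⟨E Bᶜ y, hy⟩) = 0 ∧ inner ℂ (E Bᶜ y) (A ⟨E B x, hx⟩) = 0 := by
  obtain ⟨hE, hdom, hin⟩ := h
  have key : ∀ (x y : H) (hx : E B x ∈ A.domain) (hy : E Bᶜ y ∈ A.domain),
      inner ℂ (E B x) (A ⟨E Bᶜ y, hy⟩) + inner ℂ (E Bᶜ y) (A ⟨E B x, hx⟩) = 0 := by
    intro x y hx hy
    have h1 := hin (⟨E B x, hx⟩ + ⟨E Bᶜ y, hy⟩)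
    have hc : ∀ {z : H}, z ∈ A.domain → Integrable (fun t : ℝ => (t : ℂ)) (hE.measure z) :=
      fun hz => (integrable_id hE ((hdom _).1 hz)).ofReal
    rw [A.map_add, Submodule.coe_add, hE.measure_add hB,
      integral_add_measure (hc hx) (hc hy), inner_add_left, inner_add_right, inner_add_right] at h1
    have h2 := hin ⟨E B x, hx⟩
    have h3 := hin ⟨E Bᶜ y, hy⟩
    simp only at h1 h2 h3
    rw [← h2, ← h3] at h1
    linear_combination h1
  have k1 := key x y hx hy
  have hIx : E B (Complex.I • x) ∈ A.domain := by
    rw [map_smul]; exact A.domain.smul_mem _ hx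
  have k2 := key (Complex.I • x) y hIx hy
  have e : (⟨E B (Complex.I • x), hIx⟩ : A.domain) = Complex.I • ⟨E B x, hx⟩ := by
    ext; simp
  rw [e, A.map_smul, map_smul, inner_smul_left, inner_smul_right, Complex.conj_I] at k2
  have k3 : inner ℂ (E Bᶜ y) (A ⟨E B x, hx⟩) = (0 : ℂ) := by
    have := congrArg (fun z => Complex.I * z) k2
    linear_combination (1 / 2 : ℂ) * k1 - (1 / 2) * this +
      (1 / 2 : ℂ) * (inner ℂ (E Bᶜ y) (A ⟨E B x, hx⟩) -
        inner ℂ (E B x) (A ⟨E Bᶜ y, hy⟩)) * Complex.I_mul_I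
  exact ⟨by rw [k3, add_zero] at k1; exact k1, k3⟩

/-- Test against y in the dense domain: with the cross terms gone, both sides equal ⟨E(B)y, A
E(B)x⟩. -/
theorem commute (h : IsSpectralMeasureOf E A) (hd : Dense (A.domain : Set H)) {B : Set ℝ}
    (hB : MeasurableSet B) (x : A.domain) :
    A ⟨E B x, h.apply_mem_domain hB x.2⟩ = E B (A x) := by
  refine hd.eq_of_inner_right (𝕜 := ℂ) fun y hy => ?_
  obtain ⟨hE, hdom, hin⟩ := id h
  have hxB := h.apply_mem_domain hB x.2
  have hxC := h.apply_mem_domain hB.compl x.2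
  have hyB := h.apply_mem_domain hB hy
  have hyC := h.apply_mem_domain hB.compl hy
  have e1 : A x = A ⟨E B x, hxB⟩ + A ⟨E Bᶜ x, hxC⟩ := by
    rw [← A.map_add]; congr 1; ext; exact (hE.add_compl hB _).symm
  have e2 : inner ℂ y (A ⟨E B x, hxB⟩) = inner ℂ (E B y) (A ⟨E B x, hxB⟩) := by
    conv_lhs => rw [← hE.add_compl hB y]
    rw [inner_add_left, (h.inner_compl hB x y hxB hyC).2, add_zero]
  have e3 : inner ℂ (E B y) (A ⟨E Bᶜ x, hxC⟩) = 0 := (h.inner_compl hB y x hyB hxC).1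
  rw [e2, ← hE.inner_left hB, e1, inner_add_right, e3, add_zero]

/-- On the range of E(B) the operator ε(A - c) is bounded below by r', so ‖E(B) x_n‖ ≥ r'^n ‖E(B)
x_0‖. Growth of order r^n with r < r' then forces E(B) x_0 = 0. The sign ε selects the side of c on
which B lies. -/
theorem apply_eq_zero_of_growth (h : IsSpectralMeasureOf E A) (hd : Dense (A.domain : Set H))
    {c r r' C : ℝ} (hr : 0 < r) (hrr : r < r') {B : Set ℝ} (hB : MeasurableSet B)
    {ε : ℝ} (hε : |ε| = 1) (hBc : ∀ t ∈ B, r' ≤ ε * (t - c))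
    (x : ℕ → H) (hx : ∀ n, x n ∈ A.domain) (hs : ∀ n, A ⟨x n, hx n⟩ - (c : ℂ) • x n = x (n + 1))
    (hb : ∀ n, ‖x n‖ ≤ C * r ^ n) : E B (x 0) = 0 := by
  obtain ⟨hE, hdom, hin⟩ := id h
  have step : ∀ n, r' * ‖E B (x n)‖ ≤ ‖E B (x (n + 1))‖ := by
    intro n
    have hm := h.apply_mem_domain hB (hx n)
    have e1 : E B (x (n + 1)) = A ⟨E B (x n), hm⟩ - (c : ℂ) • E B (x n) := by
      rw [← hs n, map_sub, map_smul]
      congr 1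
      exact (h.commute hd hB ⟨x n, hx n⟩).symm
    have hint := integrable_id hE ((hdom _).1 hm)
    have hfin := hE.isFiniteMeasure_measure (E B (x n))
    have e2 : inner ℂ (E B (x n)) (E B (x (n + 1)))
        = ((∫ t, (t - c) ∂(hE.measure (E B (x n))) : ℝ) : ℂ) := by
      have h1 := hin ⟨E B (x n), hm⟩
      simp only at h1
      rw [e1, inner_sub_right, h1, inner_smul_right, inner_self_eq_norm_sq_to_K,
        integral_sub hint (integrable_const _), integral_const, measureReal_def, hE.measure_univ,
        ENNReal.toReal_ofReal (sq_nonneg _), integral_complex_ofReal]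
      push_cast
      simp [mul_comm]
    -- The scalar measure of E(B) x_n is carried by B, where ε(t - c) ≥ r', and has total mass ‖E(B)
    -- x_n‖².
    have e3 : r' * ‖E B (x n)‖ ^ 2 ≤ ε * ∫ t, (t - c) ∂(hE.measure (E B (x n))) := by
      rw [← integral_const_mul]
      have : r' * ‖E B (x n)‖ ^ 2 = ∫ t, r' ∂(hE.measure (E B (x n))) := by
        rw [integral_const, measureReal_def, hE.measure_univ,
          ENNReal.toReal_ofReal (sq_nonneg _), smul_eq_mul, mul_comm]
      rw [this]
      refine integral_mono_ae (integrable_const _)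
        ((hint.sub (integrable_const c)).const_mul ε) ?_
      rw [hE.measure_apply_restrict hB]
      filter_upwards [ae_restrict_mem hB] with t ht using hBc t ht
    have e4 : ε * ∫ t, (t - c) ∂(hE.measure (E B (x n))) ≤ ‖E B (x n)‖ * ‖E B (x (n + 1))‖ := by
      calc _ ≤ |ε * ∫ t, (t - c) ∂(hE.measure (E B (x n)))| := le_abs_self _
        _ = ‖inner ℂ (E B (x n)) (E B (x (n + 1)))‖ := by
            rw [e2, abs_mul, hε, one_mul, Complex.norm_real, Real.norm_eq_abs]
        _ ≤ _ := norm_inner_le_norm _ _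
    rcases (norm_nonneg (E B (x n))).eq_or_lt with h0 | h0
    · rw [← h0, mul_zero]; exact norm_nonneg _
    · refine le_of_mul_le_mul_left ?_ h0
      calc _ = r' * ‖E B (x n)‖ ^ 2 := by ring
        _ ≤ _ := e3.trans e4
  have hr' : 0 < r' := hr.trans hrr
  have grow : ∀ n, r' ^ n * ‖E B (x 0)‖ ≤ ‖E B (x n)‖ := by
    intro n
    induction n with
    | zero => simp
    | succ n ih =>
      calc r' ^ (n + 1) * ‖E B (x 0)‖ = r' * (r' ^ n * ‖E B (x 0)‖) := by ring
        _ ≤ r' * ‖E B (x n)‖ := by gcongr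
        _ ≤ _ := step n
  have bd : ∀ n, ‖E B (x 0)‖ ≤ (‖E B‖ * C) * (r / r') ^ n := by
    intro n
    rw [div_pow, ← mul_div_assoc, le_div_iff₀ (by positivity), mul_comm]
    calc _ ≤ ‖E B (x n)‖ := grow n
      _ ≤ ‖E B‖ * ‖x n‖ := ContinuousLinearMap.le_opNorm _ _
      _ ≤ ‖E B‖ * (C * r ^ n) := by gcongr; exact hb n
      _ = _ := by ring
  have lim : Tendsto (fun n : ℕ => (‖E B‖ * C) * (r / r') ^ n) atTop (𝓝 ((‖E B‖ * C) * 0)) :=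
    (tendsto_pow_atTop_nhds_zero_of_lt_one (by positivity)
      ((div_lt_one hr').2 hrr)).const_mul _
  have := ge_of_tendsto' lim bd
  rw [mul_zero] at this
  exact norm_le_zero_iff.1 this

/-- A vector on which the powers of `A - c` grow at most like `r ^ n` lies in the spectral
subspace of `[c - r, c + r]`. -/
theorem apply_Icc_eq_self_of_growth (h : IsSpectralMeasureOf E A)
    (hd : Dense (A.domain : Set H)) {c r C : ℝ} (hr : 0 < r)
    (x : ℕ → H) (hx : ∀ n, x n ∈ A.domain) (hs : ∀ n, A ⟨x n, hx n⟩ - (c : ℂ) • x n = x (n + 1))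
    (hb : ∀ n, ‖x n‖ ≤ C * r ^ n) : E (Icc (c - r) (c + r)) (x 0) = x 0 := by
  obtain ⟨hE, hdom, hin⟩ := id h
  have hpos : ∀ k : ℕ, (0 : ℝ) < 1 / (k + 1) := fun k => by positivity
  -- The growth argument needs r' > r strictly. The half-lines at distance r + 1/(k+1) from c still
  -- exhaust the complement of the closed interval.
  have hU : ∀ k : ℕ, hE.measure (x 0) (Ici (c + (r + 1 / (k + 1)))) = 0 := fun k =>
    (hE.apply_eq_zero_iff measurableSet_Ici _).1
      (h.apply_eq_zero_of_growth hd hr (r' := r + 1 / (k + 1)) (by linarith [hpos k]) measurableSet_Ici (ε := 1) (by simp)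
        (fun t ht => by rw [mem_Ici] at ht; linarith) x hx hs hb)
  have hL : ∀ k : ℕ, hE.measure (x 0) (Iic (c - (r + 1 / (k + 1)))) = 0 := fun k =>
    (hE.apply_eq_zero_iff measurableSet_Iic _).1
      (h.apply_eq_zero_of_growth hd hr (r' := r + 1 / (k + 1)) (by linarith [hpos k]) measurableSet_Iic (ε := -1) (by simp)
        (fun t ht => by rw [mem_Iic] at ht; linarith) x hx hs hb)
  have hc : hE.measure (x 0) (Icc (c - r) (c + r))ᶜ = 0 := by
    refine measure_mono_null ?_ (measure_union_null (measure_iUnion_null hU)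
      (measure_iUnion_null hL))
    intro t ht
    simp only [mem_compl_iff, mem_Icc, not_and_or, not_le] at ht
    rcases ht with ht | ht
    · right
      obtain ⟨k, hk⟩ := exists_nat_one_div_lt (sub_pos.2 ht)
      exact mem_iUnion.2 ⟨k, by rw [mem_Iic]; linarith⟩
    · left
      obtain ⟨k, hk⟩ := exists_nat_one_div_lt (sub_pos.2 ht)
      exact mem_iUnion.2 ⟨k, by rw [mem_Ici]; linarith⟩
  have h0 := (hE.apply_eq_zero_iff measurableSet_Icc.compl _).2 hc
  have := hE.add_compl (B := Icc (c - r) (c + r)) measurableSet_Icc (x 0)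
  rwa [h0, add_zero] at this

end IsSpectralMeasureOf

end SpectralUniqueness

/-! ### The bilinear pairing on `L²` of the half-line -/

/-- The class in `L²` of the half-line of a square-integrable function (and `0` for other
functions). -/
def toL2Half (u : ℝ → ℂ) : L2Half :=
  open Classical in if h : MemLp u 2 halfLine then h.toLp u else 0

theorem coeFn_toL2Half {u : ℝ → ℂ} (h : MemLp u 2 halfLine) : toL2Half u =ᵐ[halfLine] u := by
  rw [toL2Half, dif_pos h]; exact h.coeFn_toLp

theorem toL2Half_eq_of_ae {u : ℝ → ℂ} {f : L2Half} (h : f =ᵐ[halfLine] u) : toL2Half u = f :=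
  Lp.ext ((coeFn_toL2Half ((memLp_congr_ae h).1 (Lp.memLp f))).trans h.symm)

theorem toL2Half_congr {u v : ℝ → ℂ} (h : u =ᵐ[halfLine] v) : toL2Half u = toL2Half v := by
  by_cases hu : MemLp u 2 halfLine
  · exact (toL2Half_eq_of_ae ((coeFn_toL2Half hu).trans h)).symm
  · rw [toL2Half, toL2Half, dif_neg hu, dif_neg (fun hv => hu ((memLp_congr_ae h).2 hv))]

theorem toL2Half_smul (c : ℂ) {u : ℝ → ℂ} (h : MemLp u 2 halfLine) :
    toL2Half (fun x => c * u x) = c • toL2Half u := by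
  refine toL2Half_eq_of_ae ?_
  filter_upwards [Lp.coeFn_smul c (toL2Half u), coeFn_toL2Half h] with x h1 h2
  rw [h1, Pi.smul_apply, h2, smul_eq_mul]

theorem toL2Half_sub {u v : ℝ → ℂ} (hu : MemLp u 2 halfLine) (hv : MemLp v 2 halfLine) :
    toL2Half (fun x => u x - v x) = toL2Half u - toL2Half v := by
  refine toL2Half_eq_of_ae ?_
  filter_upwards [Lp.coeFn_sub (toL2Half u) (toL2Half v), coeFn_toL2Half hu,
    coeFn_toL2Half hv] with x h1 h2 h3
  rw [h1, Pi.sub_apply, h2, h3]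

theorem ae_halfLine_of_forall {P : ℝ → Prop} (h : ∀ x, 0 < x → P x) : ∀ᵐ x ∂halfLine, P x :=
  (ae_restrict_iff' measurableSet_Ioi).2 (Eventually.of_forall h)

/-- The bilinear pairing `∫₀^∞ f g`, continuous in the first variable. -/
def pairing (g : L2Half) : L2Half →L[ℂ] ℂ := innerSL ℂ (star g)

theorem pairing_apply (g f : L2Half) : pairing g f = ∫ x, f x * g x ∂halfLine := by
  rw [pairing, innerSL_apply_apply, L2.inner_def]
  refine integral_congr_ae ?_
  filter_upwards [Lp.coeFn_star g] with x hx
  rw [hx, RCLike.inner_apply, Pi.star_apply]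
  simp

theorem pairing_comm (f g : L2Half) : pairing g f = pairing f g := by
  simp only [pairing_apply, mul_comm]

theorem integrable_coeFn_mul (f g : L2Half) : Integrable (fun x => f x * g x) halfLine :=
  (Lp.memLp f).integrable_mul (Lp.memLp g)

theorem pairing_toL2Half {u v : ℝ → ℂ} (hu : MemLp u 2 halfLine) (hv : MemLp v 2 halfLine) :
    pairing (toL2Half u) (toL2Half v) = ∫ x, v x * u x ∂halfLine := by
  rw [pairing_apply]
  refine integral_congr_ae ?_
  filter_upwards [coeFn_toL2Half hu, coeFn_toL2Half hv] with x h1 h2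
  rw [h1, h2]

theorem pairing_toL2Half_right {u : ℝ → ℂ} (hu : MemLp u 2 halfLine) (f : L2Half) :
    pairing (toL2Half u) f = ∫ x, f x * u x ∂halfLine := by
  rw [pairing_apply]
  refine integral_congr_ae ?_
  filter_upwards [coeFn_toL2Half hu] with x h1
  rw [h1]

/-! ### Gaussians times powers -/

/-- The function `x ^ p exp (- s x² / 2)`. -/
def gaussPow (p : ℂ) (s x : ℝ) : ℂ := (x : ℂ) ^ p * (Real.exp (-(s / 2) * x ^ 2) : ℂ)

theorem continuousOn_cpow_Ioi (p : ℂ) : ContinuousOn (fun x : ℝ => (x : ℂ) ^ p) (Ioi 0) :=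
  fun _ hx => (Complex.continuous_ofReal.continuousAt.cpow continuousAt_const
    (Complex.ofReal_mem_slitPlane.2 hx)).continuousWithinAt

theorem continuousOn_gaussPow (p : ℂ) (s : ℝ) : ContinuousOn (gaussPow p s) (Ioi 0) :=
  (continuousOn_cpow_Ioi p).mul (by fun_prop)

theorem aestronglyMeasurable_gaussPow (p : ℂ) (s : ℝ) :
    AEStronglyMeasurable (gaussPow p s) halfLine :=
  (continuousOn_gaussPow p s).aestronglyMeasurable measurableSet_Ioi

theorem norm_gaussPow (p : ℂ) (s : ℝ) {x : ℝ} (hx : 0 < x) :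
    ‖gaussPow p s x‖ = x ^ p.re * Real.exp (-(s / 2) * x ^ 2) := by
  rw [gaussPow, norm_mul, Complex.norm_cpow_eq_rpow_re_of_pos hx, Complex.norm_real,
    Real.norm_of_nonneg (Real.exp_pos _).le]

theorem gaussPow_mul_gaussPow (p q : ℂ) (s t : ℝ) {x : ℝ} (hx : 0 < x) :
    gaussPow p s x * gaussPow q t x = gaussPow (p + q) (s + t) x := by
  have hx0 : (x : ℂ) ≠ 0 := by exact_mod_cast hx.ne'
  have : -((s + t) / 2) * x ^ 2 = -(s / 2) * x ^ 2 + -(t / 2) * x ^ 2 := by ring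
  simp only [gaussPow]
  rw [Complex.cpow_add _ _ hx0, this, Real.exp_add]
  push_cast
  ring

theorem gaussPow_add_two (p : ℂ) (s : ℝ) {x : ℝ} (hx : 0 < x) :
    gaussPow (p + 2) s x = (x : ℂ) ^ 2 * gaussPow p s x := by
  have hx0 : (x : ℂ) ≠ 0 := by exact_mod_cast hx.ne'
  simp only [gaussPow]
  rw [Complex.cpow_add _ _ hx0]
  norm_cast
  push_cast
  ring

theorem integrable_gaussPow {p : ℂ} {s : ℝ} (hp : -1 < p.re) (hs : 0 < s) :
    Integrable (gaussPow p s) halfLine := by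
  have h := integrableOn_rpow_mul_exp_neg_mul_sq (half_pos hs) hp
  refine Integrable.mono' h (aestronglyMeasurable_gaussPow p s) ?_
  exact ae_halfLine_of_forall fun x hx => (norm_gaussPow p s hx).le

theorem memLp_gaussPow {p : ℂ} {s : ℝ} (hp : -1 / 2 < p.re) (hs : 0 < s) :
    MemLp (gaussPow p s) 2 halfLine := by
  rw [memLp_two_iff_integrable_sq_norm (aestronglyMeasurable_gaussPow p s)]
  have h := (integrable_gaussPow (p := p + p) (s := s + s)
    (by rw [Complex.add_re]; linarith) (by linarith)).norm
  refine h.congr (ae_halfLine_of_forall fun x hx => ?_)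
  simp only [← gaussPow_mul_gaussPow p p s s hx, norm_mul]; ring

/-- Euler's integral after the substitution x²; the exponent is written 2w - 1 so that Gamma appears
at w. -/
theorem integral_gaussPow {w : ℂ} {s : ℝ} (hw : 0 < w.re) (hs : 0 < s) :
    ∫ x, gaussPow (2 * w - 1) s x ∂halfLine = 1 / 2 * (2 / s : ℝ) ^ w * Complex.Gamma w := by
  have h1 := Complex.integral_cpow_mul_exp_neg_mul_Ioi hw (half_pos hs)
  rw [← integral_comp_rpow_Ioi _ (two_ne_zero)] at h1
  have h2 : ∫ x in Ioi (0 : ℝ), (|(2 : ℝ)| * x ^ ((2 : ℝ) - 1)) •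
      (((x ^ (2 : ℝ) : ℝ) : ℂ) ^ (w - 1) *
        Complex.exp (-(((s / 2 : ℝ) : ℂ) * ((x ^ (2 : ℝ) : ℝ) : ℂ))))
      = ∫ x in Ioi (0 : ℝ), 2 * gaussPow (2 * w - 1) s x := by
    refine setIntegral_congr_fun measurableSet_Ioi fun x hx => ?_
    have hx' : (0 : ℝ) < x := hx
    have hx0 : (x : ℂ) ≠ 0 := by exact_mod_cast hx'.ne'
    have e1 : ((x ^ (2 : ℝ) : ℝ) : ℂ) ^ (w - 1) = (x : ℂ) ^ (w - 1) * (x : ℂ) ^ (w - 1) := by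
      rw [← Complex.mul_cpow_ofReal_nonneg hx'.le hx'.le, Real.rpow_two, sq]
      push_cast; rfl
    have e2 : (x : ℂ) ^ (2 * w - 1) = x * ((x : ℂ) ^ (w - 1) * (x : ℂ) ^ (w - 1)) := by
      rw [← Complex.cpow_add _ _ hx0, show 2 * w - 1 = 1 + (w - 1 + (w - 1)) by ring,
        Complex.cpow_add _ _ hx0, Complex.cpow_one]
    have e3 : x ^ ((2 : ℝ) - 1) = x := by norm_num
    simp only [gaussPow]
    rw [e1, e2, e3, Real.rpow_two, Complex.real_smul]
    push_cast
    rw [abs_of_pos (two_pos : (0 : ℝ) < 2)]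
    push_cast
    ring_nf
  rw [h2, integral_const_mul] at h1
  have h3 : (1 / ((s / 2 : ℝ) : ℂ)) = ((2 / s : ℝ) : ℂ) := by
    push_cast; rw [one_div_div]
  rw [h3] at h1
  linear_combination (1 / 2 : ℂ) * h1

/-! ### Uniqueness of Gaussian (Laplace) transforms -/

/-- This is φ in the variable y = exp(-x²), prepared for Weierstrass approximation on [0,1]. It
vanishes for small y > 0 because the support is bounded. At y = 0 its value is φ 0 = 0, because
`Real.log 0 = 0`. -/
theorem continuousOn_comp_sqrt_neg_log {φ : ℝ → ℝ} (hφ : Continuous φ) (hc : HasCompactSupport φ)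
    (hs : tsupport φ ⊆ Ioi 0) : ContinuousOn (fun y => φ √(-Real.log y)) (Icc 0 1) := by
  intro y hy
  rcases hy.1.eq_or_lt with rfl | hy0
  · obtain ⟨R, hR⟩ := hc.isCompact.bddAbove
    have h0 : φ 0 = 0 := image_eq_zero_of_notMem_tsupport fun h => lt_irrefl (0 : ℝ) (hs h)
    have hz : ∀ x, R < x → φ x = 0 := fun x hx =>
      image_eq_zero_of_notMem_tsupport fun h => absurd (hR h) (not_le.2 hx)
    have hev : (fun y => φ √(-Real.log y)) =ᶠ[𝓝[Icc 0 1] 0] fun _ => 0 := by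
      have : ∀ᶠ y in 𝓝[Icc (0 : ℝ) 1] 0, y < Real.exp (-(|R| + 1) ^ 2) :=
        mem_nhdsWithin_of_mem_nhds (Iio_mem_nhds (Real.exp_pos _))
      filter_upwards [this, self_mem_nhdsWithin] with y hy1 hy2
      rcases hy2.1.eq_or_lt with rfl | hy0
      · simpa using h0
      · refine hz _ (Real.lt_sqrt_of_sq_lt ?_ |>.trans_le' (by linarith [le_abs_self R] : R ≤ |R| + 1))
        have := (Real.log_lt_iff_lt_exp hy0).2 hy1
        linarith
    exact continuousWithinAt_const.congr_of_eventuallyEq hev (by simpa using h0)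
  · exact (hφ.continuousAt.comp (Real.continuous_sqrt.continuousAt.comp
      (Real.continuousAt_log hy0.ne').neg)).continuousWithinAt

/-- Uniqueness of Laplace transforms through Weierstrass. Put k = h exp(-s₀x²/2), which is
integrable, and y = exp(-x²). The values s = s₀ + 2n say that k annihilates every y^n, hence every
polynomial in y. These approximate test functions uniformly on [0,1], so k annihilates test
functions. Square integrability of h is not required, and only large s enter. -/
theorem ae_eq_zero_of_integral_mul_exp_eq_zero {h : ℝ → ℂ} {s₀ : ℝ}
    (hi : Integrable (fun x => h x * (Real.exp (-(s₀ / 2) * x ^ 2) : ℂ)) halfLine)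
    (h0 : ∀ s, s₀ ≤ s → ∫ x, h x * (Real.exp (-(s / 2) * x ^ 2) : ℂ) ∂halfLine = 0) :
    h =ᵐ[halfLine] 0 := by
  set k : ℝ → ℂ := fun x => h x * (Real.exp (-(s₀ / 2) * x ^ 2) : ℂ) with hk
  have hbd : ∀ {g : ℝ → ℝ}, AEStronglyMeasurable g halfLine → ∀ {C : ℝ},
      (∀ x, 0 < x → |g x| ≤ C) → Integrable (fun x => k x * (g x : ℂ)) halfLine := by
    intro g hg C hC
    have := hi.bdd_mul (c := C) (Complex.continuous_ofReal.comp_aestronglyMeasurable hg)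
      (ae_halfLine_of_forall fun x hx => by
        simpa [Complex.norm_real] using hC x hx)
    refine this.congr (Eventually.of_forall fun x => mul_comm _ _)
  have hpow : ∀ n : ℕ, ∫ x, k x * ((Real.exp (-x ^ 2)) ^ n : ℝ) ∂halfLine = 0 := by
    intro n
    rw [← h0 (s₀ + 2 * n) (by have := n.cast_nonneg (α := ℝ); linarith)]
    refine integral_congr_ae (Eventually.of_forall fun x => ?_)
    simp only [hk]
    rw [mul_assoc, ← Complex.ofReal_mul, ← Real.exp_nat_mul, ← Real.exp_add]
    congr 3
    ring
  have hexp : ∀ x : ℝ, Real.exp (-x ^ 2) ∈ Icc (0 : ℝ) 1 := fun x =>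
    ⟨(Real.exp_pos _).le, Real.exp_le_one_iff.2 (neg_nonpos.2 (sq_nonneg x))⟩
  have hpbd : ∀ p : Polynomial ℝ, ∃ C, ∀ x : ℝ, |p.eval (Real.exp (-x ^ 2))| ≤ C := by
    intro p
    obtain ⟨C, hC⟩ := isCompact_Icc.exists_bound_of_continuousOn (s := Icc (0 : ℝ) 1)
      p.continuous.continuousOn
    exact ⟨C, fun x => hC _ (hexp x)⟩
  have hpm : ∀ p : Polynomial ℝ,
      AEStronglyMeasurable (fun x : ℝ => p.eval (Real.exp (-x ^ 2))) halfLine := fun p =>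
    (p.continuous.comp (by fun_prop)).aestronglyMeasurable
  have hpoly : ∀ p : Polynomial ℝ,
      ∫ x, k x * (p.eval (Real.exp (-x ^ 2)) : ℝ) ∂halfLine = 0 := by
    intro p
    induction p using Polynomial.induction_on' with
    | add p q hp hq =>
      obtain ⟨C, hC⟩ := hpbd p
      obtain ⟨D, hD⟩ := hpbd q
      have := integral_add (hbd (hpm p) (fun x _ => hC x)) (hbd (hpm q) (fun x _ => hD x))
      rw [hp, hq, add_zero] at this
      rw [← this]
      refine integral_congr_ae (Eventually.of_forall fun x => ?_)
      simp only [Polynomial.eval_add]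
      push_cast; ring
    | monomial n a =>
      have := congrArg (fun z => (a : ℂ) * z) (hpow n)
      simp only [mul_zero] at this
      rw [← this, ← integral_const_mul]
      refine integral_congr_ae (Eventually.of_forall fun x => ?_)
      simp only [Polynomial.eval_monomial]
      push_cast; ring
  have htest : ∀ φ : ℝ → ℝ, Continuous φ → HasCompactSupport φ → tsupport φ ⊆ Ioi 0 →
      ∫ x, k x * (φ x : ℂ) ∂halfLine = 0 := by
    intro φ hφ hc hs
    have hsq : ∀ x : ℝ, 0 < x → φ √(-Real.log (Real.exp (-x ^ 2))) = φ x := by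
      intro x hx
      rw [Real.log_exp, neg_neg, Real.sqrt_sq hx.le]
    obtain ⟨D, hD⟩ := hφ.bounded_above_of_compact_support hc
    have hle : ∀ ε > 0, ‖∫ x, k x * (φ x : ℂ) ∂halfLine‖ ≤ ε * ∫ x, ‖k x‖ ∂halfLine := by
      intro ε hε
      obtain ⟨p, hp⟩ := exists_polynomial_near_of_continuousOn 0 1 _
        (continuousOn_comp_sqrt_neg_log hφ hc hs) ε hε
      obtain ⟨C, hC⟩ := hpbd p
      have i1 := hbd hφ.aestronglyMeasurable (fun x _ => hD x)
      have i2 := hbd (hpm p) (fun x _ => hC x)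
      have e : ∫ x, k x * (φ x : ℂ) ∂halfLine = ∫ x, (k x * (φ x : ℂ) -
          k x * (p.eval (Real.exp (-x ^ 2)) : ℝ)) ∂halfLine := by
        rw [integral_sub i1 i2, hpoly, sub_zero]
      rw [e, ← integral_const_mul]
      refine norm_integral_le_of_norm_le (hi.norm.const_mul ε) (ae_halfLine_of_forall ?_)
      intro x hx
      have := hp _ (hexp x)
      rw [hsq x hx] at this
      rw [← mul_sub, norm_mul, mul_comm, ← Complex.ofReal_sub, Complex.norm_real, Real.norm_eq_abs,
        abs_sub_comm]
      gcongr
    have hlim : Tendsto (fun ε : ℝ => ε * ∫ x, ‖k x‖ ∂halfLine) (𝓝[>] 0) (𝓝 0) := by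
      have : Tendsto (fun ε : ℝ => ε * ∫ x, ‖k x‖ ∂halfLine) (𝓝 0)
          (𝓝 (0 * ∫ x, ‖k x‖ ∂halfLine)) := (continuous_id.mul continuous_const).tendsto 0
      rw [zero_mul] at this
      exact this.mono_left nhdsWithin_le_nhds
    have := ge_of_tendsto hlim (by filter_upwards [self_mem_nhdsWithin] with ε hε using hle ε hε)
    exact norm_le_zero_iff.1 this
  have hae := isOpen_Ioi.ae_eq_zero_of_integral_contDiff_smul_eq_zero (f := k) (U := Ioi (0 : ℝ))
    (μ := volume) (IntegrableOn.locallyIntegrableOn hi) (by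
      intro φ hφ hc hs
      rw [← setIntegral_eq_integral_of_forall_compl_eq_zero (s := Ioi 0)]
      · rw [← htest φ hφ.continuous hc hs]
        refine integral_congr_ae (Eventually.of_forall fun x => ?_)
        simp [mul_comm]
      · intro x hx
        have : φ x = 0 := image_eq_zero_of_notMem_tsupport (fun h => hx (hs h))
        simp [this])
  filter_upwards [(ae_restrict_iff' measurableSet_Ioi).2 hae] with x hx
  simpa [hk, (Real.exp_pos _).ne'] using hx

theorem ae_eq_zero_of_integral_mul_gaussPow_eq_zero {h : ℝ → ℂ} {p : ℂ} {s₀ : ℝ}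
    (hi : Integrable (fun x => h x * gaussPow p s₀ x) halfLine)
    (h0 : ∀ s, s₀ ≤ s → ∫ x, h x * gaussPow p s x ∂halfLine = 0) :
    h =ᵐ[halfLine] 0 := by
  have := ae_eq_zero_of_integral_mul_exp_eq_zero (h := fun x => h x * (x : ℂ) ^ p) (s₀ := s₀)
    (by simpa only [gaussPow, mul_assoc] using hi)
    (fun s hs => by simpa only [gaussPow, mul_assoc] using h0 s hs)
  filter_upwards [this, ae_restrict_mem measurableSet_Ioi] with x hx hx0
  have hx0' : (x : ℂ) ≠ 0 := by exact_mod_cast (ne_of_gt hx0)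
  have : (x : ℂ) ^ p ≠ 0 := by simp [Complex.cpow_eq_zero_iff, hx0']
  simpa [this] using hx

/-- The class of `x ^ p exp (- s x² / 2)` in `L²` of the half-line. -/
def gaussL2 (p : ℂ) (s : ℝ) : L2Half := toL2Half (gaussPow p s)

theorem coeFn_gaussL2 {p : ℂ} {s : ℝ} (hp : -1 / 2 < p.re) (hs : 0 < s) :
    gaussL2 p s =ᵐ[halfLine] gaussPow p s := coeFn_toL2Half (memLp_gaussPow hp hs)

theorem L2Half.ext_of_pairing_gaussL2 {p : ℂ} (hp : -1 / 2 < p.re) {f g : L2Half}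
    (h : ∀ s, 0 < s → pairing (gaussL2 p s) f = pairing (gaussL2 p s) g) : f = g := by
  rw [← sub_eq_zero]
  have h1 : ∀ s, 0 < s → ∫ x, (f - g : L2Half) x * gaussPow p s x ∂halfLine = 0 := by
    intro s hs
    rw [← pairing_toL2Half_right (memLp_gaussPow hp hs), map_sub, sub_eq_zero]
    exact h s hs
  have h2 := ae_eq_zero_of_integral_mul_gaussPow_eq_zero (s₀ := 1)
    ((Lp.memLp (f - g)).integrable_mul (memLp_gaussPow hp one_pos))
    (fun s hs => h1 s (one_pos.trans_le hs))
  exact Lp.ext (h2.trans (Lp.coeFn_zero ..).symm)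

/-- The conjugate of a vector orthogonal to S annihilates S in the bilinear pairing. -/
theorem dense_span_of_pairing {S : Set L2Half}
    (h : ∀ f : L2Half, (∀ g ∈ S, pairing g f = 0) → f = 0) :
    Dense (Submodule.span ℂ S : Set L2Half) := by
  rw [Submodule.dense_iff_topologicalClosure_eq_top, Submodule.topologicalClosure_eq_top_iff,
    Submodule.eq_bot_iff]
  intro f hf
  have h0 : star f = 0 := by
    refine h (star f) fun g hg => ?_
    rw [pairing_comm, pairing, star_star, innerSL_apply_apply]
    exact Submodule.inner_left_of_mem_orthogonal (Submodule.subset_span hg) hf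
  refine Lp.ext ?_
  filter_upwards [Lp.coeFn_star f, Lp.coeFn_zero ℂ 2 halfLine] with x h1 h2
  rw [h0, h2, Pi.zero_apply, Pi.star_apply] at h1
  rw [h2, Pi.zero_apply, ← star_eq_zero, ← h1]

theorem dense_span_gaussL2 {p : ℂ} (hp : -1 / 2 < p.re) :
    Dense (Submodule.span ℂ (gaussL2 p '' Ioi 0) : Set L2Half) :=
  dense_span_of_pairing fun f hf => L2Half.ext_of_pairing_gaussL2 hp fun s hs => by
    rw [hf _ ⟨s, hs, rfl⟩, map_zero]

theorem pairing_gaussL2 {p q w : ℂ} {s t : ℝ} (hp : -1 / 2 < p.re) (hq : -1 / 2 < q.re)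
    (hs : 0 < s) (ht : 0 < t) (hw : p + q = 2 * w - 1) :
    pairing (gaussL2 p s) (gaussL2 q t) =
      1 / 2 * (2 / (s + t) : ℝ) ^ w * Complex.Gamma w := by
  have hw0 : 0 < w.re := by
    have := congrArg Complex.re hw
    simp at this
    linarith
  rw [gaussL2, gaussL2, pairing_toL2Half (memLp_gaussPow hp hs) (memLp_gaussPow hq ht),
    ← integral_gaussPow hw0 (add_pos hs ht)]
  refine integral_congr_ae (ae_halfLine_of_forall fun x hx => ?_)
  simp only
  rw [mul_comm, gaussPow_mul_gaussPow p q s t hx, hw]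

/-! ### Weighted composition operators on `L²` -/

section WeightedComp

open scoped NNReal

variable {μ ν : Measure ℝ} {w : ℝ → ℂ} {σ : ℝ → ℝ} {C : ℝ≥0}

theorem memLp_weightedComp (hw : AEStronglyMeasurable w ν)
    (hσ : Measure.QuasiMeasurePreserving σ ν μ)
    (hb : ∀ f : ℝ → ℂ, AEStronglyMeasurable f μ →
      eLpNorm (fun x => w x * f (σ x)) 2 ν ≤ C * eLpNorm f 2 μ) (f : Lp ℂ 2 μ) :
    MemLp (fun x => w x * f (σ x)) 2 ν :=
  ⟨hw.mul ((Lp.aestronglyMeasurable f).comp_quasiMeasurePreserving hσ),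
    (hb f (Lp.aestronglyMeasurable f)).trans_lt
      (ENNReal.mul_lt_top ENNReal.coe_lt_top (Lp.memLp f).2)⟩

variable (w σ C) in
/-- The weighted composition operator `f ↦ w · (f ∘ σ)` on `L²`. -/
def weightedComp (hw : AEStronglyMeasurable w ν)
    (hσ : Measure.QuasiMeasurePreserving σ ν μ)
    (hb : ∀ f : ℝ → ℂ, AEStronglyMeasurable f μ →
      eLpNorm (fun x => w x * f (σ x)) 2 ν ≤ C * eLpNorm f 2 μ) : Lp ℂ 2 μ →L[ℂ] Lp ℂ 2 ν :=
  LinearMap.mkContinuous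
    { toFun := fun f => (memLp_weightedComp hw hσ hb f).toLp _
      map_add' := by
        intro f g
        rw [← MemLp.toLp_add]
        refine (MemLp.toLp_eq_toLp_iff _ _).2 ?_
        filter_upwards [hσ.ae (Lp.coeFn_add f g)] with x hx
        simp only [Pi.add_apply]
        rw [hx, Pi.add_apply, mul_add]
      map_smul' := by
        intro c f
        rw [RingHom.id_apply, ← MemLp.toLp_const_smul]
        refine (MemLp.toLp_eq_toLp_iff _ _).2 ?_
        filter_upwards [hσ.ae (Lp.coeFn_smul c f)] with x hx
        simp only [Pi.smul_apply, smul_eq_mul]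
        rw [hx, Pi.smul_apply, smul_eq_mul]
        ring }
    C (by
      intro f
      simp only [LinearMap.coe_mk, AddHom.coe_mk]
      rw [Lp.norm_toLp, Lp.norm_def, ← ENNReal.coe_toReal, ← ENNReal.toReal_mul]
      exact ENNReal.toReal_mono
        (ENNReal.mul_lt_top ENNReal.coe_lt_top (Lp.memLp f).2).ne
        (hb f (Lp.aestronglyMeasurable f)))

theorem coeFn_weightedComp (hw : AEStronglyMeasurable w ν)
    (hσ : Measure.QuasiMeasurePreserving σ ν μ)
    (hb : ∀ f : ℝ → ℂ, AEStronglyMeasurable f μ →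
      eLpNorm (fun x => w x * f (σ x)) 2 ν ≤ C * eLpNorm f 2 μ) {f : Lp ℂ 2 μ} {u : ℝ → ℂ}
    (hu : f =ᵐ[μ] u) :
    weightedComp w σ C hw hσ hb f =ᵐ[ν] fun x => w x * u (σ x) := by
  refine (MemLp.coeFn_toLp (memLp_weightedComp hw hσ hb f)).trans ?_
  filter_upwards [hσ.ae hu] with x hx
  rw [hx]

variable (w) in
theorem eLpNorm_mul_le_of_bound (hC : ∀ᵐ x ∂μ, ‖w x‖ ≤ C) (f : ℝ → ℂ) :
    eLpNorm (fun x => w x * f (id x)) 2 μ ≤ C * eLpNorm f 2 μ := by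
  refine (eLpNorm_le_nnreal_smul_eLpNorm_of_ae_le_mul (c := C) ?_ 2).trans_eq rfl
  filter_upwards [hC] with x hx
  rw [nnnorm_mul]
  exact mul_le_mul' (by exact_mod_cast hx) le_rfl

end WeightedComp

/-- Multiplication by a bounded measurable function on `L²`. -/
def boundedMul {μ : Measure ℝ} (w : ℝ → ℂ) (C : NNReal) (hw : AEStronglyMeasurable w μ)
    (hC : ∀ᵐ x ∂μ, ‖w x‖ ≤ C) : Lp ℂ 2 μ →L[ℂ] Lp ℂ 2 μ :=
  weightedComp w id C hw (Measure.QuasiMeasurePreserving.id μ)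
    (fun f _ => eLpNorm_mul_le_of_bound w hC f)

theorem coeFn_boundedMul {μ : Measure ℝ} {w : ℝ → ℂ} {C : NNReal} (hw : AEStronglyMeasurable w μ)
    (hC : ∀ᵐ x ∂μ, ‖w x‖ ≤ C) {f : Lp ℂ 2 μ} {u : ℝ → ℂ} (hu : f =ᵐ[μ] u) :
    boundedMul w C hw hC f =ᵐ[μ] fun x => w x * u x :=
  coeFn_weightedComp hw _ _ hu

/-! ### Logarithmic change of variables -/

theorem lintegral_exp_mul_comp_exp (g : ℝ → ℝ≥0∞) :
    ∫⁻ v, ENNReal.ofReal (Real.exp v) * g (Real.exp v) = ∫⁻ x, g x ∂halfLine := by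
  have h := lintegral_image_eq_lintegral_abs_deriv_mul (s := univ) MeasurableSet.univ
    (fun x _ => (Real.hasDerivAt_exp x).hasDerivWithinAt) Real.exp_injective.injOn g
  rw [image_univ, Real.range_exp, setLIntegral_univ] at h
  simp only [abs_of_pos (Real.exp_pos _)] at h
  exact h.symm

theorem integral_exp_smul_comp_exp (g : ℝ → ℂ) :
    ∫ v, (Real.exp v : ℂ) * g (Real.exp v) = ∫ x, g x ∂halfLine := by
  have h := integral_image_eq_integral_abs_deriv_smul (s := univ) MeasurableSet.univ
    (fun x _ => (Real.hasDerivAt_exp x).hasDerivWithinAt) Real.exp_injective.injOn g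
  rw [image_univ, Real.range_exp, setIntegral_univ] at h
  simp only [abs_of_pos (Real.exp_pos _), Complex.real_smul] at h
  exact h.symm

theorem integrable_exp_smul_comp_exp {g : ℝ → ℂ} (hg : Integrable g halfLine) :
    Integrable (fun v => (Real.exp v : ℂ) * g (Real.exp v)) := by
  have h := integrableOn_image_iff_integrableOn_abs_deriv_smul (s := univ) MeasurableSet.univ
    (fun x _ => (Real.hasDerivAt_exp x).hasDerivWithinAt) Real.exp_injective.injOn g
  rw [image_univ, Real.range_exp, integrableOn_univ] at h
  simp only [abs_of_pos (Real.exp_pos _), Complex.real_smul] at h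
  exact h.1 hg

theorem quasiMeasurePreserving_exp :
    Measure.QuasiMeasurePreserving Real.exp volume halfLine := by
  refine ⟨Real.measurable_exp, Measure.AbsolutelyContinuous.mk fun N hN h0 => ?_⟩
  rw [Measure.map_apply Real.measurable_exp hN]
  have h := lintegral_exp_mul_comp_exp (N.indicator 1)
  rw [lintegral_indicator_one hN, h0, lintegral_eq_zero_iff (by
    refine Measurable.mul (by fun_prop) ((measurable_one.indicator hN).comp Real.measurable_exp))]
    at h
  refine measure_mono_null ?_ h
  intro v hv hv'
  have hv1 : Real.exp v ∈ N := hv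
  have h1 : ENNReal.ofReal (Real.exp v) * N.indicator 1 (Real.exp v) = 0 := hv'
  rw [indicator_of_mem hv1, Pi.one_apply, mul_one, ENNReal.ofReal_eq_zero] at h1
  exact absurd (Real.exp_pos v) (not_lt.2 h1)

theorem quasiMeasurePreserving_log :
    Measure.QuasiMeasurePreserving Real.log halfLine volume := by
  refine ⟨Real.measurable_log, Measure.AbsolutelyContinuous.mk fun N hN h0 => ?_⟩
  rw [Measure.map_apply Real.measurable_log hN,
    ← lintegral_indicator_one (Real.measurable_log hN), ← lintegral_exp_mul_comp_exp]
  refine (lintegral_congr_ae ?_).trans lintegral_zero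
  have : ∀ᵐ v : ℝ, v ∉ N := measure_eq_zero_iff_ae_notMem.1 h0
  filter_upwards [this] with v hv
  simp [hv]

theorem enorm_rpow_two (z : ℂ) : ‖z‖ₑ ^ (2 : ℝ) = ENNReal.ofReal (‖z‖ ^ 2) := by
  rw [← ofReal_norm, ENNReal.ofReal_rpow_of_nonneg (norm_nonneg _) two_pos.le, Real.rpow_two]

theorem eLpNorm_two_eq {μ : Measure ℝ} (f : ℝ → ℂ) :
    eLpNorm f 2 μ = (∫⁻ x, ENNReal.ofReal (‖f x‖ ^ 2) ∂μ) ^ (1 / 2 : ℝ) := by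
  rw [eLpNorm_eq_lintegral_rpow_enorm_toReal two_ne_zero ENNReal.ofNat_ne_top]
  simp only [ENNReal.toReal_ofNat, enorm_rpow_two]

theorem eLpNorm_exp_half_mul_comp_exp (f : ℝ → ℂ) :
    eLpNorm (fun v => (Real.exp (v / 2) : ℂ) * f (Real.exp v)) 2 volume = eLpNorm f 2 halfLine := by
  rw [eLpNorm_two_eq, eLpNorm_two_eq, ← lintegral_exp_mul_comp_exp]
  congr 1
  refine lintegral_congr fun v => ?_
  rw [← ENNReal.ofReal_mul (Real.exp_pos _).le, norm_mul, mul_pow, Complex.norm_real,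
    Real.norm_of_nonneg (Real.exp_pos _).le, ← Real.exp_nat_mul]
  congr 3
  push_cast; ring_nf

/-- The unitary change of variables `f ↦ e^(v/2) f(e^v)`. -/
def toLogVar : L2Half →L[ℂ] Lp ℂ 2 (volume : Measure ℝ) :=
  weightedComp (fun v => (Real.exp (v / 2) : ℂ)) Real.exp 1
    (by fun_prop) quasiMeasurePreserving_exp
    (fun f _ => by rw [eLpNorm_exp_half_mul_comp_exp]; simp)

/-- The inverse change of variables `f ↦ x^(-1/2) f(log x)`. -/
def ofLogVar : Lp ℂ 2 (volume : Measure ℝ) →L[ℂ] L2Half :=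
  weightedComp (fun x => (Real.exp (-(Real.log x / 2)) : ℂ)) Real.log 1
    (by fun_prop) quasiMeasurePreserving_log
    (fun f _ => by
      rw [← eLpNorm_exp_half_mul_comp_exp]
      refine le_of_eq ?_
      rw [ENNReal.coe_one, one_mul]
      congr 1
      funext v
      rw [Real.log_exp, ← mul_assoc, ← Complex.ofReal_mul, ← Real.exp_add]
      simp)

theorem ofLogVar_toLogVar (f : L2Half) : ofLogVar (toLogVar f) = f := by
  refine Lp.ext ?_
  have h1 : toLogVar f =ᵐ[volume] fun v => (Real.exp (v / 2) : ℂ) * f (Real.exp v) :=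
    coeFn_weightedComp _ _ _ EventuallyEq.rfl
  refine (coeFn_weightedComp _ _ _ h1).trans ?_
  refine ae_halfLine_of_forall fun x hx => ?_
  simp only
  rw [Real.exp_log hx, ← mul_assoc, ← Complex.ofReal_mul, ← Real.exp_add]
  simp

/-! ### The Fourier transform on `L¹ ∩ L²` -/

section FourierL1L2

open FourierTransform

/-- The L² transform and the Fourier integral define the same distribution, by the multiplication
formula ∫ Ĝ f = ∫ G f̂ for test functions G. -/
theorem coeFn_fourier_toLp {f : ℝ → ℂ} (h1 : Integrable f) (h2 : MemLp f 2 volume) :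
    (𝓕 (h2.toLp f) : Lp ℂ 2 (volume : Measure ℝ)) =ᵐ[volume] 𝓕 f := by
  refine ae_eq_of_integral_contDiff_smul_eq
    ((Lp.memLp _).locallyIntegrable (by norm_num)) (Continuous.locallyIntegrable
      (VectorFourier.fourierIntegral_continuous Real.continuous_fourierChar
        continuous_inner h1)) fun g hg hc => ?_
  have hc' : HasCompactSupport (Complex.ofRealCLM ∘ g) := hc.comp_left rfl
  have hg' : ContDiff ℝ ∞ (Complex.ofRealCLM ∘ g) := by fun_prop
  set G := hc'.toSchwartzMap hg'
  have e1 := congrArg (fun T => T G) (Lp.fourier_toTemperedDistribution_eq (h2.toLp f))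
  simp only [TemperedDistribution.fourier_apply, Lp.toTemperedDistribution_apply] at e1
  have e2 : ∫ x, 𝓕 G x • (h2.toLp f) x = ∫ x, 𝓕 (G : ℝ → ℂ) x • f x := by
    refine integral_congr_ae ?_
    filter_upwards [h2.coeFn_toLp] with x hx
    rw [hx, SchwartzMap.fourier_coe]
  have e3 : ∫ x, 𝓕 (G : ℝ → ℂ) x • f x = ∫ x, G x • 𝓕 f x := by
    simpa using! VectorFourier.integral_fourierIntegral_smul_eq_flip (L := innerₗ ℝ)
      Real.continuous_fourierChar continuous_inner G.integrable h1
  rw [e2, e3] at e1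
  exact e1.symm

theorem coeFn_fourierInv_toLp {f : ℝ → ℂ} (h1 : Integrable f) (h2 : MemLp f 2 volume) :
    (𝓕⁻ (h2.toLp f) : Lp ℂ 2 (volume : Measure ℝ)) =ᵐ[volume] 𝓕⁻ f := by
  have hcont : Continuous (𝓕⁻ f) := by
    have : 𝓕⁻ f = fun w => 𝓕 f (-w) := by
      funext w; exact Real.fourierInv_eq_fourier_neg f w
    rw [this]
    exact (VectorFourier.fourierIntegral_continuous Real.continuous_fourierChar
        continuous_inner h1).comp continuous_neg
  refine ae_eq_of_integral_contDiff_smul_eq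
    ((Lp.memLp _).locallyIntegrable (by norm_num)) hcont.locallyIntegrable fun g hg hc => ?_
  have hc' : HasCompactSupport (Complex.ofRealCLM ∘ g) := hc.comp_left rfl
  have hg' : ContDiff ℝ ∞ (Complex.ofRealCLM ∘ g) := by fun_prop
  set G := hc'.toSchwartzMap hg'
  have e1 := congrArg (fun T => T G) (Lp.fourierInv_toTemperedDistribution_eq (E := ℝ) (F := ℂ) (h2.toLp f))
  simp only [TemperedDistribution.fourierInv_apply, Lp.toTemperedDistribution_apply] at e1
  have e2 : ∫ x, 𝓕⁻ G x • (h2.toLp f) x = ∫ x, 𝓕⁻ (G : ℝ → ℂ) x • f x := by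
    refine integral_congr_ae ?_
    filter_upwards [h2.coeFn_toLp] with x hx
    rw [hx, SchwartzMap.fourierInv_coe]
  have e3 : ∫ x, 𝓕⁻ (G : ℝ → ℂ) x • f x = ∫ x, G x • 𝓕⁻ f x := by
    -- The inverse transform of f is the transform of x ↦ f(-x), so the forward multiplication
    -- formula applies after a reflection.
    have e4 : ∫ x, 𝓕 (G : ℝ → ℂ) x • f (-x) = ∫ x, G x • 𝓕 (fun x => f (-x)) x := by
      simpa using! VectorFourier.integral_fourierIntegral_smul_eq_flip (L := innerₗ ℝ)
        Real.continuous_fourierChar continuous_inner G.integrable h1.comp_neg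
    rw [← integral_neg_eq_self] at e4
    simpa only [neg_neg, ← Real.fourierInv_eq_fourier_neg,
      ← Real.fourierInv_eq_fourier_comp_neg] using e4
  rw [e2, e3] at e1
  exact e1.symm

end FourierL1L2

/-! ### Comparison of the Gamma function along a vertical line -/

/-- Comparison with the telescoping differences 1/(P+j) - 1/(P+j+1). -/
theorem sum_range_inv_sq_le {P : ℝ} (hP : 0 < P) (n : ℕ) :
    ∑ j ∈ Finset.range (n + 1), 1 / (P + j) ^ 2 ≤ 1 / P ^ 2 + 1 / P := by
  have h : ∀ n : ℕ, ∑ j ∈ Finset.range (n + 1), 1 / (P + j) ^ 2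
      ≤ 1 / P ^ 2 + (1 / P - 1 / (P + n)) := by
    intro n
    induction n with
    | zero => simp
    | succ n ih =>
      rw [Finset.sum_range_succ]
      have hn : (0 : ℝ) ≤ n := n.cast_nonneg
      have h1 : 1 / (P + (n + 1 : ℕ)) ^ 2 ≤ 1 / (P + n) - 1 / (P + (n + 1 : ℕ)) := by
        push_cast
        rw [div_sub_div _ _ (by positivity) (by positivity), div_le_div_iff₀ (by positivity)
          (by positivity)]
        nlinarith [mul_nonneg hP.le hn, sq_nonneg (P + n)]
      linarith
  refine (h n).trans ?_
  have : 0 ≤ 1 / (P + n) := by positivity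
  linarith

/-- By Gauss's limit, |Γ(σ+ip)|² is a limit of quotients with denominator ∏_j ((σ+j)² + p²). Passing
from p to q multiplies the j-th factor by at most exp(N(|p|+N)/((σ+j)²+p²)). The sum of these
exponents over j is bounded uniformly in p, because q² - p² grows at most linearly in |p|. -/
theorem exists_norm_Gamma_le {σ N : ℝ} (hσ : 0 < σ) (hN : 0 ≤ N) :
    ∃ C : ℝ, 0 ≤ C ∧ ∀ p q : ℝ, q ^ 2 - p ^ 2 ≤ N * (|p| + N) →
      ‖Complex.Gamma (σ + p * Complex.I)‖ ≤ C * ‖Complex.Gamma (σ + q * Complex.I)‖ := by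
  -- With P = σ + |p| one has (σ+j)² + p² ≥ (P+j)²/2, so the exponents sum to at most 2N(P+N)(1/P² +
  -- 1/P) = 2N(1+N/P)(1/P+1). This decreases in P, and K is its value at P = σ.
  set K : ℝ := N * (2 * ((1 + N / σ) * (1 / σ + 1))) with hK
  refine ⟨√(Real.exp K), Real.sqrt_nonneg _, fun p q hpq => ?_⟩
  have hnorm : ∀ (r : ℝ) (j : ℕ), ‖(σ : ℂ) + r * Complex.I + j‖ ^ 2 = (σ + j) ^ 2 + r ^ 2 := by
    intro r j
    rw [Complex.sq_norm, Complex.normSq_apply]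
    simp; ring
  have hpos : ∀ (r : ℝ) (j : ℕ), 0 < (σ + j) ^ 2 + r ^ 2 := fun r j => by positivity
  have hfac : ∀ j : ℕ, ((σ + j) ^ 2 + q ^ 2) ≤
      Real.exp (N * (|p| + N) / ((σ + j) ^ 2 + p ^ 2)) * ((σ + j) ^ 2 + p ^ 2) := by
    intro j
    calc ((σ + j) ^ 2 + q ^ 2) ≤ (N * (|p| + N) / ((σ + j) ^ 2 + p ^ 2) + 1) *
          ((σ + j) ^ 2 + p ^ 2) := by
          rw [add_mul, div_mul_cancel₀ _ (hpos p j).ne']; linarith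
      _ ≤ _ := by gcongr; exact Real.add_one_le_exp _
  have hsum : ∀ n : ℕ,
      ∑ j ∈ Finset.range (n + 1), N * (|p| + N) / ((σ + j) ^ 2 + p ^ 2) ≤ K := by
    intro n
    set P := σ + |p| with hP
    have hP0 : 0 < P := by positivity
    have hPσ : σ ≤ P := by simp [hP]
    calc _ ≤ ∑ j ∈ Finset.range (n + 1), N * (|p| + N) * 2 * (1 / (P + j) ^ 2) := by
          refine Finset.sum_le_sum fun j _ => ?_
          rw [mul_assoc _ (2 : ℝ), mul_one_div, div_eq_mul_inv, inv_eq_one_div]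
          refine mul_le_mul_of_nonneg_left ?_ (by positivity)
          rw [div_le_div_iff₀ (hpos p j) (by positivity), ← sq_abs p]
          nlinarith [sq_nonneg (σ + j - |p|)]
      _ = N * (|p| + N) * 2 * ∑ j ∈ Finset.range (n + 1), (1 / (P + j) ^ 2) := by
          rw [Finset.mul_sum]
      _ ≤ N * (P + N) * 2 * (1 / P ^ 2 + 1 / P) := by
          refine mul_le_mul ?_ (sum_range_inv_sq_le hP0 n) (by positivity) (by positivity)
          have : |p| ≤ P := by simp [hP, hσ.le]
          gcongr
      _ = N * (2 * ((1 + N / P) * (1 / P + 1))) := by field_simp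
      _ ≤ K := by rw [hK]; gcongr
  have hprod : ∀ n : ℕ, ∏ j ∈ Finset.range (n + 1), ((σ + j) ^ 2 + q ^ 2) ≤
      Real.exp K * ∏ j ∈ Finset.range (n + 1), ((σ + j) ^ 2 + p ^ 2) := by
    intro n
    calc _ ≤ ∏ j ∈ Finset.range (n + 1),
          (Real.exp (N * (|p| + N) / ((σ + j) ^ 2 + p ^ 2)) * ((σ + j) ^ 2 + p ^ 2)) :=
          Finset.prod_le_prod (fun j _ => (hpos q j).le) fun j _ => hfac j
      _ ≤ _ := by
          rw [Finset.prod_mul_distrib, ← Real.exp_sum]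
          have : 0 ≤ ∏ j ∈ Finset.range (n + 1), ((σ + j) ^ 2 + p ^ 2) :=
            Finset.prod_nonneg fun j _ => (hpos p j).le
          gcongr
          exact hsum n
  have hseq : ∀ n : ℕ, 0 < n → ‖Complex.GammaSeq (σ + p * Complex.I) n‖ ^ 2 ≤
      Real.exp K * ‖Complex.GammaSeq (σ + q * Complex.I) n‖ ^ 2 := by
    intro n hn
    have hn' : (0 : ℝ) < n := by exact_mod_cast hn
    have e : ∀ r : ℝ, ‖Complex.GammaSeq (σ + r * Complex.I) n‖ ^ 2 =
        ((n : ℝ) ^ σ * n.factorial) ^ 2 / ∏ j ∈ Finset.range (n + 1), ((σ + j) ^ 2 + r ^ 2) := by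
      intro r
      rw [Complex.GammaSeq, norm_div, norm_mul, div_pow, norm_prod, ← Finset.prod_pow]
      simp only [hnorm]
      rw [← Complex.ofReal_natCast n, Complex.norm_cpow_eq_rpow_re_of_pos hn']
      simp
    rw [e, e, ← mul_div_assoc, div_le_div_iff₀ (Finset.prod_pos fun j _ => hpos p j)
      (Finset.prod_pos fun j _ => hpos q j)]
    calc _ ≤ ((n : ℝ) ^ σ * n.factorial) ^ 2 * (Real.exp K *
          ∏ j ∈ Finset.range (n + 1), ((σ + j) ^ 2 + p ^ 2)) :=
          mul_le_mul_of_nonneg_left (hprod n) (sq_nonneg _)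
      _ = _ := by ring
  have hlim := le_of_tendsto_of_tendsto ((Complex.GammaSeq_tendsto_Gamma _).norm.pow 2)
    (((Complex.GammaSeq_tendsto_Gamma (σ + q * Complex.I)).norm.pow 2).const_mul (Real.exp K))
    (by filter_upwards [eventually_gt_atTop 0] with n hn using hseq n hn)
  refine (abs_le_of_sq_le_sq' ?_ (by positivity)).2
  rw [mul_pow, Real.sq_sqrt (Real.exp_pos _).le]
  exact hlim

/-! ### The Hankel transform -/

/-- The multiplier by which the Hankel transform acts after the Mellin transform. -/
def hankelMultiplier (m : ℂ) (t : ℝ) : ℂ :=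
  (2 : ℂ) ^ (-(2 * Real.pi * t * Complex.I)) *
    Complex.Gamma ((m + 1 - 2 * Real.pi * t * Complex.I) / 2) /
    Complex.Gamma ((m + 1 + 2 * Real.pi * t * Complex.I) / 2)

theorem re_hankel_arg_pos {m : ℂ} (hm : -1 < m.re) (t : ℝ) :
    0 < ((m + 1 + 2 * Real.pi * t * Complex.I) / 2).re := by
  have : ((m + 1 + 2 * Real.pi * t * Complex.I) / 2) =
      (((m.re + 1) / 2 : ℝ) : ℂ) + ((m.im / 2 + Real.pi * t : ℝ) : ℂ) * Complex.I := by
    conv_lhs => rw [← Complex.re_add_im m]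
    push_cast; ring
  rw [this]
  simp
  linarith

theorem re_hankel_arg_neg_pos {m : ℂ} (hm : -1 < m.re) (t : ℝ) :
    0 < ((m + 1 - 2 * Real.pi * t * Complex.I) / 2).re := by
  have := re_hankel_arg_pos hm (-t)
  push_cast at this
  convert this using 3
  ring

/-- Both Gamma factors sit on the line of real part (Re m + 1)/2, at heights p, q = Im m/2 ∓ πt.
Then q² - p² = 2πt Im m is at most linear in |p|, and N = 2|Im m| suffices. -/
theorem exists_norm_hankelMultiplier_le {m : ℂ} (hm : -1 < m.re) :
    ∃ C : NNReal, ∀ t, ‖hankelMultiplier m t‖ ≤ C := by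
  obtain ⟨C, hC0, hC⟩ := exists_norm_Gamma_le (σ := (m.re + 1) / 2) (N := 2 * |m.im|)
    (by linarith) (by positivity)
  refine ⟨⟨C, hC0⟩, fun t => ?_⟩
  have e1 : (m + 1 - 2 * Real.pi * t * Complex.I) / 2 =
      (((m.re + 1) / 2 : ℝ) : ℂ) + ((m.im / 2 - Real.pi * t : ℝ) : ℂ) * Complex.I := by
    conv_lhs => rw [← Complex.re_add_im m]
    push_cast; ring
  have e2 : (m + 1 + 2 * Real.pi * t * Complex.I) / 2 =
      (((m.re + 1) / 2 : ℝ) : ℂ) + ((m.im / 2 + Real.pi * t : ℝ) : ℂ) * Complex.I := by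
    conv_lhs => rw [← Complex.re_add_im m]
    push_cast; ring
  have h := hC (m.im / 2 - Real.pi * t) (m.im / 2 + Real.pi * t) (by
    have h1 : |Real.pi * t| ≤ |m.im / 2 - Real.pi * t| + |m.im| / 2 := by
      have := abs_sub_abs_le_abs_sub (Real.pi * t) (m.im / 2)
      rw [abs_sub_comm, abs_div, abs_two] at this
      linarith
    have h2 : m.im * (Real.pi * t) ≤ |m.im| * |Real.pi * t| := by
      rw [← abs_mul]; exact le_abs_self _
    nlinarith [abs_nonneg m.im, mul_le_mul_of_nonneg_left h1 (abs_nonneg m.im)])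
  have hne := Complex.Gamma_ne_zero_of_re_pos (re_hankel_arg_pos hm t)
  rw [hankelMultiplier, norm_div, norm_mul, e1, e2]
  rw [e2] at hne
  have h3 : ‖(2 : ℂ) ^ (-(2 * Real.pi * t * Complex.I))‖ = 1 := by
    have := Complex.norm_cpow_eq_rpow_re_of_pos two_pos (-(2 * Real.pi * t * Complex.I))
    simpa using this
  rw [h3, one_mul, div_le_iff₀ (norm_pos_iff.2 hne)]
  exact h

theorem continuous_hankelMultiplier {m : ℂ} (hm : -1 < m.re) :
    Continuous (hankelMultiplier m) := by
  have hG : ∀ z : ℂ, 0 < z.re → ContinuousAt Complex.Gamma z := fun z hz =>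
    (Complex.differentiableAt_Gamma z fun n h => by
      rw [h] at hz
      simp at hz
      exact absurd hz (not_lt.2 (Nat.cast_nonneg n))).continuousAt
  rw [continuous_iff_continuousAt]
  intro t
  refine ContinuousAt.div (ContinuousAt.mul ?_ ?_) ?_
    (Complex.Gamma_ne_zero_of_re_pos (re_hankel_arg_pos hm t))
  · exact (Continuous.const_cpow (by fun_prop) (Or.inl two_ne_zero)).continuousAt
  · exact ContinuousAt.comp (f := fun t : ℝ => (m + 1 - 2 * Real.pi * t * Complex.I) / 2)
      (hG _ (re_hankel_arg_neg_pos hm t)) (by fun_prop)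
  · exact ContinuousAt.comp (f := fun t : ℝ => (m + 1 + 2 * Real.pi * t * Complex.I) / 2)
      (hG _ (re_hankel_arg_pos hm t)) (by fun_prop)

/-- Multiplication by `hankelMultiplier m` on `L²(ℝ)`. -/
def hankelMul {m : ℂ} (hm : -1 < m.re) :
    Lp ℂ 2 (volume : Measure ℝ) →L[ℂ] Lp ℂ 2 (volume : Measure ℝ) :=
  boundedMul (hankelMultiplier m) (exists_norm_hankelMultiplier_le hm).choose
    (continuous_hankelMultiplier hm).aestronglyMeasurable
    (Eventually.of_forall (exists_norm_hankelMultiplier_le hm).choose_spec)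

/-- The inverse Fourier transform as a bounded operator on `L²(ℝ)`. -/
def fourierInvL2 : Lp ℂ 2 (volume : Measure ℝ) →L[ℂ] Lp ℂ 2 (volume : Measure ℝ) :=
  (Lp.fourierTransformₗᵢ ℝ ℂ).symm.toContinuousLinearEquiv.toContinuousLinearMap

/-- The Hankel transform of order `m` as a bounded operator on `L²` of the half-line. -/
def hankel {m : ℂ} (hm : -1 < m.re) : L2Half →L[ℂ] L2Half :=
  ofLogVar ∘L fourierInvL2 ∘L hankelMul hm ∘L fourierInvL2 ∘L toLogVar

theorem exp_mul_gaussPow_exp (p : ℂ) (s v : ℝ) :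
    (Real.exp (v / 2) : ℂ) * gaussPow (p + 1 / 2) s (Real.exp v) =
      (Real.exp v : ℂ) * gaussPow p s (Real.exp v) := by
  have h0 : ((Real.exp v : ℝ) : ℂ) ≠ 0 := by exact_mod_cast (Real.exp_pos v).ne'
  have h1 : ((Real.exp v : ℝ) : ℂ) ^ (1 / 2 : ℂ) = (Real.exp (v / 2) : ℂ) := by
    rw [show (1 / 2 : ℂ) = ((1 / 2 : ℝ) : ℂ) by push_cast; rfl,
      ← Complex.ofReal_cpow (Real.exp_pos v).le, ← Real.exp_mul]
    congr 2; ring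
  have h2 : (Real.exp v : ℂ) = (Real.exp (v / 2) : ℂ) * (Real.exp (v / 2) : ℂ) := by
    rw [← Complex.ofReal_mul, ← Real.exp_add, add_halves]
  simp only [gaussPow]
  rw [Complex.cpow_add _ _ h0, h1]
  linear_combination (-(Real.exp v : ℂ) ^ p * (Real.exp (-(s / 2) * Real.exp v ^ 2) : ℂ)) * h2

theorem cexp_mul_gaussPow_exp (p c : ℂ) (s v : ℝ) :
    Complex.exp (v * c) * gaussPow p s (Real.exp v) = gaussPow (p + c) s (Real.exp v) := by
  have h0 : ((Real.exp v : ℝ) : ℂ) ≠ 0 := by exact_mod_cast (Real.exp_pos v).ne'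
  simp only [gaussPow]
  rw [Complex.cpow_add _ _ h0, Complex.cpow_def_of_ne_zero h0 c, ← Complex.ofReal_log
    (Real.exp_pos v).le, Real.log_exp]
  ring

/-! ### The Hankel transform of Gaussians -/

section

open FourierTransform

variable {m : ℂ}

theorem integrable_logGauss (hm : -1 < m.re) {s : ℝ} (hs : 0 < s) :
    Integrable (fun v : ℝ => (Real.exp v : ℂ) * gaussPow m s (Real.exp v)) :=
  integrable_exp_smul_comp_exp (integrable_gaussPow hm hs)

theorem coeFn_toLogVar_gaussL2 (hm : -1 < m.re) {s : ℝ} (hs : 0 < s) :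
    toLogVar (gaussL2 (m + 1 / 2) s) =ᵐ[volume]
      fun v : ℝ => (Real.exp v : ℂ) * gaussPow m s (Real.exp v) := by
  have h : toLogVar (gaussL2 (m + 1 / 2) s) =ᵐ[volume] _ :=
    coeFn_weightedComp _ _ _ (coeFn_gaussL2 (by simp; linarith) hs)
  refine h.trans (Eventually.of_forall fun v => ?_)
  exact exp_mul_gaussPow_exp m s v

theorem memLp_logGauss (hm : -1 < m.re) {s : ℝ} (hs : 0 < s) :
    MemLp (fun v : ℝ => (Real.exp v : ℂ) * gaussPow m s (Real.exp v)) 2 volume :=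
  (memLp_congr_ae (coeFn_toLogVar_gaussL2 hm hs)).1 (Lp.memLp _)

theorem toLogVar_gaussL2 (hm : -1 < m.re) {s : ℝ} (hs : 0 < s) :
    toLogVar (gaussL2 (m + 1 / 2) s) = (memLp_logGauss hm hs).toLp _ :=
  Lp.ext ((coeFn_toLogVar_gaussL2 hm hs).trans (MemLp.coeFn_toLp _).symm)

/-- In the logarithmic variable the Fourier integral is a Mellin integral of the Gaussian, evaluated
by `integral_gaussPow` at w = (m + 1 - 2πit)/2. -/
theorem fourier_logGauss (hm : -1 < m.re) {s : ℝ} (hs : 0 < s) (t : ℝ) :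
    𝓕 (fun v : ℝ => (Real.exp v : ℂ) * gaussPow m s (Real.exp v)) t =
      1 / 2 * (2 / s : ℝ) ^ ((m + 1 - 2 * Real.pi * t * Complex.I) / 2) *
        Complex.Gamma ((m + 1 - 2 * Real.pi * t * Complex.I) / 2) := by
  rw [← integral_gaussPow (re_hankel_arg_neg_pos hm t) hs, ← integral_exp_smul_comp_exp,
    Real.fourier_real_eq_integral_exp_smul]
  refine integral_congr_ae (Eventually.of_forall fun v => ?_)
  simp only [smul_eq_mul]
  rw [mul_left_comm, show ((-2 * Real.pi * v * t : ℝ) : ℂ) * Complex.I =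
    v * (-(2 * Real.pi * t * Complex.I)) by push_cast; ring, cexp_mul_gaussPow_exp]
  congr 2
  ring

theorem fourierInv_logGauss (hm : -1 < m.re) {s : ℝ} (hs : 0 < s) (t : ℝ) :
    𝓕⁻ (fun v : ℝ => (Real.exp v : ℂ) * gaussPow m s (Real.exp v)) t =
      1 / 2 * (2 / s : ℝ) ^ ((m + 1 + 2 * Real.pi * t * Complex.I) / 2) *
        Complex.Gamma ((m + 1 + 2 * Real.pi * t * Complex.I) / 2) := by
  rw [Real.fourierInv_eq_fourier_neg, fourier_logGauss hm hs]
  push_cast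
  ring_nf

/-- The multiplier is the quotient of the two Mellin transforms of Gaussians. The parameter s
separates off as s^(-m-1) because the two Gamma arguments add up to m + 1. -/
theorem hankelMultiplier_mul {m : ℂ} (hm : -1 < m.re) {s : ℝ} (hs : 0 < s) (t : ℝ) :
    hankelMultiplier m t * (1 / 2 * (2 / s : ℝ) ^ ((m + 1 + 2 * Real.pi * t * Complex.I) / 2) *
        Complex.Gamma ((m + 1 + 2 * Real.pi * t * Complex.I) / 2)) =
      (s : ℂ) ^ (-m - 1) * (1 / 2 *
        (2 / s⁻¹ : ℝ) ^ ((m + 1 - 2 * Real.pi * t * Complex.I) / 2) *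
        Complex.Gamma ((m + 1 - 2 * Real.pi * t * Complex.I) / 2)) := by
  have hne := Complex.Gamma_ne_zero_of_re_pos (re_hankel_arg_pos hm t)
  have hs0 : (s : ℂ) ≠ 0 := by exact_mod_cast hs.ne'
  set w := (m + 1 - 2 * Real.pi * t * Complex.I) / 2 with hw
  set w' := (m + 1 + 2 * Real.pi * t * Complex.I) / 2 with hw'
  have e1 : ((2 / s : ℝ) : ℂ) ^ w' = (2 : ℂ) ^ w' * (s : ℂ) ^ (-w') := by
    rw [div_eq_mul_inv, Complex.ofReal_mul, Complex.mul_cpow_ofReal_nonneg two_pos.le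
      (inv_pos.2 hs).le, Complex.ofReal_inv, Complex.inv_cpow _ _ (by
        rw [Complex.arg_ofReal_of_nonneg hs.le]; exact Real.pi_pos.ne), Complex.cpow_neg]
    norm_cast
  have e2 : ((2 / s⁻¹ : ℝ) : ℂ) ^ w = (2 : ℂ) ^ w * (s : ℂ) ^ w := by
    rw [div_inv_eq_mul, Complex.ofReal_mul, Complex.mul_cpow_ofReal_nonneg two_pos.le hs.le]
    norm_cast
  have e3 : (2 : ℂ) ^ (-(2 * Real.pi * t * Complex.I)) * (2 : ℂ) ^ w' = (2 : ℂ) ^ w := by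
    rw [← Complex.cpow_add _ _ two_ne_zero]; congr 1; rw [hw, hw']; ring
  have e4 : (s : ℂ) ^ (-m - 1) * (s : ℂ) ^ w = (s : ℂ) ^ (-w') := by
    rw [← Complex.cpow_add _ _ hs0]; congr 1; rw [hw, hw']; ring
  rw [e1, e2, hankelMultiplier, ← hw, ← hw', ← e3, ← e4]
  field_simp

theorem fourierInvL2_toLp {f : ℝ → ℂ} (h1 : Integrable f) (h2 : MemLp f 2 volume) :
    fourierInvL2 (h2.toLp f) =ᵐ[volume] 𝓕⁻ f := coeFn_fourierInv_toLp h1 h2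

/-- The Hankel transform of a Gaussian. -/
theorem hankel_gaussL2 (hm : -1 < m.re) {s : ℝ} (hs : 0 < s) :
    hankel hm (gaussL2 (m + 1 / 2) s) = (s : ℂ) ^ (-m - 1) • gaussL2 (m + 1 / 2) s⁻¹ := by
  have hs' : 0 < s⁻¹ := inv_pos.2 hs
  -- The multiplier turns an inverse transform of the Gaussian at s into a forward transform of the
  -- Gaussian at 1/s, which the second inverse transform then undoes.
  have key : hankelMul hm (fourierInvL2 (toLogVar (gaussL2 (m + 1 / 2) s))) =
      (s : ℂ) ^ (-m - 1) • (𝓕 ((memLp_logGauss hm hs').toLp _) : Lp ℂ 2 (volume : Measure ℝ)) := by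
    refine Lp.ext ?_
    rw [toLogVar_gaussL2 hm hs]
    refine (coeFn_boundedMul _ _ (fourierInvL2_toLp (integrable_logGauss hm hs) _)).trans ?_
    filter_upwards [Lp.coeFn_smul ((s : ℂ) ^ (-m - 1))
      (𝓕 ((memLp_logGauss hm hs').toLp _) : Lp ℂ 2 (volume : Measure ℝ)),
      coeFn_fourier_toLp (integrable_logGauss hm hs') (memLp_logGauss hm hs')] with t h1 h2
    rw [h1, Pi.smul_apply, h2, smul_eq_mul, fourier_logGauss hm hs', fourierInv_logGauss hm hs,
      hankelMultiplier_mul hm hs]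
  simp only [hankel, ContinuousLinearMap.comp_apply]
  rw [key, map_smul, map_smul, ← toLogVar_gaussL2 hm hs']
  have : fourierInvL2 (𝓕 (toLogVar (gaussL2 (m + 1 / 2) s⁻¹))) =
      toLogVar (gaussL2 (m + 1 / 2) s⁻¹) := (Lp.fourierTransformₗᵢ ℝ ℂ).symm_apply_apply _
  rw [this, ofLogVar_toLogVar]

end

/-! ### The Hankel transform as a symmetric involution -/

section HankelProperties

variable {m : ℂ} (hm : -1 < m.re)
include hm

theorem hankel_order : -1 / 2 < (m + 1 / 2).re := by simp; linarith

/-- On Gaussians s goes to 1/s and back, and the constants s^(-m-1) and (1/s)^(-m-1) cancel;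
Gaussians span a dense subspace. -/
theorem hankel_hankel (f : L2Half) : hankel hm (hankel hm f) = f := by
  have h : hankel hm ∘L hankel hm = ContinuousLinearMap.id ℂ L2Half := by
    refine ContinuousLinearMap.ext_on (dense_span_gaussL2 (hankel_order hm)) ?_
    rintro _ ⟨s, hs, rfl⟩
    have hs0 : (s : ℂ) ≠ 0 := by exact_mod_cast (ne_of_gt hs)
    rw [ContinuousLinearMap.comp_apply, hankel_gaussL2 hm hs, map_smul,
      hankel_gaussL2 hm (inv_pos.2 hs), inv_inv, smul_smul, Complex.ofReal_inv,
      Complex.inv_cpow _ _ (by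
        rw [Complex.arg_ofReal_of_nonneg (le_of_lt hs)]; exact Real.pi_pos.ne),
      mul_inv_cancel₀ (by simp [Complex.cpow_eq_zero_iff, hs0]), one_smul]
    rfl
  exact congrArg (fun T : L2Half →L[ℂ] L2Half => T f) h

/-- The point is that the value is symmetric in s and t. -/
theorem pairing_hankel_gaussL2 {s t : ℝ} (hs : 0 < s) (ht : 0 < t) :
    pairing (gaussL2 (m + 1 / 2) t) (hankel hm (gaussL2 (m + 1 / 2) s)) =
      1 / 2 * (2 / (1 + s * t) : ℝ) ^ (m + 1) * Complex.Gamma (m + 1) := by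
  have hs0 : (s : ℂ) ≠ 0 := by exact_mod_cast hs.ne'
  rw [hankel_gaussL2 hm hs, map_smul, pairing_gaussL2 (w := m + 1) (hankel_order hm)
    (hankel_order hm) ht (inv_pos.2 hs) (by ring), smul_eq_mul]
  have : (2 / (t + s⁻¹) : ℝ) = s * (2 / (1 + s * t)) := by field_simp; ring
  rw [this, Complex.ofReal_mul, Complex.mul_cpow_ofReal_nonneg hs.le (by positivity)]
  have e : (s : ℂ) ^ (-m - 1) * (s : ℂ) ^ (m + 1) = 1 := by
    rw [← Complex.cpow_add _ _ hs0]; simp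
  linear_combination
    (1 / 2 * ((2 / (1 + s * t) : ℝ) : ℂ) ^ (m + 1) * Complex.Gamma (m + 1)) * e

/-- The Hankel transform is symmetric for the bilinear pairing. -/
theorem pairing_hankel (f g : L2Half) :
    pairing g (hankel hm f) = pairing (hankel hm g) f := by
  -- Symmetry is known for pairs of Gaussians; it is extended by density and continuity in one
  -- variable and then in the other.
  have h1 : ∀ s, 0 < s → ∀ f, pairing (gaussL2 (m + 1 / 2) s) (hankel hm f) =
      pairing (hankel hm (gaussL2 (m + 1 / 2) s)) f := by
    intro s hs f
    have : pairing (gaussL2 (m + 1 / 2) s) ∘L hankel hm =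
        pairing (hankel hm (gaussL2 (m + 1 / 2) s)) := by
      refine ContinuousLinearMap.ext_on (dense_span_gaussL2 (hankel_order hm)) ?_
      rintro _ ⟨t, ht, rfl⟩
      rw [ContinuousLinearMap.comp_apply, pairing_hankel_gaussL2 hm ht hs, pairing_comm,
        pairing_hankel_gaussL2 hm hs ht, mul_comm t s]
    exact congrArg (fun T : L2Half →L[ℂ] ℂ => T f) this
  have h2 : pairing (hankel hm f) = pairing f ∘L hankel hm := by
    refine ContinuousLinearMap.ext_on (dense_span_gaussL2 (hankel_order hm)) ?_
    rintro _ ⟨s, hs, rfl⟩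
    rw [ContinuousLinearMap.comp_apply, pairing_comm, h1 s hs, pairing_comm]
  rw [pairing_comm, h2, ContinuousLinearMap.comp_apply, pairing_comm]

end HankelProperties

/-! ### Norms and dominated convergence in `L²` of the half-line -/

theorem lintegral_norm_sq_eq (f : L2Half) :
    ∫⁻ x, ENNReal.ofReal (‖f x‖ ^ 2) ∂halfLine = ENNReal.ofReal (‖f‖ ^ 2) := by
  have h := Lp.enorm_def f
  rw [eLpNorm_two_eq, ← ofReal_norm] at h
  rw [ENNReal.ofReal_pow (norm_nonneg _), h, ← ENNReal.rpow_natCast, ← ENNReal.rpow_mul]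
  norm_num

theorem integrable_norm_sq (f : L2Half) : Integrable (fun x => ‖f x‖ ^ 2) halfLine :=
  (memLp_two_iff_integrable_sq_norm (Lp.aestronglyMeasurable f)).1 (Lp.memLp f)

theorem norm_sq_eq_integral (f : L2Half) : ‖f‖ ^ 2 = ∫ x, ‖f x‖ ^ 2 ∂halfLine := by
  have h := lintegral_norm_sq_eq f
  rw [← ofReal_integral_eq_lintegral_ofReal (integrable_norm_sq f)
    (Eventually.of_forall fun x => sq_nonneg _)] at h
  exact ((ENNReal.ofReal_eq_ofReal_iff (integral_nonneg fun x => sq_nonneg _) (sq_nonneg _)).1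
    h).symm

theorem tendsto_L2Half_of_dominated {ι : Type*} {l : Filter ι} [l.IsCountablyGenerated] [l.NeBot]
    {f : ι → L2Half} {g : L2Half} {G : ℝ → ℝ} (hG : MemLp G 2 halfLine)
    (hb : ∀ n, ∀ᵐ x ∂halfLine, ‖f n x‖ ≤ G x) (hgb : ∀ᵐ x ∂halfLine, ‖g x‖ ≤ G x)
    (hlim : ∀ᵐ x ∂halfLine, Tendsto (fun n => f n x) l (𝓝 (g x))) : Tendsto f l (𝓝 g) := by
  rw [tendsto_iff_norm_sub_tendsto_zero]
  have h : Tendsto (fun n => ‖f n - g‖ ^ 2) l (𝓝 0) := by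
    have e : ∀ n, ‖f n - g‖ ^ 2 = ∫ x, ‖f n x - g x‖ ^ 2 ∂halfLine := by
      intro n
      rw [norm_sq_eq_integral]
      refine integral_congr_ae ?_
      filter_upwards [Lp.coeFn_sub (f n) g] with x hx
      rw [hx, Pi.sub_apply]
    simp only [e]
    have := tendsto_integral_filter_of_dominated_convergence (μ := halfLine) (l := l)
      (F := fun n x => ‖f n x - g x‖ ^ 2) (f := fun _ => (0 : ℝ))
      (fun x => (2 * G x) ^ 2)
      (Eventually.of_forall fun n => ((Lp.aestronglyMeasurable (f n)).sub
        (Lp.aestronglyMeasurable g)).norm.pow 2)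
      (Eventually.of_forall fun n => by
        filter_upwards [hb n, hgb] with x h1 h2
        rw [Real.norm_of_nonneg (sq_nonneg _)]
        have := norm_sub_le (f n x) (g x)
        gcongr
        linarith)
      ((memLp_two_iff_integrable_sq (hG.const_mul 2).aestronglyMeasurable).1 (hG.const_mul 2)) (by
        filter_upwards [hlim] with x hx
        have := ((tendsto_iff_norm_sub_tendsto_zero.1 hx).pow 2)
        simpa using this)
    rwa [integral_zero] at this
  have h2 := h.sqrt
  simpa [Real.sqrt_sq (norm_nonneg _)] using h2

theorem memLp_of_lintegral_norm_sq_lt_top {u : ℝ → ℂ} (hu : AEStronglyMeasurable u halfLine)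
    (h : ∫⁻ x, ENNReal.ofReal (‖u x‖ ^ 2) ∂halfLine < ⊤) : MemLp u 2 halfLine :=
  ⟨hu, by rw [eLpNorm_two_eq]; exact ENNReal.rpow_lt_top_of_nonneg (by norm_num) h.ne⟩

theorem inner_boundedMul {w : ℝ → ℂ} {C : NNReal} (hw : AEStronglyMeasurable w halfLine)
    (hC : ∀ᵐ x ∂halfLine, ‖w x‖ ≤ C) (hr : ∀ x, star (w x) = w x) (f g : L2Half) :
    inner ℂ (boundedMul w C hw hC f) g = inner ℂ f (boundedMul w C hw hC g) := by
  rw [L2.inner_def, L2.inner_def]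
  refine integral_congr_ae ?_
  filter_upwards [coeFn_boundedMul hw hC (EventuallyEq.rfl (f := (f : ℝ → ℂ))),
    coeFn_boundedMul hw hC (EventuallyEq.rfl (f := (g : ℝ → ℂ)))] with x h1 h2
  rw [h1, h2]
  simp only [RCLike.inner_apply, map_mul]
  have : (starRingEnd ℂ) (w x) = w x := hr x
  rw [this]; ring

/-! ### Multiplication by `x²` -/

/-- The graph of the operator of multiplication by `x²`. -/
def mulSqGraph : Submodule ℂ (L2Half × L2Half) where
  carrier := {p | p.2 =ᵐ[halfLine] fun x => (x : ℂ) ^ 2 * p.1 x}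
  zero_mem' := by
    filter_upwards [Lp.coeFn_zero ℂ 2 halfLine] with x hx
    simp only [Prod.fst_zero, Prod.snd_zero]
    rw [hx]; simp
  add_mem' := by
    intro p q hp hq
    filter_upwards [hp, hq, Lp.coeFn_add p.1 q.1, Lp.coeFn_add p.2 q.2] with x h1 h2 h3 h4
    simp only [Prod.fst_add, Prod.snd_add]
    rw [h3, h4, Pi.add_apply, Pi.add_apply, h1, h2, mul_add]
  smul_mem' := by
    intro c p hp
    filter_upwards [hp, Lp.coeFn_smul c p.1, Lp.coeFn_smul c p.2] with x h1 h2 h3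
    simp only [Prod.smul_fst, Prod.smul_snd]
    rw [h2, h3, Pi.smul_apply, Pi.smul_apply, h1, smul_eq_mul, smul_eq_mul]
    ring

theorem mem_mulSqGraph {f g : L2Half} :
    (f, g) ∈ mulSqGraph ↔ g =ᵐ[halfLine] fun x => (x : ℂ) ^ 2 * f x := Iff.rfl

/-- Multiplication by `(1 + x²)⁻¹`. -/
def mulResolvent : L2Half →L[ℂ] L2Half :=
  boundedMul (fun x => ((1 / (1 + x ^ 2) : ℝ) : ℂ)) 1
    (by
      refine (Complex.continuous_ofReal.comp ?_).aestronglyMeasurable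
      exact continuous_const.div (by fun_prop) fun x => by positivity)
    (Eventually.of_forall fun x : ℝ => by
      rw [Complex.norm_real, Real.norm_of_nonneg (by positivity), NNReal.coe_one,
        div_le_one (by positivity)]
      nlinarith [sq_nonneg x])

theorem coeFn_mulResolvent (f : L2Half) :
    mulResolvent f =ᵐ[halfLine] fun x => ((1 / (1 + x ^ 2) : ℝ) : ℂ) * f x :=
  coeFn_boundedMul _ _ EventuallyEq.rfl

theorem one_add_sq_ne_zero (x : ℝ) : (1 + (x : ℂ) ^ 2) ≠ 0 := by
  have : (1 + x ^ 2 : ℝ) ≠ 0 := by positivity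
  exact_mod_cast this

theorem inner_mulResolvent (f g : L2Half) :
    inner ℂ (mulResolvent f) g = inner ℂ f (mulResolvent g) :=
  inner_boundedMul _ _ (fun _ => Complex.conj_ofReal _) f g

/-- Expressing the graph through the bounded operator (1 + x²)⁻¹ turns closedness and
self-adjointness into statements about bounded operators. -/
theorem mem_mulSqGraph_iff {f g : L2Half} :
    (f, g) ∈ mulSqGraph ↔ mulResolvent g = f - mulResolvent f := by
  rw [mem_mulSqGraph]
  have e : mulResolvent g = f - mulResolvent f ↔
      ∀ᵐ x ∂halfLine, mulResolvent g x = (f - mulResolvent f : L2Half) x :=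
    ⟨fun h => by rw [h]; exact EventuallyEq.rfl, fun h => Lp.ext h⟩
  rw [e]
  constructor <;> intro h
  · filter_upwards [h, coeFn_mulResolvent f, coeFn_mulResolvent g,
      Lp.coeFn_sub f (mulResolvent f)] with x h1 h2 h3 h4
    rw [h4, Pi.sub_apply, h2, h3, h1]
    have := one_add_sq_ne_zero x
    push_cast
    field_simp
    ring
  · filter_upwards [h, coeFn_mulResolvent f, coeFn_mulResolvent g,
      Lp.coeFn_sub f (mulResolvent f)] with x h1 h2 h3 h4
    rw [h4, Pi.sub_apply, h2, h3] at h1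
    have := one_add_sq_ne_zero x
    push_cast at h1
    field_simp at h1
    linear_combination h1

theorem isClosed_mulSqGraph : IsClosed (mulSqGraph : Set (L2Half × L2Half)) := by
  have : (mulSqGraph : Set (L2Half × L2Half)) =
      {p | mulResolvent p.2 = p.1 - mulResolvent p.1} := by
    ext ⟨f, g⟩; exact mem_mulSqGraph_iff
  rw [this]
  exact isClosed_eq (by fun_prop) (by fun_prop)

theorem mulResolvent_mem_mulSqGraph (f : L2Half) :
    (mulResolvent f, f - mulResolvent f) ∈ mulSqGraph := by
  rw [mem_mulSqGraph_iff, map_sub]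

theorem mulSqGraph_snd_eq_zero (p : L2Half × L2Half) (hp : p ∈ mulSqGraph) (h0 : p.1 = 0) :
    p.2 = 0 := by
  refine Lp.ext ?_
  have hp' : p.2 =ᵐ[halfLine] fun x => (x : ℂ) ^ 2 * p.1 x := hp
  rw [h0] at hp'
  filter_upwards [hp', Lp.coeFn_zero ℂ 2 halfLine] with x h1 h2
  rw [h1, h2]; simp

/-- The operator of multiplication by `x²` on its maximal domain. -/
def mulSqOp : L2Half →ₗ.[ℂ] L2Half := mulSqGraph.toLinearPMap

theorem mulSqOp_graph : mulSqOp.graph = mulSqGraph :=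
  Submodule.toLinearPMap_graph_eq _ mulSqGraph_snd_eq_zero

theorem mulSqOp_mem (f : mulSqOp.domain) : ((f : L2Half), mulSqOp f) ∈ mulSqGraph := by
  rw [← mulSqOp_graph]; exact mulSqOp.mem_graph f

theorem mulSqOp_apply {f g : L2Half} (h : (f, g) ∈ mulSqGraph) :
    ∃ hf : f ∈ mulSqOp.domain, mulSqOp ⟨f, hf⟩ = g := by
  rw [← mulSqOp_graph] at h
  refine ⟨LinearPMap.mem_domain_of_mem_graph h, ?_⟩
  exact mulSqOp.mem_graph_snd_inj (mulSqOp.mem_graph ⟨f, _⟩) h rfl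

theorem gaussL2_mem_mulSqGraph {p : ℂ} {s : ℝ} (hp : -1 / 2 < p.re) (hs : 0 < s) :
    (gaussL2 p s, gaussL2 (p + 2) s) ∈ mulSqGraph := by
  rw [mem_mulSqGraph]
  filter_upwards [coeFn_gaussL2 hp hs, coeFn_gaussL2 (p := p + 2) (by simp; linarith) hs,
    ae_restrict_mem measurableSet_Ioi] with x h1 h2 hx
  rw [h1, h2, gaussPow_add_two p s hx]

theorem dense_mulSqOp_domain : Dense (mulSqOp.domain : Set L2Half) := by
  refine (dense_span_gaussL2 (p := 0) (by norm_num)).mono (Submodule.span_le.2 ?_)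
  rintro _ ⟨s, hs, rfl⟩
  exact (mulSqOp_apply (gaussL2_mem_mulSqGraph (by norm_num) hs)).1

theorem isFormalAdjoint_mulSqOp : mulSqOp.IsFormalAdjoint mulSqOp := by
  intro f g
  rw [L2.inner_def, L2.inner_def]
  refine integral_congr_ae ?_
  filter_upwards [mulSqOp_mem f, mulSqOp_mem g] with x h1 h2
  rw [h1, h2]
  simp only [RCLike.inner_apply, map_mul, map_pow, Complex.conj_ofReal]
  ring

/-- Let R = (1 + x²)⁻¹ and let y be in the domain of the adjoint A*. Testing on Rv, which is in the
domain with image v - Rv, gives R A* y = y - Ry, and this says that (y, A* y) is in the graph. -/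
theorem isSelfAdjoint_mulSqOp : IsSelfAdjoint mulSqOp := by
  rw [LinearPMap.isSelfAdjoint_def]
  refine le_antisymm ?_ (isFormalAdjoint_mulSqOp.le_adjoint dense_mulSqOp_domain)
  refine LinearPMap.le_of_le_graph ?_
  rintro ⟨y, z⟩ hyz
  rw [mulSqOp_graph, mem_mulSqGraph_iff]
  obtain ⟨y', rfl, rfl⟩ := (LinearPMap.mem_graph_iff _).1 hyz
  refine ext_inner_right ℂ fun v => ?_
  obtain ⟨hv, hv'⟩ := mulSqOp_apply (mulResolvent_mem_mulSqGraph v)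
  have h := LinearPMap.adjoint_isFormalAdjoint dense_mulSqOp_domain y' ⟨mulResolvent v, hv⟩
  rw [hv'] at h
  rw [inner_mulResolvent, inner_sub_left, inner_mulResolvent, ← inner_sub_right]
  exact h

/-! ### The spectral measure of multiplication by `x²` -/

/-- The indicator function of `{x | x² ∈ B}`. -/
def sqIndicator (B : Set ℝ) : ℝ → ℂ := ((fun x : ℝ => x ^ 2) ⁻¹' B).indicator 1

theorem measurable_sqIndicator {B : Set ℝ} (hB : MeasurableSet B) :
    Measurable (sqIndicator B) :=
  measurable_one.indicator ((measurable_id.pow_const 2) hB)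

theorem norm_sqIndicator_le (B : Set ℝ) (x : ℝ) : ‖sqIndicator B x‖ ≤ (1 : NNReal) := by
  simp only [sqIndicator, indicator]
  split_ifs <;> simp

/-- The projections `1_B(x²)`. -/
def sqProj (B : Set ℝ) : L2Half →L[ℂ] L2Half :=
  open Classical in if hB : MeasurableSet B then
    boundedMul (sqIndicator B) 1 (measurable_sqIndicator hB).aestronglyMeasurable
      (Eventually.of_forall (norm_sqIndicator_le B)) else 0

theorem coeFn_sqProj {B : Set ℝ} (hB : MeasurableSet B) {f : L2Half} {u : ℝ → ℂ}
    (hu : f =ᵐ[halfLine] u) : sqProj B f =ᵐ[halfLine] fun x => sqIndicator B x * u x := by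
  rw [sqProj, dif_pos hB]; exact coeFn_boundedMul _ _ hu

theorem sqIndicator_of_mem {B : Set ℝ} {x : ℝ} (h : x ^ 2 ∈ B) : sqIndicator B x = 1 :=
  indicator_of_mem (by exact h) _

theorem sqIndicator_of_notMem {B : Set ℝ} {x : ℝ} (h : x ^ 2 ∉ B) : sqIndicator B x = 0 :=
  indicator_of_notMem (by exact h) _

theorem isProjectionValuedMeasure_sqProj : IsProjectionValuedMeasure sqProj where
  isStarProjection := by
    intro B hB
    refine ⟨?_, ?_⟩
    · refine ContinuousLinearMap.ext fun f => Lp.ext ?_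
      have h1 := coeFn_sqProj hB (EventuallyEq.rfl (f := (f : ℝ → ℂ)))
      refine (coeFn_sqProj hB h1).trans (EventuallyEq.trans ?_ h1.symm)
      refine Eventually.of_forall fun x => ?_
      by_cases hx : x ^ 2 ∈ B
      · simp [sqIndicator_of_mem hx]
      · simp [sqIndicator_of_notMem hx]
    · rw [ContinuousLinearMap.isSelfAdjoint_iff_isSymmetric]
      intro f g
      simp only [ContinuousLinearMap.coe_coe, sqProj, dif_pos hB]
      refine inner_boundedMul _ _ (fun x => ?_) f g
      simp only [sqIndicator, indicator]
      split_ifs <;> simp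
  univ := by
    refine ContinuousLinearMap.ext fun f => Lp.ext ?_
    refine (coeFn_sqProj MeasurableSet.univ EventuallyEq.rfl).trans ?_
    refine Eventually.of_forall fun x => ?_
    simp [sqIndicator]
  hasSum := by
    intro B hB hd f
    have hpt : ∀ᵐ x ∂halfLine, ∀ s : Finset ℕ,
        (∑ i ∈ s, sqProj (B i) f : L2Half) x = ∑ i ∈ s, sqIndicator (B i) x * f x := by
      rw [ae_all_iff]
      intro s
      have h1 : ∀ᵐ x ∂halfLine, ∀ i, sqProj (B i) f x = sqIndicator (B i) x * f x :=
        ae_all_iff.2 fun i => coeFn_sqProj (hB i) EventuallyEq.rfl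
      induction s using Finset.induction_on with
      | empty =>
        filter_upwards [Lp.coeFn_zero ℂ 2 halfLine] with x hx
        rw [Finset.sum_empty, Finset.sum_empty, hx, Pi.zero_apply]
      | insert i s hi ih =>
        filter_upwards [ih, h1, Lp.coeFn_add (sqProj (B i) f) (∑ i ∈ s, sqProj (B i) f)]
          with x h2 h3 h4
        rw [Finset.sum_insert hi, Finset.sum_insert hi, h4, Pi.add_apply, h2, h3]
    have hpU := coeFn_sqProj (MeasurableSet.iUnion hB) (EventuallyEq.rfl (f := (f : ℝ → ℂ)))
    -- By disjointness at most one index contributes at each x. Partial sums are therefore bounded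
    -- by |f x| and eventually constant, and dominated convergence applies along finite sets.
    have hval : ∀ (x : ℝ) (s : Finset ℕ), (∀ i, x ^ 2 ∈ B i → i ∈ s) →
        ∑ i ∈ s, sqIndicator (B i) x * f x = sqIndicator (⋃ i, B i) x * f x := by
      intro x s hs
      by_cases hx : x ^ 2 ∈ ⋃ i, B i
      · obtain ⟨i, hi⟩ := mem_iUnion.1 hx
        rw [sqIndicator_of_mem hx, Finset.sum_eq_single_of_mem i (hs i hi),
          sqIndicator_of_mem hi]
        intro j _ hj
        rw [sqIndicator_of_notMem, zero_mul]
        exact fun hj' => (hd hj).le_bot ⟨hj', hi⟩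
      · rw [sqIndicator_of_notMem hx, zero_mul]
        refine Finset.sum_eq_zero fun i _ => ?_
        rw [sqIndicator_of_notMem, zero_mul]
        exact fun h => hx (mem_iUnion.2 ⟨i, h⟩)
    have hbd : ∀ (x : ℝ) (s : Finset ℕ), ‖∑ i ∈ s, sqIndicator (B i) x * f x‖ ≤ ‖f x‖ := by
      intro x s
      by_cases hx : ∃ i ∈ s, x ^ 2 ∈ B i
      · obtain ⟨i, his, hi⟩ := hx
        rw [Finset.sum_eq_single_of_mem i his, sqIndicator_of_mem hi, one_mul]
        intro j _ hj
        rw [sqIndicator_of_notMem, zero_mul]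
        exact fun hj' => (hd hj).le_bot ⟨hj', hi⟩
      · push Not at hx
        rw [Finset.sum_eq_zero, norm_zero]
        · exact norm_nonneg _
        · intro i hi
          rw [sqIndicator_of_notMem (hx i hi), zero_mul]
    refine tendsto_L2Half_of_dominated (l := atTop) (Lp.memLp f).norm ?_ ?_ ?_
    · intro s
      filter_upwards [hpt] with x hx
      rw [hx]; exact hbd x s
    · filter_upwards [hpU] with x hx
      rw [hx, norm_mul]
      exact mul_le_of_le_one_left (norm_nonneg _) (norm_sqIndicator_le _ x)
    · filter_upwards [hpt, hpU] with x h1 h2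
      have hex : ∃ s₀ : Finset ℕ, ∀ i, x ^ 2 ∈ B i → i ∈ s₀ := by
        by_cases hx : ∃ i, x ^ 2 ∈ B i
        · obtain ⟨i, hi⟩ := hx
          refine ⟨{i}, fun j hj => ?_⟩
          by_contra hne
          exact (hd (fun h => hne (by simp [h]) : j ≠ i)).le_bot ⟨hj, hi⟩
        · push Not at hx
          exact ⟨∅, fun i hi => absurd hi (hx i)⟩
      obtain ⟨s₀, hs₀⟩ := hex
      refine tendsto_const_nhds.congr' ?_
      filter_upwards [eventually_ge_atTop s₀] with s hs
      rw [h1, h2, hval x s fun i hi => hs (hs₀ i hi)]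

theorem sqProj_measure (f : L2Half) : isProjectionValuedMeasure_sqProj.measure f =
    (halfLine.withDensity fun x => ENNReal.ofReal (‖f x‖ ^ 2)).map (fun x => x ^ 2) := by
  ext B hB
  have hm : Measurable fun x : ℝ => x ^ 2 := measurable_id.pow_const 2
  rw [isProjectionValuedMeasure_sqProj.measure_apply f hB, Measure.map_apply hm hB,
    withDensity_apply _ (hm hB), ← lintegral_norm_sq_eq, ← lintegral_indicator (hm hB)]
  refine lintegral_congr_ae ?_
  filter_upwards [coeFn_sqProj hB (EventuallyEq.rfl (f := (f : ℝ → ℂ)))] with x hx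
  rw [hx]
  by_cases h : x ^ 2 ∈ B
  · rw [sqIndicator_of_mem h, indicator_of_mem (by exact h), one_mul]
  · rw [sqIndicator_of_notMem h, indicator_of_notMem (by exact h)]; simp

theorem isSpectralMeasureOf_sqProj : IsSpectralMeasureOf sqProj mulSqOp := by
  have hm : Measurable fun x : ℝ => x ^ 2 := measurable_id.pow_const 2
  have hd : ∀ f : L2Half, Measurable fun x => ENNReal.ofReal (‖f x‖ ^ 2) := fun f =>
    ((Lp.stronglyMeasurable f).measurable.norm.pow_const 2).ennreal_ofReal
  refine ⟨isProjectionValuedMeasure_sqProj, fun f => ?_, fun f => ?_⟩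
  · have e : ∫⁻ t, ENNReal.ofReal (t ^ 2) ∂(isProjectionValuedMeasure_sqProj.measure f) =
        ∫⁻ x, ENNReal.ofReal (‖(x : ℂ) ^ 2 * f x‖ ^ 2) ∂halfLine := by
      rw [sqProj_measure, lintegral_map (by fun_prop) hm,
        lintegral_withDensity_eq_lintegral_mul _ (hd f) (by fun_prop)]
      refine lintegral_congr fun x => ?_
      rw [Pi.mul_apply, ← ENNReal.ofReal_mul (sq_nonneg _), norm_mul, norm_pow, Complex.norm_real,
        Real.norm_eq_abs, sq_abs]
      congr 1; ring
    rw [e, LinearPMap.mem_domain_iff]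
    constructor
    · rintro ⟨g, hg⟩
      rw [mulSqOp_graph, mem_mulSqGraph] at hg
      have h1 : ∫⁻ x, ENNReal.ofReal (‖(x : ℂ) ^ 2 * f x‖ ^ 2) ∂halfLine =
          ∫⁻ x, ENNReal.ofReal (‖g x‖ ^ 2) ∂halfLine := by
        refine lintegral_congr_ae ?_
        filter_upwards [hg] with x hx
        rw [hx]
      rw [h1, lintegral_norm_sq_eq]
      exact ENNReal.ofReal_lt_top
    · intro h
      have hL : MemLp (fun x : ℝ => (x : ℂ) ^ 2 * f x) 2 halfLine :=
        memLp_of_lintegral_norm_sq_lt_top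
          (AEStronglyMeasurable.mul (by fun_prop) (Lp.aestronglyMeasurable f)) h
      exact ⟨toL2Half _, by rw [mulSqOp_graph]; exact coeFn_toL2Half hL⟩
  · have e : ∫ t, (t : ℂ) ∂(isProjectionValuedMeasure_sqProj.measure f) =
        ∫ x, (‖(f : L2Half) x‖ ^ 2 : ℝ) • ((x ^ 2 : ℝ) : ℂ) ∂halfLine := by
      rw [sqProj_measure, integral_map hm.aemeasurable (by fun_prop),
        integral_withDensity_eq_integral_toReal_smul (hd f)
          (Eventually.of_forall fun x => ENNReal.ofReal_lt_top)]
      refine integral_congr_ae (Eventually.of_forall fun x => ?_)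
      simp only
      rw [ENNReal.toReal_ofReal (sq_nonneg _)]
    rw [e, L2.inner_def]
    refine integral_congr_ae ?_
    filter_upwards [mulSqOp_mem f] with x hx
    rw [hx, RCLike.inner_apply, mul_assoc, RCLike.mul_conj, Complex.real_smul]
    push_cast
    exact mul_comm _ _

/-! ### Functions behaving like `x^(1/2 + m)` near the origin -/

theorem hasDerivAt_cpow_ofReal (p : ℂ) {x : ℝ} (hx : 0 < x) :
    HasDerivAt (fun y : ℝ => (y : ℂ) ^ p) (p * (x : ℂ) ^ (p - 1)) x := by
  have h := ((hasDerivAt_id (x : ℂ)).cpow_const (c := p)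
    (Complex.ofReal_mem_slitPlane.2 hx)).comp_ofReal
  simpa using h

theorem cpow_sub_one {x : ℝ} (hx : 0 < x) (p : ℂ) : (x : ℂ) ^ (p - 1) = (x : ℂ) ^ p / x := by
  have hx0 : (x : ℂ) ≠ 0 := by exact_mod_cast hx.ne'
  rw [Complex.cpow_sub _ _ hx0, Complex.cpow_one]

theorem hasDerivAt_gaussPow (p : ℂ) (s : ℝ) {x : ℝ} (hx : 0 < x) :
    HasDerivAt (gaussPow p s) ((p / x - s * x) * gaussPow p s x) x := by
  have h1 := hasDerivAt_cpow_ofReal p hx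
  have h2 : HasDerivAt (fun y : ℝ => (Real.exp (-(s / 2) * y ^ 2) : ℂ))
      ((Real.exp (-(s / 2) * x ^ 2) * (-(s / 2) * (2 * x)) : ℝ) : ℂ) x := by
    have := ((hasDerivAt_pow 2 x).const_mul (-(s / 2))).exp.ofReal_comp
    simpa using this
  have h := h1.mul h2
  refine h.congr_deriv ?_
  rw [cpow_sub_one hx]
  simp only [gaussPow]
  push_cast
  ring

theorem deriv_deriv_eq_of_hasDerivAt {u v : ℝ → ℂ} {v' : ℂ}
    (h1 : ∀ x, 0 < x → HasDerivAt u (v x) x) {x : ℝ} (hx : 0 < x) (h2 : HasDerivAt v v' x) :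
    deriv (deriv u) x = v' := by
  have : deriv u =ᶠ[𝓝 x] v := by
    filter_upwards [Ioi_mem_nhds hx] with y hy using (h1 y hy).deriv
  rw [this.deriv_eq, h2.deriv]

theorem diffExpr_congr_of_eventuallyEq {α : ℂ} {u v : ℝ → ℂ} {x : ℝ} (h : u =ᶠ[𝓝 x] v) :
    diffExpr α u x = diffExpr α v x := by
  simp only [diffExpr, h.deriv.deriv_eq, h.eq_of_nhds]

theorem hasDerivAt_deriv_gaussPow (p : ℂ) (s : ℝ) {x : ℝ} (hx : 0 < x) :
    HasDerivAt (fun y : ℝ => (p / y - s * y) * gaussPow p s y)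
      ((p * (p - 1) / (x : ℂ) ^ 2 - (2 * p + 1) * s + s ^ 2 * (x : ℂ) ^ 2) * gaussPow p s x) x := by
  have hx0 : (x : ℂ) ≠ 0 := by exact_mod_cast hx.ne'
  have h1 : HasDerivAt (fun y : ℝ => p / (y : ℂ) - s * y) (-p / (x : ℂ) ^ 2 - s) x := by
    have hid : HasDerivAt (fun y : ℝ => (y : ℂ)) 1 x := (hasDerivAt_id x).ofReal_comp
    have := ((hasDerivAt_const x p).div hid hx0).sub (hid.const_mul (s : ℂ))
    refine this.congr_deriv ?_
    simp
  refine (h1.mul (hasDerivAt_gaussPow p s hx)).congr_deriv ?_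
  field_simp
  ring

/-- For p = m + 1/2 one has p(p - 1) = m² - 1/4, so the singular terms in x⁻² cancel. -/
theorem diffExpr_gaussPow (m : ℂ) (s : ℝ) {x : ℝ} (hx : 0 < x) :
    diffExpr (m ^ 2) (gaussPow (m + 1 / 2) s) x =
      2 * (m + 1) * s * gaussPow (m + 1 / 2) s x -
        (s : ℂ) ^ 2 * gaussPow (m + 1 / 2 + 2) s x := by
  have hx0 : (x : ℂ) ≠ 0 := by exact_mod_cast hx.ne'
  rw [diffExpr, deriv_deriv_eq_of_hasDerivAt (fun y hy => hasDerivAt_gaussPow _ s hy) hx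
    (hasDerivAt_deriv_gaussPow _ s hx), gaussPow_add_two _ _ hx]
  field_simp
  ring

theorem diffExpr_cpow (m c : ℂ) {x : ℝ} (hx : 0 < x) :
    diffExpr (m ^ 2) (fun y : ℝ => c * (y : ℂ) ^ (m + 1 / 2)) x = 0 := by
  have hx0 : (x : ℂ) ≠ 0 := by exact_mod_cast hx.ne'
  rw [diffExpr, deriv_deriv_eq_of_hasDerivAt
    (fun y hy => (hasDerivAt_cpow_ofReal (m + 1 / 2) hy).const_mul c) hx
    (((hasDerivAt_cpow_ofReal (m + 1 / 2 - 1) hx).const_mul (m + 1 / 2)).const_mul c),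
    cpow_sub_one hx, cpow_sub_one hx]
  field_simp
  ring

/-- Functions smooth on the half-line, equal to a multiple of `x^(1/2 + m)` near `0` and vanishing
near infinity. -/
structure IsAdmissible (m : ℂ) (u : ℝ → ℂ) : Prop where
  smooth : ContDiffOn ℝ ∞ u (Ioi 0)
  near_zero : ∃ c : ℂ, ∃ ε > 0, ∀ x ∈ Ioo 0 ε, u x = c * (x : ℂ) ^ (m + 1 / 2)
  far : ∃ R, ∀ x, R < x → u x = 0

theorem exists_bound_gaussPow {v : ℝ → ℂ} {p c : ℂ} {ε R : ℝ} (hv : ContinuousOn v (Ioi 0))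
    (hε : 0 < ε) (h0 : ∀ x ∈ Ioo 0 ε, v x = c * (x : ℂ) ^ p) (hR : ∀ x, R < x → v x = 0) :
    ∃ K, 0 ≤ K ∧ ∀ x, 0 < x → ‖v x‖ ≤ K * ‖gaussPow p 1 x‖ := by
  have hg : ∀ x, 0 < x → gaussPow p 1 x ≠ 0 := fun x hx => by
    have hx0 : (x : ℂ) ≠ 0 := by exact_mod_cast hx.ne'
    have := (Real.exp_pos (-(1 / 2) * x ^ 2)).ne'
    simp only [gaussPow, ne_eq, mul_eq_zero, not_or, Complex.cpow_eq_zero_iff, Complex.ofReal_eq_zero]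
    exact ⟨fun h => hx.ne' h.1, this⟩
  obtain ⟨K, hK⟩ := isCompact_Icc.exists_bound_of_continuousOn (s := Icc (ε / 2) R)
    (f := fun x => v x / gaussPow p 1 x)
    ((hv.mono fun x hx => (half_pos hε).trans_le hx.1).div
      ((continuousOn_gaussPow p 1).mono fun x hx => (half_pos hε).trans_le hx.1)
      fun x hx => hg x ((half_pos hε).trans_le hx.1))
  refine ⟨max |K| (‖c‖ * Real.exp (1 / 2 * ε ^ 2)), (abs_nonneg K).trans (le_max_left _ _),
    fun x hx => ?_⟩
  rcases lt_or_ge x ε with h1 | h1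
  · rw [h0 x ⟨hx, h1⟩]
    have : (x : ℂ) ^ p = (Real.exp (1 / 2 * x ^ 2) : ℂ) * gaussPow p 1 x := by
      rw [gaussPow, mul_left_comm, ← Complex.ofReal_mul, ← Real.exp_add]; simp
    rw [this, ← mul_assoc, norm_mul, norm_mul, Complex.norm_real,
      Real.norm_of_nonneg (Real.exp_pos _).le]
    refine mul_le_mul_of_nonneg_right (le_trans ?_ (le_max_right _ _)) (norm_nonneg _)
    gcongr
  · rcases le_or_gt x R with h2 | h2
    · have := hK x ⟨by linarith, h2⟩
      rw [norm_div, div_le_iff₀ (norm_pos_iff.2 (hg x hx))] at this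
      refine this.trans (mul_le_mul_of_nonneg_right ?_ (norm_nonneg _))
      exact (le_abs_self K).trans (le_max_left _ _)
    · rw [hR x h2, norm_zero]
      positivity

theorem memLp_of_bound_gaussPow {v : ℝ → ℂ} {p : ℂ} {K : ℝ} (hp : -1 / 2 < p.re)
    (hv : ContinuousOn v (Ioi 0)) (hK : ∀ x, 0 < x → ‖v x‖ ≤ K * ‖gaussPow p 1 x‖) :
    MemLp v 2 halfLine := by
  refine ((memLp_gaussPow hp one_pos).norm.const_mul K).mono
    (hv.aestronglyMeasurable measurableSet_Ioi) (ae_halfLine_of_forall fun x hx => ?_)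
  exact (hK x hx).trans (le_abs_self _)

namespace IsAdmissible

variable {m : ℂ} {u : ℝ → ℂ}

theorem hasDerivAt (h : IsAdmissible m u) {x : ℝ} (hx : 0 < x) : HasDerivAt u (deriv u x) x :=
  ((h.smooth.differentiableOn (by simp)).differentiableAt (Ioi_mem_nhds hx)).hasDerivAt

theorem contDiffOn_deriv (h : IsAdmissible m u) : ContDiffOn ℝ ∞ (deriv u) (Ioi 0) :=
  ((contDiffOn_infty_iff_deriv_of_isOpen isOpen_Ioi).1 h.smooth).2

theorem hasDerivAt_deriv (h : IsAdmissible m u) {x : ℝ} (hx : 0 < x) :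
    HasDerivAt (deriv u) (deriv (deriv u) x) x :=
  ((h.contDiffOn_deriv.differentiableOn (by simp)).differentiableAt (Ioi_mem_nhds hx)).hasDerivAt

theorem continuousOn_diffExpr (h : IsAdmissible m u) (α : ℂ) :
    ContinuousOn (diffExpr α u) (Ioi 0) := by
  have h2 : ContinuousOn (deriv (deriv u)) (Ioi 0) :=
    ((contDiffOn_infty_iff_deriv_of_isOpen isOpen_Ioi).1 h.contDiffOn_deriv).2.continuousOn
  refine h2.neg.add (ContinuousOn.mul (ContinuousOn.div continuousOn_const (by fun_prop) ?_)
    h.smooth.continuousOn)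
  intro x hx
  have : (x : ℂ) ≠ 0 := by exact_mod_cast (ne_of_gt hx)
  exact pow_ne_zero 2 this

theorem diffExpr_near_zero (h : IsAdmissible m u) :
    ∃ ε > 0, ∀ x ∈ Ioo 0 ε, diffExpr (m ^ 2) u x = 0 := by
  obtain ⟨c, ε, hε, hc⟩ := h.near_zero
  refine ⟨ε, hε, fun x hx => ?_⟩
  rw [← diffExpr_cpow m c hx.1]
  refine diffExpr_congr_of_eventuallyEq ?_
  filter_upwards [Ioo_mem_nhds hx.1 hx.2] with y hy using hc y hy

theorem diffExpr_far (h : IsAdmissible m u) : ∃ R, ∀ x, R < x → diffExpr (m ^ 2) u x = 0 := by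
  obtain ⟨R, hR⟩ := h.far
  refine ⟨R, fun x hx => ?_⟩
  have : u =ᶠ[𝓝 x] fun _ => 0 := by
    filter_upwards [Ioi_mem_nhds hx] with y hy using hR y hy
  rw [diffExpr_congr_of_eventuallyEq this]
  simp [diffExpr]

theorem memLp (hm : -1 < m.re) (h : IsAdmissible m u) : MemLp u 2 halfLine := by
  obtain ⟨c, ε, hε, hc⟩ := h.near_zero
  obtain ⟨R, hR⟩ := h.far
  obtain ⟨K, -, hK⟩ := exists_bound_gaussPow h.smooth.continuousOn hε hc hR
  exact memLp_of_bound_gaussPow (hankel_order hm) h.smooth.continuousOn hK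

theorem memLp_diffExpr (hm : -1 < m.re) (h : IsAdmissible m u) :
    MemLp (diffExpr (m ^ 2) u) 2 halfLine := by
  obtain ⟨ε, hε, hc⟩ := h.diffExpr_near_zero
  obtain ⟨R, hR⟩ := h.diffExpr_far
  obtain ⟨K, -, hK⟩ := exists_bound_gaussPow (p := m + 1 / 2) (c := 0)
    (h.continuousOn_diffExpr _) hε (fun x hx => by rw [hc x hx, zero_mul]) hR
  exact memLp_of_bound_gaussPow (hankel_order hm) (h.continuousOn_diffExpr _) hK

/-- Integration by parts against a Gaussian: the boundary term at `0` vanishes. -/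
theorem integral_diffExpr_mul (hm : -1 < m.re) (h : IsAdmissible m u) {s : ℝ} (hs : 0 < s) :
    ∫ x, diffExpr (m ^ 2) u x * gaussPow (m + 1 / 2) s x ∂halfLine =
      ∫ x, u x * diffExpr (m ^ 2) (gaussPow (m + 1 / 2) s) x ∂halfLine := by
  set p := m + 1 / 2 with hp
  set φ := gaussPow p s with hφ
  set φ' : ℝ → ℂ := fun x => (p / x - s * x) * φ x with hφ'
  set W : ℝ → ℂ := fun x => u x * φ' x - deriv u x * φ x with hW
  have hLφ : MemLp (diffExpr (m ^ 2) φ) 2 halfLine := by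
    have h1 := ((memLp_gaussPow (hankel_order hm) hs).const_mul (2 * (m + 1) * s)).sub
      ((memLp_gaussPow (p := p + 2) (s := s) (by
        have := hankel_order hm
        rw [Complex.add_re]
        simp only [← hp] at this
        norm_num at this ⊢; linarith) hs).const_mul ((s : ℂ) ^ 2))
    refine (memLp_congr_ae (ae_halfLine_of_forall fun x hx => ?_)).2 h1
    exact diffExpr_gaussPow m s hx
  have i1 : Integrable (fun x => diffExpr (m ^ 2) u x * φ x) halfLine :=
    (h.memLp_diffExpr hm).integrable_mul (memLp_gaussPow (hankel_order hm) hs)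
  have i2 : Integrable (fun x => u x * diffExpr (m ^ 2) φ x) halfLine :=
    (h.memLp hm).integrable_mul hLφ
  -- W is the Wronskian of u and the Gaussian. It is set to its limit 0 at the origin so that the
  -- fundamental theorem of calculus applies on the closed half-line.
  have hder : ∀ x ∈ Ioi (0 : ℝ), HasDerivAt (Function.update W 0 0)
      (diffExpr (m ^ 2) u x * φ x - u x * diffExpr (m ^ 2) φ x) x := by
    intro x hx
    have hx' : 0 < x := hx
    have hd := ((h.hasDerivAt hx').mul (hasDerivAt_deriv_gaussPow p s hx')).sub
      ((h.hasDerivAt_deriv hx').mul (hasDerivAt_gaussPow p s hx'))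
    have hev : Function.update W 0 0 =ᶠ[𝓝 x] W := by
      filter_upwards [Ioi_mem_nhds hx'] with y hy
      exact Function.update_of_ne (ne_of_gt hy) _ _
    refine (HasDerivAt.congr_of_eventuallyEq ?_ hev)
    refine hd.congr_deriv ?_
    rw [diffExpr, diffExpr, deriv_deriv_eq_of_hasDerivAt
      (fun y hy => hasDerivAt_gaussPow p s hy) hx' (hasDerivAt_deriv_gaussPow p s hx')]
    ring
  have hlim : Tendsto W (𝓝[>] 0) (𝓝 0) := by
    obtain ⟨c, ε, hε, hc⟩ := h.near_zero
    have hb : Tendsto (fun x : ℝ => ‖c‖ * |s| * x ^ (2 * (m.re + 1))) (𝓝[>] 0) (𝓝 0) := by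
      have h0 : Tendsto (fun x : ℝ => x ^ (2 * (m.re + 1))) (𝓝 0) (𝓝 (0 ^ (2 * (m.re + 1)))) :=
        (Real.continuousAt_rpow_const 0 _ (Or.inr (by linarith))).tendsto
      rw [Real.zero_rpow (by linarith)] at h0
      have := Tendsto.const_mul (‖c‖ * |s|) (h0.mono_left (nhdsWithin_le_nhds (s := Ioi 0)))
      rwa [mul_zero] at this
    refine squeeze_zero_norm' ?_ hb
    filter_upwards [Ioo_mem_nhdsGT hε] with x hx
    have hx0 : (x : ℂ) ≠ 0 := by exact_mod_cast hx.1.ne'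
    have hu : u =ᶠ[𝓝 x] fun y : ℝ => c * (y : ℂ) ^ p := by
      filter_upwards [Ioo_mem_nhds hx.1 hx.2] with y hy using hc y hy
    have hdu : deriv u x = c * (p * (x : ℂ) ^ (p - 1)) := by
      rw [hu.deriv_eq]
      exact ((hasDerivAt_cpow_ofReal p hx.1).const_mul c).deriv
    -- Both functions carry the same power x^p near 0, so the p/x terms cancel. What remains is
    -- O(x^(2 Re m + 2)) and vanishes at 0 exactly because Re m > -1.
    have e : W x = -(c * s) * (x * ((x : ℂ) ^ p * φ x)) := by
      simp only [hW, hφ']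
      rw [hc x hx, hdu, cpow_sub_one hx.1, ← hp]
      field_simp
      ring
    rw [e, norm_mul, norm_neg, norm_mul, Complex.norm_real, Real.norm_eq_abs]
    refine mul_le_mul_of_nonneg_left ?_ (by positivity)
    rw [norm_mul, norm_mul, hφ, norm_gaussPow _ _ hx.1, Complex.norm_real,
      Real.norm_of_nonneg hx.1.le, Complex.norm_cpow_eq_rpow_re_of_pos hx.1]
    have he : Real.exp (-(s / 2) * x ^ 2) ≤ 1 := by
      rw [Real.exp_le_one_iff]
      nlinarith [sq_nonneg x]
    have hpre : 2 * (m.re + 1) = 1 + (p.re + p.re) := by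
      rw [hp]; simp; ring
    rw [hpre, Real.rpow_add hx.1, Real.rpow_add hx.1, Real.rpow_one]
    have h1 : 0 ≤ x ^ p.re := Real.rpow_nonneg hx.1.le _
    have h2 := mul_le_of_le_one_right h1 he
    exact mul_le_mul_of_nonneg_left (mul_le_mul_of_nonneg_left h2 h1) hx.1.le
  have hcont : ContinuousWithinAt (Function.update W 0 0) (Ici 0) 0 := by
    rw [continuousWithinAt_update_same]
    rwa [Ici_sdiff_left]
  have hinf : Tendsto (Function.update W 0 0) atTop (𝓝 0) := by
    obtain ⟨R, hR⟩ := h.far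
    refine tendsto_const_nhds.congr' ?_
    filter_upwards [eventually_gt_atTop (max R 0)] with x hx
    have hx0 : 0 < x := (le_max_right _ _).trans_lt hx
    have hxR : R < x := (le_max_left _ _).trans_lt hx
    have hev : u =ᶠ[𝓝 x] fun _ => 0 := by
      filter_upwards [Ioi_mem_nhds hxR] with y hy using hR y hy
    rw [Function.update_of_ne hx0.ne']
    simp only [hW]
    rw [hR x hxR, hev.deriv_eq]
    simp
  have := integral_Ioi_of_hasDerivAt_of_tendsto hcont hder (i1.sub i2) hinf
  rw [Function.update_self, sub_zero, integral_sub i1 i2, sub_eq_zero] at this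
  exact this

end IsAdmissible

/-! ### The operator `H_m` is the Hankel conjugate of multiplication by `k²` -/

theorem contDiffOn_cpow_ofReal (p : ℂ) :
    ContDiffOn ℝ ∞ (fun x : ℝ => (x : ℂ) ^ p) (Ioi 0) := by
  intro x hx
  have h1 : ContDiffAt ℂ ∞ (fun z : ℂ => z ^ p) (x : ℂ) :=
    (analyticAt_id.cpow analyticAt_const (Complex.ofReal_mem_slitPlane.2 hx)).contDiffAt
  exact ((h1.restrict_scalars ℝ).comp x Complex.ofRealCLM.contDiff.contDiffAt).contDiffWithinAt

section HankelGraph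

variable {m : ℂ} (hm : -1 < m.re)

/-- The class of `L_{m²} (x^(1/2 + m) exp (- s x² / 2))`. -/
def diffGaussL2 (m : ℂ) (s : ℝ) : L2Half :=
  (2 * (m + 1) * s) • gaussL2 (m + 1 / 2) s - ((s : ℂ) ^ 2) • gaussL2 (m + 1 / 2 + 2) s

/-- The graph of the operator `F k² F`, where `F` is the Hankel transform. -/
def hankelGraph : Submodule ℂ (L2Half × L2Half) :=
  mulSqGraph.comap ((hankel hm : L2Half →ₗ[ℂ] L2Half).prodMap (hankel hm : L2Half →ₗ[ℂ] L2Half))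

theorem mem_hankelGraph {f g : L2Half} :
    (f, g) ∈ hankelGraph hm ↔ (hankel hm f, hankel hm g) ∈ mulSqGraph := Iff.rfl

theorem isClosed_hankelGraph : IsClosed (hankelGraph hm : Set (L2Half × L2Half)) :=
  isClosed_mulSqGraph.preimage
    (((hankel hm).continuous.comp continuous_fst).prodMk ((hankel hm).continuous.comp continuous_snd))

include hm

theorem hankel_order_add_two : -1 / 2 < (m + 1 / 2 + 2).re := by
  have := hankel_order hm
  rw [Complex.add_re]
  norm_num at this ⊢
  linarith

/-- This is F k² = L F on Gaussians. Pairing with g_t and moving F across by symmetry makes both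
sides explicit in s and t; they agree by Γ(m+2) = (m+1)Γ(m+1). -/
theorem hankel_gaussL2_add_two {s : ℝ} (hs : 0 < s) :
    hankel hm (gaussL2 (m + 1 / 2 + 2) s) = (s : ℂ) ^ (-m - 1) • diffGaussL2 m s⁻¹ := by
  have hs0 : (s : ℂ) ≠ 0 := by exact_mod_cast hs.ne'
  have hp := hankel_order hm
  have hp2 := hankel_order_add_two hm
  have hs' := inv_pos.2 hs
  refine L2Half.ext_of_pairing_gaussL2 hp fun t ht => ?_
  have ht0 : (t : ℂ) ≠ 0 := by exact_mod_cast ht.ne'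
  have hG : Complex.Gamma (m + 2) = (m + 1) * Complex.Gamma (m + 1) := by
    have h1 : m + 1 ≠ 0 := fun h => by
      have := congrArg Complex.re h
      simp at this; linarith
    rw [← Complex.Gamma_add_one _ h1]; congr 1; ring
  have hst : (1 + (s : ℂ) * t) ≠ 0 := by
    have : (1 + s * t : ℝ) ≠ 0 := by positivity
    exact_mod_cast this
  have hts : (1 + (t : ℂ) * s) ≠ 0 := by rwa [mul_comm (t : ℂ)]
  rw [pairing_hankel, hankel_gaussL2 hm ht, map_smul, diffGaussL2, map_sub, map_smul, map_smul,
    pairing_comm, map_smul, pairing_gaussL2 (w := m + 2) hp2 hp hs (inv_pos.2 ht) (by ring),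
    pairing_gaussL2 (w := m + 1) hp hp ht hs' (by ring),
    pairing_gaussL2 (w := m + 2) hp hp2 ht hs' (by ring), hG]
  simp only [smul_eq_mul]
  have hA : (2 / (s + t⁻¹) : ℝ) = t * (2 / (1 + s * t)) := by field_simp; ring
  have hB : (2 / (t + s⁻¹) : ℝ) = s * (2 / (1 + s * t)) := by field_simp; ring
  have hpos : 0 < 2 / (1 + s * t) := by positivity
  have hA0 : ((2 / (1 + s * t) : ℝ) : ℂ) ≠ 0 := by exact_mod_cast hpos.ne'
  rw [hA, hB, Complex.ofReal_mul t, Complex.ofReal_mul s,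
    Complex.mul_cpow_ofReal_nonneg ht.le hpos.le, Complex.mul_cpow_ofReal_nonneg hs.le hpos.le,
    Complex.mul_cpow_ofReal_nonneg hs.le hpos.le]
  have k : ∀ {z : ℂ}, z ≠ 0 → z ^ (m + 2) = z ^ (m + 1) * z := fun hz => by
    rw [show m + 2 = m + 1 + 1 by ring, Complex.cpow_add _ _ hz, Complex.cpow_one]
  have es : (s : ℂ) ^ (-m - 1) = ((s : ℂ) ^ (m + 1))⁻¹ := by
    rw [← Complex.cpow_neg]; congr 1; ring
  have et : (t : ℂ) ^ (-m - 1) = ((t : ℂ) ^ (m + 1))⁻¹ := by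
    rw [← Complex.cpow_neg]; congr 1; ring
  have hs1 : (s : ℂ) ^ (m + 1) ≠ 0 := by simp [Complex.cpow_eq_zero_iff, hs0]
  have ht1 : (t : ℂ) ^ (m + 1) ≠ 0 := by simp [Complex.cpow_eq_zero_iff, ht0]
  rw [k hs0, k ht0, k hA0, es, et]
  generalize (s : ℂ) ^ (m + 1) = a at *
  generalize (t : ℂ) ^ (m + 1) = b at *
  generalize ((2 / (1 + s * t) : ℝ) : ℂ) ^ (m + 1) = d at *
  push_cast
  field_simp
  ring

theorem IsAdmissible.pairing_toL2Half_diffExpr {u : ℝ → ℂ} (hu : IsAdmissible m u) {s : ℝ}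
    (hs : 0 < s) :
    pairing (gaussL2 (m + 1 / 2) s) (toL2Half (diffExpr (m ^ 2) u)) =
      pairing (diffGaussL2 m s) (toL2Half u) := by
  rw [gaussL2, pairing_toL2Half (memLp_gaussPow (hankel_order hm) hs) (hu.memLp_diffExpr hm),
    hu.integral_diffExpr_mul hm hs, pairing_apply]
  refine integral_congr_ae ?_
  filter_upwards [coeFn_toL2Half (hu.memLp hm), ae_restrict_mem measurableSet_Ioi,
    Lp.coeFn_sub ((2 * (m + 1) * s) • gaussL2 (m + 1 / 2) s)
      (((s : ℂ) ^ 2) • gaussL2 (m + 1 / 2 + 2) s),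
    Lp.coeFn_smul (2 * (m + 1) * s) (gaussL2 (m + 1 / 2) s),
    Lp.coeFn_smul ((s : ℂ) ^ 2) (gaussL2 (m + 1 / 2 + 2) s),
    coeFn_gaussL2 (hankel_order hm) hs, coeFn_gaussL2 (hankel_order_add_two hm) hs]
    with x h1 hx h2 h3 h4 h5 h6
  rw [diffGaussL2, h1, h2, Pi.sub_apply, h3, h4, Pi.smul_apply, Pi.smul_apply, h5, h6,
    diffExpr_gaussPow m s hx, smul_eq_mul, smul_eq_mul]

/-- Admissible functions lie in the domain of `F k² F`. -/
theorem IsAdmissible.mem_hankelGraph {u : ℝ → ℂ} (hu : IsAdmissible m u) :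
    (toL2Half u, toL2Half (diffExpr (m ^ 2) u)) ∈ hankelGraph hm := by
  rw [_root_.mem_hankelGraph, mem_mulSqGraph]
  set U := toL2Half u
  set V := toL2Half (diffExpr (m ^ 2) u)
  have hp := hankel_order hm
  have hp2 := hankel_order_add_two hm
  have i1 : ∀ s, 0 < s → Integrable (fun x => hankel hm V x * gaussPow (m + 1 / 2) s x) halfLine :=
    fun s hs => (Lp.memLp _).integrable_mul (memLp_gaussPow hp hs)
  have i2 : ∀ s, 0 < s →
      Integrable (fun x : ℝ => (x : ℂ) ^ 2 * hankel hm U x * gaussPow (m + 1 / 2) s x) halfLine := by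
    intro s hs
    have : Integrable (fun x => hankel hm U x * gaussPow (m + 1 / 2 + 2) s x) halfLine :=
      (Lp.memLp _).integrable_mul (memLp_gaussPow hp2 hs)
    refine this.congr (ae_halfLine_of_forall fun x hx => ?_)
    simp only
    rw [gaussPow_add_two _ _ hx]; ring
  -- Here ⟨FV, g_s⟩ = ⟨Lu, F g_s⟩ = s^(-m-1)⟨u, L g_(1/s)⟩ = ⟨u, F(x² g_s)⟩ = ⟨FU, x² g_s⟩, by
  -- symmetry and integration by parts. That x² FU is in L² is not known beforehand, so uniqueness
  -- is applied to a function not assumed square integrable.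
  have key : ∀ s, 0 < s → ∫ x, (hankel hm V x - (x : ℂ) ^ 2 * hankel hm U x) *
      gaussPow (m + 1 / 2) s x ∂halfLine = 0 := by
    intro s hs
    simp only [sub_mul]
    rw [integral_sub (i1 s hs) (i2 s hs), sub_eq_zero,
      ← pairing_toL2Half_right (memLp_gaussPow hp hs)]
    have e1 : ∫ x, (x : ℂ) ^ 2 * hankel hm U x * gaussPow (m + 1 / 2) s x ∂halfLine =
        pairing (gaussL2 (m + 1 / 2 + 2) s) (hankel hm U) := by
      rw [gaussL2, pairing_toL2Half_right (memLp_gaussPow hp2 hs)]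
      refine integral_congr_ae (ae_halfLine_of_forall fun x hx => ?_)
      simp only
      rw [gaussPow_add_two _ _ hx]; ring
    have e2 := pairing_hankel hm V (gaussL2 (m + 1 / 2) s)
    rw [gaussL2] at e2
    rw [e1, e2, pairing_hankel, ← gaussL2, hankel_gaussL2 hm hs, hankel_gaussL2_add_two hm hs,
      pairing_comm, map_smul, pairing_comm, hu.pairing_toL2Half_diffExpr hm (inv_pos.2 hs),
      pairing_comm _ ((s : ℂ) ^ (-m - 1) • diffGaussL2 m s⁻¹), map_smul, pairing_comm]
  have h := ae_eq_zero_of_integral_mul_gaussPow_eq_zero (s₀ := 1) (p := m + 1 / 2)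
    (h := fun x => hankel hm V x - (x : ℂ) ^ 2 * hankel hm U x)
    (by simpa only [sub_mul] using! (i1 1 one_pos).sub (i2 1 one_pos))
    (fun s hs => key s (one_pos.trans_le hs))
  filter_upwards [h] with x hx
  exact sub_eq_zero.1 hx

omit hm in
theorem IsHalfLineTest.isAdmissible {φ : ℝ → ℂ} (h : IsHalfLineTest φ) : IsAdmissible m φ := by
  refine ⟨h.smooth.contDiffOn, ⟨0, ?_⟩, ?_⟩
  · have h0 : (0 : ℝ) ∉ tsupport φ := fun h' => lt_irrefl (0 : ℝ) (h.supp h')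
    obtain ⟨ε, hε, hz⟩ := Metric.eventually_nhds_iff.1 (notMem_tsupport_iff_eventuallyEq.1 h0)
    refine ⟨ε, hε, fun x hx => ?_⟩
    rw [hz (by rw [Real.dist_0_eq_abs, abs_of_pos hx.1]; exact hx.2)]
    simp
  · obtain ⟨R, hR⟩ := h.compact.isCompact.bddAbove
    exact ⟨R, fun x hx => image_eq_zero_of_notMem_tsupport fun h' => absurd (hR h') (not_le.2 hx)⟩

theorem coreGraph_le_hankelGraph : coreGraph (m ^ 2) ≤ hankelGraph hm := by
  rintro ⟨f, g⟩ ⟨φ, hφ, h1, h2⟩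
  obtain rfl := toL2Half_eq_of_ae h1
  obtain rfl := toL2Half_eq_of_ae h2
  exact hφ.isAdmissible.mem_hankelGraph hm

theorem minGraph_le_hankelGraph : minGraph (m ^ 2) ≤ hankelGraph hm :=
  Submodule.topologicalClosure_minimal _ (coreGraph_le_hankelGraph hm) (isClosed_hankelGraph hm)

/-- Test functions are admissible, so L becomes k² on them after applying F. Symmetry and F² = 1
carry the distributional identity to the Hankel side, where the factor k² can be put on either
function. -/
theorem hankelGraph_le_maxGraph : hankelGraph hm ≤ maxGraph (m ^ 2) := by
  rintro ⟨f, g⟩ hfg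
  rw [mem_maxGraph]
  intro φ hφ
  have h1 := (hφ.isAdmissible (m := m)).mem_hankelGraph hm
  rw [mem_hankelGraph, mem_mulSqGraph] at h1 hfg
  have e1 := pairing_hankel hm (hankel hm f) (toL2Half (diffExpr (m ^ 2) φ))
  have e2 := pairing_hankel hm (hankel hm g) (toL2Half φ)
  rw [hankel_hankel] at e1 e2
  rw [← pairing_toL2Half_right (hφ.diffExpr _).memLp, ← pairing_toL2Half_right hφ.memLp, e1, e2,
    pairing_apply, pairing_apply]
  refine integral_congr_ae ?_
  filter_upwards [h1, hfg] with x h2 h3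
  rw [h2, h3]; ring

omit hm in
theorem IsCutoffAtZero.isAdmissible {ξ : ℝ → ℝ} (hξ : IsCutoffAtZero ξ) :
    IsAdmissible m (fun x => (x : ℂ) ^ (1 / 2 + m) * (ξ x : ℂ)) := by
  refine ⟨?_, ⟨1, ?_⟩, ?_⟩
  · exact (contDiffOn_cpow_ofReal _).mul
      (Complex.ofRealCLM.contDiff.comp hξ.smooth).contDiffOn
  · obtain ⟨ε, hε, hz⟩ := Metric.eventually_nhds_iff.1 hξ.eq_one
    refine ⟨ε, hε, fun x hx => ?_⟩
    rw [hz (by rw [Real.dist_0_eq_abs, abs_of_pos hx.1]; exact hx.2), add_comm m]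
    simp
  · obtain ⟨R, hR⟩ := hξ.compact.isCompact.bddAbove
    refine ⟨R, fun x hx => ?_⟩
    rw [image_eq_zero_of_notMem_tsupport (f := ξ) fun h' => absurd (hR h') (not_le.2 hx)]
    simp

end HankelGraph

/-! ### Cutoffs on the half-line -/

theorem exists_bound_deriv_smoothTransition :
    ∃ M, 0 ≤ M ∧ ∀ y, |deriv Real.smoothTransition y| ≤ M := by
  have hc : Continuous (deriv Real.smoothTransition) :=
    (Real.smoothTransition.contDiff (n := 1)).continuous_deriv le_rfl
  obtain ⟨M, hM⟩ := isCompact_Icc.exists_bound_of_continuousOn (s := Icc (0 : ℝ) 1) hc.continuousOn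
  refine ⟨|M|, abs_nonneg _, fun y => ?_⟩
  by_cases hy : y ∈ Icc (0 : ℝ) 1
  · exact (hM y hy).trans (le_abs_self M)
  · have : deriv Real.smoothTransition y = 0 := by
      rcases not_and_or.1 hy with h | h
      · have : Real.smoothTransition =ᶠ[𝓝 y] fun _ => 0 := by
          filter_upwards [Iio_mem_nhds (not_le.1 h)] with z hz
          exact Real.smoothTransition.zero_of_nonpos (le_of_lt hz)
        rw [this.deriv_eq, deriv_const]
      · have : Real.smoothTransition =ᶠ[𝓝 y] fun _ => 1 := by
          filter_upwards [Ioi_mem_nhds (not_le.1 h)] with z hz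
          exact Real.smoothTransition.one_of_one_le (le_of_lt hz)
        rw [this.deriv_eq, deriv_const]
    rw [this, abs_zero]
    exact abs_nonneg _

theorem deriv_smoothTransition_of_neg {y : ℝ} (h : y < 0) :
    deriv Real.smoothTransition y = 0 := by
  have : Real.smoothTransition =ᶠ[𝓝 y] fun _ => 0 := by
    filter_upwards [Iio_mem_nhds h] with z hz
    exact Real.smoothTransition.zero_of_nonpos (le_of_lt hz)
  rw [this.deriv_eq, deriv_const]

theorem deriv_smoothTransition_of_one_lt {y : ℝ} (h : 1 < y) :
    deriv Real.smoothTransition y = 0 := by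
  have : Real.smoothTransition =ᶠ[𝓝 y] fun _ => 1 := by
    filter_upwards [Ioi_mem_nhds h] with z hz
    exact Real.smoothTransition.one_of_one_le (le_of_lt hz)
  rw [this.deriv_eq, deriv_const]

/-- A cutoff to the interval `[1/N, 2N]`. -/
def halfLineCutoff (N x : ℝ) : ℝ :=
  Real.smoothTransition (N * x - 1) * Real.smoothTransition (2 - x / N)

/-- The derivative of `halfLineCutoff N`. -/
def halfLineCutoffDeriv (N x : ℝ) : ℝ :=
  deriv Real.smoothTransition (N * x - 1) * N * Real.smoothTransition (2 - x / N) +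
    Real.smoothTransition (N * x - 1) * (deriv Real.smoothTransition (2 - x / N) * (-(1 / N)))

theorem contDiff_halfLineCutoff (N : ℝ) : ContDiff ℝ ∞ (halfLineCutoff N) :=
  (Real.smoothTransition.contDiff.comp (by fun_prop)).mul
    (Real.smoothTransition.contDiff.comp (by fun_prop))

theorem hasDerivAt_halfLineCutoff (N x : ℝ) :
    HasDerivAt (halfLineCutoff N) (halfLineCutoffDeriv N x) x := by
  have hst : ∀ y, HasDerivAt Real.smoothTransition (deriv Real.smoothTransition y) y := fun y =>
    ((Real.smoothTransition.contDiff (n := 1)).differentiable (by simp) y).hasDerivAt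
  have h1 : HasDerivAt (fun y : ℝ => N * y - 1) N x := by
    simpa using ((hasDerivAt_id x).const_mul N).sub_const 1
  have h2 : HasDerivAt (fun y : ℝ => 2 - y / N) (-(1 / N)) x := by
    simpa using ((hasDerivAt_id x).div_const N).const_sub 2
  exact ((hst _).comp x h1).mul ((hst _).comp x h2)

theorem halfLineCutoff_nonneg (N x : ℝ) : 0 ≤ halfLineCutoff N x :=
  mul_nonneg (Real.smoothTransition.nonneg _) (Real.smoothTransition.nonneg _)

theorem halfLineCutoff_le_one (N x : ℝ) : halfLineCutoff N x ≤ 1 :=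
  mul_le_one₀ (Real.smoothTransition.le_one _) (Real.smoothTransition.nonneg _)
    (Real.smoothTransition.le_one _)

theorem halfLineCutoff_of_lt {N x : ℝ} (hN : 0 < N) (h : x < 1 / N) : halfLineCutoff N x = 0 := by
  rw [lt_div_iff₀ hN] at h
  rw [halfLineCutoff, Real.smoothTransition.zero_of_nonpos (by linarith), zero_mul]

theorem halfLineCutoff_of_gt {N x : ℝ} (hN : 0 < N) (h : 2 * N < x) : halfLineCutoff N x = 0 := by
  rw [← lt_div_iff₀ hN] at h
  rw [halfLineCutoff, Real.smoothTransition.zero_of_nonpos (x := 2 - x / N) (by linarith), mul_zero]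

theorem halfLineCutoff_eq_one {N x : ℝ} (h1 : 2 < N * x) (h2 : x / N < 1) :
    halfLineCutoff N x = 1 := by
  rw [halfLineCutoff, Real.smoothTransition.one_of_one_le (by linarith),
    Real.smoothTransition.one_of_one_le (by linarith), one_mul]

theorem halfLineCutoffDeriv_eq_zero {N x : ℝ} (h1 : 2 < N * x) (h2 : x / N < 1) :
    halfLineCutoffDeriv N x = 0 := by
  rw [halfLineCutoffDeriv, deriv_smoothTransition_of_one_lt (by linarith),
    deriv_smoothTransition_of_one_lt (by linarith)]
  ring

/-- Scale invariance: the derivative is of size N only where 1 ≤ Nx ≤ 2, and of size 1/N only where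
N ≤ x ≤ 2N. -/
theorem exists_bound_mul_halfLineCutoffDeriv :
    ∃ M, 0 ≤ M ∧ ∀ N x, 0 < N → 0 < x → |x * halfLineCutoffDeriv N x| ≤ M := by
  obtain ⟨M, hM0, hM⟩ := exists_bound_deriv_smoothTransition
  refine ⟨4 * M, by positivity, fun N x hN hx => ?_⟩
  have e : x * halfLineCutoffDeriv N x =
      (N * x * deriv Real.smoothTransition (N * x - 1)) * Real.smoothTransition (2 - x / N) -
      Real.smoothTransition (N * x - 1) * (x / N * deriv Real.smoothTransition (2 - x / N)) := by
    rw [halfLineCutoffDeriv]; field_simp; ring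
  have hs : ∀ y, |Real.smoothTransition y| ≤ 1 := fun y => by
    rw [abs_of_nonneg (Real.smoothTransition.nonneg _)]; exact Real.smoothTransition.le_one _
  have h1 : |N * x * deriv Real.smoothTransition (N * x - 1)| ≤ 2 * M := by
    rcases le_or_gt (N * x) 2 with h | h
    · rw [abs_mul, abs_of_pos (mul_pos hN hx)]
      exact mul_le_mul h (hM _) (abs_nonneg _) (by norm_num)
    · rw [deriv_smoothTransition_of_one_lt (by linarith), mul_zero, abs_zero]; positivity
  have h2 : |x / N * deriv Real.smoothTransition (2 - x / N)| ≤ 2 * M := by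
    rcases le_or_gt (x / N) 2 with h | h
    · rw [abs_mul, abs_of_pos (div_pos hx hN)]
      exact mul_le_mul h (hM _) (abs_nonneg _) (by norm_num)
    · rw [deriv_smoothTransition_of_neg (by linarith), mul_zero, abs_zero]; positivity
  rw [e]
  refine (abs_sub _ _).trans ?_
  rw [abs_mul, abs_mul (Real.smoothTransition (N * x - 1))]
  have h3 := mul_le_mul h1 (hs (2 - x / N)) (abs_nonneg _) (by positivity)
  have h4 := mul_le_mul (hs (N * x - 1)) h2 (abs_nonneg _) zero_le_one
  linarith

theorem eventually_halfLineCutoff {x : ℝ} (hx : 0 < x) :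
    ∀ᶠ n : ℕ in atTop, 2 < ((n : ℝ) + 1) * x ∧ x / ((n : ℝ) + 1) < 1 := by
  have h1 : Tendsto (fun n : ℕ => (n : ℝ) + 1) atTop atTop :=
    tendsto_atTop_add_const_right _ _ tendsto_natCast_atTop_atTop
  filter_upwards [h1.eventually_gt_atTop (2 / x), h1.eventually_gt_atTop x] with n h2 h3
  have hpos : (0 : ℝ) < (n : ℝ) + 1 := by positivity
  exact ⟨(div_lt_iff₀ hx).1 h2, (div_lt_one hpos).2 h3⟩

/-! ### Approximation of Gaussians by admissible functions -/

/-- Minus the derivative of `exp (- s x² / 2)`, cut off to a compact subset of the half-line. -/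
def cutGaussDeriv (s N x : ℝ) : ℝ := s * x * Real.exp (-(s / 2) * x ^ 2) * halfLineCutoff N x

/-- The approximation of `exp (- s x² / 2)` which is constant near `0` and compactly supported. -/
def cutGauss (s N x : ℝ) : ℝ := ∫ t in Ioi x, cutGaussDeriv s N t

section CutGauss

variable {s N : ℝ}

theorem contDiff_cutGaussDeriv (s N : ℝ) : ContDiff ℝ ∞ (cutGaussDeriv s N) :=
  ContDiff.mul (by fun_prop) (contDiff_halfLineCutoff N)

theorem integrable_cutGaussDeriv (s : ℝ) (hN : 0 < N) : Integrable (cutGaussDeriv s N) := by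
  refine (contDiff_cutGaussDeriv s N).continuous.integrable_of_hasCompactSupport
    (HasCompactSupport.intro (isCompact_Icc (a := 1 / N) (b := 2 * N)) fun x hx => ?_)
  rcases not_and_or.1 hx with h | h
  · rw [cutGaussDeriv, halfLineCutoff_of_lt hN (not_le.1 h), mul_zero]
  · rw [cutGaussDeriv, halfLineCutoff_of_gt hN (not_le.1 h), mul_zero]

theorem cutGauss_eq (s : ℝ) (hN : 0 < N) (x : ℝ) :
    cutGauss s N x = cutGauss s N 0 - ∫ t in (0 : ℝ)..x, cutGaussDeriv s N t := by
  have h := (integrable_cutGaussDeriv s hN)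
  rw [← intervalIntegral.integral_Ioi_sub_Ioi' h.integrableOn h.integrableOn]
  simp only [cutGauss]
  ring

theorem hasDerivAt_cutGauss (s : ℝ) (hN : 0 < N) (x : ℝ) :
    HasDerivAt (cutGauss s N) (-cutGaussDeriv s N x) x := by
  have hc := (contDiff_cutGaussDeriv s N).continuous
  have h := (hc.integral_hasStrictDerivAt 0 x).hasDerivAt.const_sub (cutGauss s N 0)
  exact h.congr_of_eventuallyEq (Eventually.of_forall fun y => cutGauss_eq s hN y)

theorem contDiff_cutGauss (s : ℝ) (hN : 0 < N) : ContDiff ℝ ∞ (cutGauss s N) := by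
  rw [contDiff_infty_iff_deriv]
  refine ⟨fun x => (hasDerivAt_cutGauss s hN x).differentiableAt, ?_⟩
  have : deriv (cutGauss s N) = fun x => -cutGaussDeriv s N x :=
    funext fun x => (hasDerivAt_cutGauss s hN x).deriv
  rw [this]
  exact (contDiff_cutGaussDeriv s N).neg

theorem cutGauss_of_lt (s : ℝ) (hN : 0 < N) {x : ℝ} (h0 : 0 < x) (hx : x < 1 / N) :
    cutGauss s N x = cutGauss s N 0 := by
  rw [cutGauss_eq s hN, intervalIntegral.integral_of_le h0.le, setIntegral_eq_zero_of_forall_eq_zero,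
    sub_zero]
  intro t ht
  rw [cutGaussDeriv, halfLineCutoff_of_lt hN (ht.2.trans_lt hx), mul_zero]

theorem cutGauss_of_gt (s : ℝ) (hN : 0 < N) {x : ℝ} (hx : 2 * N < x) : cutGauss s N x = 0 :=
  setIntegral_eq_zero_of_forall_eq_zero fun t ht => by
    rw [cutGaussDeriv, halfLineCutoff_of_gt hN (hx.trans ht), mul_zero]

theorem integral_gaussDeriv (hs : 0 < s) {x : ℝ} (hx : 0 ≤ x) :
    IntegrableOn (fun t => s * t * Real.exp (-(s / 2) * t ^ 2)) (Ioi x) ∧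
    ∫ t in Ioi x, s * t * Real.exp (-(s / 2) * t ^ 2) = Real.exp (-(s / 2) * x ^ 2) := by
  have hd : ∀ t ∈ Ici x, HasDerivAt (fun t => -Real.exp (-(s / 2) * t ^ 2))
      (s * t * Real.exp (-(s / 2) * t ^ 2)) t := by
    intro t _
    refine (((hasDerivAt_pow 2 t).const_mul (-(s / 2))).exp.neg).congr_deriv ?_
    norm_num
    ring
  have hpos : ∀ t ∈ Ioi x, 0 ≤ s * t * Real.exp (-(s / 2) * t ^ 2) := fun t ht => by
    have : 0 < t := hx.trans_lt ht
    positivity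
  have hlim : Tendsto (fun t => -Real.exp (-(s / 2) * t ^ 2)) atTop (𝓝 0) := by
    rw [← neg_zero]
    refine (Real.tendsto_exp_atBot.comp ?_).neg
    exact (tendsto_pow_atTop two_ne_zero).const_mul_atTop_of_neg (by linarith)
  refine ⟨integrableOn_Ioi_deriv_of_nonneg' hd hpos hlim, ?_⟩
  rw [integral_Ioi_of_hasDerivAt_of_nonneg' hd hpos hlim]
  ring

theorem abs_cutGauss_le (hs : 0 < s) (N : ℝ) {x : ℝ} (hx : 0 ≤ x) :
    |cutGauss s N x| ≤ Real.exp (-(s / 2) * x ^ 2) := by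
  obtain ⟨hi, he⟩ := integral_gaussDeriv hs hx
  rw [← he, ← Real.norm_eq_abs]
  refine norm_integral_le_of_norm_le hi ?_
  filter_upwards [ae_restrict_mem measurableSet_Ioi] with t ht
  have h0 : 0 < t := hx.trans_lt ht
  have h1 : 0 ≤ s * t * Real.exp (-(s / 2) * t ^ 2) := by positivity
  rw [cutGaussDeriv, Real.norm_of_nonneg (mul_nonneg h1 (halfLineCutoff_nonneg N t))]
  exact mul_le_of_le_one_right h1 (halfLineCutoff_le_one N t)

theorem tendsto_cutGauss (hs : 0 < s) {x : ℝ} (hx : 0 ≤ x) :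
    Tendsto (fun n : ℕ => cutGauss s (n + 1) x) atTop (𝓝 (Real.exp (-(s / 2) * x ^ 2))) := by
  obtain ⟨hi, he⟩ := integral_gaussDeriv hs hx
  rw [← he]
  refine tendsto_integral_of_dominated_convergence _
    (fun n => (contDiff_cutGaussDeriv s _).continuous.aestronglyMeasurable) hi ?_ ?_
  · intro n
    filter_upwards [ae_restrict_mem measurableSet_Ioi] with t ht
    have h0 : 0 < t := hx.trans_lt ht
    have h1 : 0 ≤ s * t * Real.exp (-(s / 2) * t ^ 2) := by positivity
    rw [cutGaussDeriv, Real.norm_of_nonneg (mul_nonneg h1 (halfLineCutoff_nonneg _ t))]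
    exact mul_le_of_le_one_right h1 (halfLineCutoff_le_one _ t)
  · filter_upwards [ae_restrict_mem measurableSet_Ioi] with t ht
    have h0 : 0 < t := hx.trans_lt ht
    refine tendsto_const_nhds.congr' ?_
    filter_upwards [eventually_halfLineCutoff h0] with n hn
    rw [cutGaussDeriv, halfLineCutoff_eq_one hn.1 hn.2, mul_one]

/-- The factor in `L_{m²}(x^(1/2+m) cutGauss)` besides the Gaussian. -/
def cutGaussFactor (m : ℂ) (s N x : ℝ) : ℂ :=
  ((s * (1 - s * x ^ 2) * halfLineCutoff N x + s * (x * halfLineCutoffDeriv N x) : ℝ) : ℂ) +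
    (2 * m + 1) * ((s * halfLineCutoff N x : ℝ) : ℂ)

theorem hasDerivAt_cutGaussDeriv (s N x : ℝ) : HasDerivAt (cutGaussDeriv s N)
    (Real.exp (-(s / 2) * x ^ 2) *
      (s * (1 - s * x ^ 2) * halfLineCutoff N x + s * (x * halfLineCutoffDeriv N x))) x := by
  have h1 : HasDerivAt (fun y => s * y) s x := by simpa using (hasDerivAt_id x).const_mul s
  have h2 := ((hasDerivAt_pow 2 x).const_mul (-(s / 2))).exp
  refine ((h1.mul h2).mul (hasDerivAt_halfLineCutoff N x)).congr_deriv ?_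
  simp only [Pi.mul_apply]
  norm_num
  ring

variable {m : ℂ}

/-- The derivative of the Gaussian is cut off and integrated back, instead of the Gaussian itself
being cut off. The result is constant near 0, so the product is exactly a multiple of x^(m+1/2)
there. -/
theorem isAdmissible_cutGauss (s : ℝ) (hN : 0 < N) :
    IsAdmissible m (fun x => (x : ℂ) ^ (m + 1 / 2) * (cutGauss s N x : ℂ)) := by
  refine ⟨(contDiffOn_cpow_ofReal _).mul
    (Complex.ofRealCLM.contDiff.comp (contDiff_cutGauss s hN)).contDiffOn, ?_, ?_⟩
  · refine ⟨(cutGauss s N 0 : ℂ), 1 / N, by positivity, fun x hx => ?_⟩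
    rw [cutGauss_of_lt s hN hx.1 hx.2, mul_comm]
  · refine ⟨2 * N, fun x hx => ?_⟩
    rw [cutGauss_of_gt s hN hx]; simp

/-- The x⁻² terms cancel as for pure powers. The cross term, of the form 2p/x times `cutGaussDeriv`,
stays regular because `cutGaussDeriv` contains a factor x. -/
theorem diffExpr_cutGauss (s : ℝ) (hN : 0 < N) {x : ℝ} (hx : 0 < x) :
    diffExpr (m ^ 2) (fun x : ℝ => (x : ℂ) ^ (m + 1 / 2) * (cutGauss s N x : ℂ)) x =
      cutGaussFactor m s N x * gaussPow (m + 1 / 2) s x := by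
  have hx0 : (x : ℂ) ≠ 0 := by exact_mod_cast hx.ne'
  have hχ : ∀ y : ℝ, HasDerivAt (fun y : ℝ => (cutGauss s N y : ℂ))
      ((-cutGaussDeriv s N y : ℝ) : ℂ) y := fun y => (hasDerivAt_cutGauss s hN y).ofReal_comp
  have hη := ((hasDerivAt_cutGaussDeriv s N x).neg).ofReal_comp
  have hdd := deriv_deriv_eq_of_hasDerivAt
    (u := fun y : ℝ => (y : ℂ) ^ (m + 1 / 2) * (cutGauss s N y : ℂ))
    (fun y hy => (hasDerivAt_cpow_ofReal (m + 1 / 2) hy).mul (hχ y)) hx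
    ((((hasDerivAt_cpow_ofReal (m + 1 / 2 - 1) hx).const_mul (m + 1 / 2)).mul (hχ x)).add
      ((hasDerivAt_cpow_ofReal (m + 1 / 2) hx).mul hη))
  rw [diffExpr, hdd,
    cpow_sub_one hx, cpow_sub_one hx]
  simp only [gaussPow, cutGaussFactor, cutGaussDeriv]
  push_cast
  field_simp
  ring

theorem exists_bound_cutGaussFactor (m : ℂ) (hs : 0 < s) : ∃ K, 0 ≤ K ∧ ∀ N x, 0 < N → 0 < x →
    ‖cutGaussFactor m s N x‖ ≤ K * (1 + x ^ 2) := by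
  obtain ⟨M, hM0, hM⟩ := exists_bound_mul_halfLineCutoffDeriv
  refine ⟨s * (1 + s) + s * M + ‖2 * m + 1‖ * s, by positivity, fun N x hN hx => ?_⟩
  have hc0 := halfLineCutoff_nonneg N x
  have hc1 := halfLineCutoff_le_one N x
  have hx2 := sq_nonneg x
  have h1 : |s * (1 - s * x ^ 2) * halfLineCutoff N x| ≤ s * (1 + s) * (1 + x ^ 2) := by
    rw [abs_mul, abs_mul, abs_of_pos hs, abs_of_nonneg hc0]
    have : |1 - s * x ^ 2| ≤ (1 + s) * (1 + x ^ 2) := by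
      rw [abs_le]; constructor <;> nlinarith
    calc s * |1 - s * x ^ 2| * halfLineCutoff N x ≤ s * |1 - s * x ^ 2| :=
          mul_le_of_le_one_right (by positivity) hc1
      _ ≤ s * ((1 + s) * (1 + x ^ 2)) := by gcongr
      _ = _ := by ring
  have h2 : |s * (x * halfLineCutoffDeriv N x)| ≤ s * M * (1 + x ^ 2) := by
    rw [abs_mul, abs_of_pos hs]
    have := mul_le_mul_of_nonneg_left (hM N x hN hx) hs.le
    refine this.trans (le_mul_of_one_le_right (by positivity) (by linarith))
  have h3 : |s * halfLineCutoff N x| ≤ s * (1 + x ^ 2) := by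
    rw [abs_mul, abs_of_pos hs, abs_of_nonneg hc0]
    gcongr
    linarith
  calc ‖cutGaussFactor m s N x‖ ≤ |s * (1 - s * x ^ 2) * halfLineCutoff N x +
        s * (x * halfLineCutoffDeriv N x)| + ‖2 * m + 1‖ * |s * halfLineCutoff N x| := by
        refine (norm_add_le _ _).trans ?_
        rw [norm_mul, Complex.norm_real, Complex.norm_real, Real.norm_eq_abs, Real.norm_eq_abs]
    _ ≤ (s * (1 + s) * (1 + x ^ 2) + s * M * (1 + x ^ 2)) + ‖2 * m + 1‖ * (s * (1 + x ^ 2)) := by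
        gcongr
        exact (abs_add_le _ _).trans (add_le_add h1 h2)
    _ = _ := by ring

theorem tendsto_cutGauss_L2 (hm : -1 < m.re) (hs : 0 < s) :
    Tendsto (fun n : ℕ => toL2Half fun x => (x : ℂ) ^ (m + 1 / 2) * (cutGauss s (n + 1) x : ℂ))
      atTop (𝓝 (gaussL2 (m + 1 / 2) s)) := by
  have hp := hankel_order hm
  have hmem : ∀ n : ℕ, MemLp (fun x : ℝ => (x : ℂ) ^ (m + 1 / 2) * (cutGauss s (n + 1) x : ℂ)) 2
      halfLine := fun n => (isAdmissible_cutGauss s (by positivity)).memLp hm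
  refine tendsto_L2Half_of_dominated (memLp_gaussPow hp hs).norm ?_ ?_ ?_
  · intro n
    filter_upwards [coeFn_toL2Half (hmem n), ae_restrict_mem measurableSet_Ioi] with x h1 hx
    rw [h1, gaussPow, norm_mul, norm_mul, Complex.norm_real, Complex.norm_real, Real.norm_eq_abs,
      Real.norm_of_nonneg (Real.exp_pos _).le]
    exact mul_le_mul_of_nonneg_left (abs_cutGauss_le hs _ (le_of_lt hx)) (norm_nonneg _)
  · filter_upwards [coeFn_gaussL2 hp hs] with x hx
    rw [hx]
  · have : ∀ᵐ x ∂halfLine, ∀ n : ℕ, (toL2Half fun x : ℝ =>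
        (x : ℂ) ^ (m + 1 / 2) * (cutGauss s (n + 1) x : ℂ)) x =
          (x : ℂ) ^ (m + 1 / 2) * (cutGauss s (n + 1) x : ℂ) :=
      ae_all_iff.2 fun n => coeFn_toL2Half (hmem n)
    filter_upwards [this, coeFn_gaussL2 hp hs, ae_restrict_mem measurableSet_Ioi] with x h1 h2 hx
    simp only [h1]
    rw [h2, gaussPow]
    exact ((Complex.continuous_ofReal.tendsto _).comp
      (tendsto_cutGauss hs (le_of_lt hx))).const_mul _

theorem coeFn_diffGaussL2 (hm : -1 < m.re) (hs : 0 < s) : diffGaussL2 m s =ᵐ[halfLine]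
    fun x => (2 * (m + 1) * s - (s : ℂ) ^ 2 * (x : ℂ) ^ 2) * gaussPow (m + 1 / 2) s x := by
  filter_upwards [ae_restrict_mem measurableSet_Ioi,
    Lp.coeFn_sub ((2 * (m + 1) * s) • gaussL2 (m + 1 / 2) s)
      (((s : ℂ) ^ 2) • gaussL2 (m + 1 / 2 + 2) s),
    Lp.coeFn_smul (2 * (m + 1) * s) (gaussL2 (m + 1 / 2) s),
    Lp.coeFn_smul ((s : ℂ) ^ 2) (gaussL2 (m + 1 / 2 + 2) s),
    coeFn_gaussL2 (hankel_order hm) hs, coeFn_gaussL2 (hankel_order_add_two hm) hs]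
    with x hx h2 h3 h4 h5 h6
  rw [diffGaussL2, h2, Pi.sub_apply, h3, h4, Pi.smul_apply, Pi.smul_apply, h5, h6,
    gaussPow_add_two _ _ hx, smul_eq_mul, smul_eq_mul]
  ring

theorem tendsto_diffExpr_cutGauss_L2 (hm : -1 < m.re) (hs : 0 < s) :
    Tendsto (fun n : ℕ => toL2Half
      (diffExpr (m ^ 2) fun x => (x : ℂ) ^ (m + 1 / 2) * (cutGauss s (n + 1) x : ℂ)))
      atTop (𝓝 (diffGaussL2 m s)) := by
  have hp := hankel_order hm
  have hp2 := hankel_order_add_two hm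
  obtain ⟨K, hK0, hK⟩ := exists_bound_cutGaussFactor m hs
  have hmem : ∀ n : ℕ, MemLp (diffExpr (m ^ 2)
      fun x : ℝ => (x : ℂ) ^ (m + 1 / 2) * (cutGauss s (n + 1) x : ℂ)) 2
      halfLine := fun n => (isAdmissible_cutGauss s (by positivity)).memLp_diffExpr hm
  have hcoe : ∀ᵐ x ∂halfLine, ∀ n : ℕ, (toL2Half (diffExpr (m ^ 2) fun x : ℝ =>
      (x : ℂ) ^ (m + 1 / 2) * (cutGauss s (n + 1) x : ℂ))) x =
        cutGaussFactor m s (n + 1) x * gaussPow (m + 1 / 2) s x := by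
    rw [ae_all_iff]
    intro n
    filter_upwards [coeFn_toL2Half (hmem n), ae_restrict_mem measurableSet_Ioi] with x h1 hx
    rw [h1, diffExpr_cutGauss s (by positivity) hx]
  have hG : ∀ x : ℝ, 0 < x → ‖gaussPow (m + 1 / 2 + 2) s x‖ =
      x ^ 2 * ‖gaussPow (m + 1 / 2) s x‖ := fun x hx => by
    rw [gaussPow_add_two _ _ hx, norm_mul, norm_pow, Complex.norm_real, Real.norm_of_nonneg hx.le]
  have hlim : ∀ x : ℝ, 0 < x → Tendsto (fun n : ℕ => cutGaussFactor m s (n + 1) x *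
      gaussPow (m + 1 / 2) s x) atTop
      (𝓝 ((2 * (m + 1) * s - (s : ℂ) ^ 2 * (x : ℂ) ^ 2) * gaussPow (m + 1 / 2) s x)) := by
    intro x hx
    refine tendsto_const_nhds.congr' ?_
    filter_upwards [eventually_halfLineCutoff hx] with n hn
    rw [cutGaussFactor, halfLineCutoff_eq_one hn.1 hn.2, halfLineCutoffDeriv_eq_zero hn.1 hn.2]
    push_cast
    ring
  have hbd : ∀ x : ℝ, 0 < x → ∀ n : ℕ, ‖cutGaussFactor m s (n + 1) x * gaussPow (m + 1 / 2) s x‖ ≤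
      K * (‖gaussPow (m + 1 / 2) s x‖ + ‖gaussPow (m + 1 / 2 + 2) s x‖) := by
    intro x hx n
    rw [norm_mul, hG x hx]
    calc _ ≤ K * (1 + x ^ 2) * ‖gaussPow (m + 1 / 2) s x‖ := by
          gcongr
          exact hK _ x (by positivity) hx
      _ = _ := by ring
  refine tendsto_L2Half_of_dominated
    (((memLp_gaussPow hp hs).norm.add (memLp_gaussPow hp2 hs).norm).const_mul K) ?_ ?_ ?_
  · intro n
    filter_upwards [hcoe, ae_restrict_mem measurableSet_Ioi] with x h1 hx
    rw [h1]
    exact hbd x hx n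
  · filter_upwards [coeFn_diffGaussL2 hm hs, ae_restrict_mem measurableSet_Ioi] with x h1 hx
    rw [h1]
    exact le_of_tendsto (hlim x hx).norm (Eventually.of_forall fun n => hbd x hx n)
  · filter_upwards [hcoe, coeFn_diffGaussL2 hm hs, ae_restrict_mem measurableSet_Ioi] with x h1 h2 hx
    simp only [h1, h2]
    exact hlim x hx

end CutGauss

/-! ### The graph of `H_m` is the graph of `F k² F` -/

section Graph

variable {m : ℂ}

theorem IsAdmissible.sub_const_mul {u w : ℝ → ℂ} (hu : IsAdmissible m u) (hw : IsAdmissible m w)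
    (c : ℂ) : IsAdmissible m (fun x => u x - c * w x) := by
  refine ⟨hu.smooth.sub (contDiffOn_const.mul hw.smooth), ?_, ?_⟩
  · obtain ⟨a, ε, hε, ha⟩ := hu.near_zero
    obtain ⟨b, δ, hδ, hb⟩ := hw.near_zero
    refine ⟨a - c * b, min ε δ, lt_min hε hδ, fun x hx => ?_⟩
    rw [ha x ⟨hx.1, hx.2.trans_le (min_le_left _ _)⟩, hb x ⟨hx.1, hx.2.trans_le (min_le_right _ _)⟩]
    ring
  · obtain ⟨R, hR⟩ := hu.far
    obtain ⟨T, hT⟩ := hw.far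
    refine ⟨max R T, fun x hx => ?_⟩
    rw [hR x ((le_max_left _ _).trans_lt hx), hT x ((le_max_right _ _).trans_lt hx)]
    ring

theorem IsAdmissible.diffExpr_sub_const_mul {u w : ℝ → ℂ} (hu : IsAdmissible m u)
    (hw : IsAdmissible m w) (α c : ℂ) {x : ℝ} (hx : 0 < x) :
    diffExpr α (fun x => u x - c * w x) x = diffExpr α u x - c * diffExpr α w x := by
  have h := deriv_deriv_eq_of_hasDerivAt (u := fun x => u x - c * w x)
    (v := fun x => deriv u x - c * deriv w x)
    (fun y hy => (hu.hasDerivAt hy).sub ((hw.hasDerivAt hy).const_mul c)) hx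
    ((hu.hasDerivAt_deriv hx).sub ((hw.hasDerivAt_deriv hx).const_mul c))
  simp only [diffExpr]
  rw [h]
  ring

/-- Admissibility says nothing about u on (-∞, 0], hence the truncation to the half-line. -/
theorem IsAdmissible.isHalfLineTest_indicator {u : ℝ → ℂ} (hu : IsAdmissible m u) {ε : ℝ}
    (hε : 0 < ε) (h0 : ∀ x ∈ Ioo 0 ε, u x = 0) : IsHalfLineTest ((Ioi 0).indicator u) := by
  obtain ⟨R, hR⟩ := hu.far
  have hz : ∀ x, x ∉ Icc ε R → (Ioi 0).indicator u x = 0 := by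
    intro x hx
    by_cases hx0 : x ∈ Ioi (0 : ℝ)
    · rw [indicator_of_mem hx0]
      rcases not_and_or.1 hx with h | h
      · exact h0 x ⟨hx0, not_le.1 h⟩
      · exact hR x (not_le.1 h)
    · exact indicator_of_notMem hx0 _
  have hsub : tsupport ((Ioi 0).indicator u) ⊆ Icc ε R :=
    closure_minimal (fun x hx => by_contra fun h => hx (hz x h)) isClosed_Icc
  refine ⟨contDiff_iff_contDiffAt.2 fun x => ?_, HasCompactSupport.intro isCompact_Icc hz,
    hsub.trans fun x hx => hε.trans_le hx.1⟩
  rcases lt_or_ge x ε with hx | hx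
  · have : (Ioi 0).indicator u =ᶠ[𝓝 x] fun _ => 0 := by
      filter_upwards [Iio_mem_nhds hx] with y hy using hz y fun h => absurd h.1 (not_le.2 hy)
    exact contDiffAt_const.congr_of_eventuallyEq this
  · have hx0 := hε.trans_le hx
    refine (hu.smooth.contDiffAt (Ioi_mem_nhds hx0)).congr_of_eventuallyEq ?_
    filter_upwards [Ioi_mem_nhds hx0] with y hy using indicator_of_mem hy _

/-- Functions in the core, together with the span of one admissible function. -/
def coreSupGraph (m : ℂ) (w : ℝ → ℂ) : Submodule ℂ (L2Half × L2Half) :=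
  minGraph (m ^ 2) ⊔ Submodule.span ℂ {(toL2Half w, toL2Half (diffExpr (m ^ 2) w))}

/-- A closed subspace plus a line is closed. Hence limits of admissible functions do not leave Dom
L^min + ℂ w. -/
theorem isClosed_coreSupGraph (m : ℂ) (w : ℝ → ℂ) :
    IsClosed (coreSupGraph m w : Set (L2Half × L2Half)) :=
  Submodule.isClosed_sup_finiteDimensional _ _ (Submodule.isClosed_topologicalClosure _)

/-- Subtract c w, with c the coefficient of u at 0: the difference vanishes near 0 and near
infinity, so on the half-line it is a test function. -/
theorem IsAdmissible.mem_coreSupGraph (hm : -1 < m.re) {u w : ℝ → ℂ} (hu : IsAdmissible m u)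
    (hw : IsAdmissible m w) {ε : ℝ} (hε : 0 < ε)
    (hw0 : ∀ x ∈ Ioo 0 ε, w x = (x : ℂ) ^ (m + 1 / 2)) :
    (toL2Half u, toL2Half (diffExpr (m ^ 2) u)) ∈ coreSupGraph m w := by
  obtain ⟨c, δ, hδ, hc⟩ := hu.near_zero
  have hv := hu.sub_const_mul hw c
  set v : ℝ → ℂ := fun x => u x - c * w x with hvdef
  have hφ := hv.isHalfLineTest_indicator (lt_min hε hδ) fun x hx => by
    rw [hvdef]
    simp only
    rw [hc x ⟨hx.1, hx.2.trans_le (min_le_right _ _)⟩,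
      hw0 x ⟨hx.1, hx.2.trans_le (min_le_left _ _)⟩, sub_self]
  have hcore : (toL2Half v, toL2Half (diffExpr (m ^ 2) v)) ∈ minGraph (m ^ 2) := by
    refine Submodule.le_topologicalClosure _ ⟨_, hφ, ?_, ?_⟩
    · filter_upwards [coeFn_toL2Half (hv.memLp hm), ae_restrict_mem measurableSet_Ioi] with x h hx
      rw [indicator_of_mem hx]; exact h
    · filter_upwards [coeFn_toL2Half (hv.memLp_diffExpr hm), ae_restrict_mem measurableSet_Ioi]
        with x h hx
      refine h.trans (diffExpr_congr_of_eventuallyEq ?_)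
      filter_upwards [Ioi_mem_nhds hx] with y hy using (indicator_of_mem hy _).symm
  have e1 : toL2Half v = toL2Half u - c • toL2Half w := by
    rw [← toL2Half_smul c (hw.memLp hm), ← toL2Half_sub (hu.memLp hm) ((hw.memLp hm).const_mul c)]
  have e2 : toL2Half (diffExpr (m ^ 2) v) =
      toL2Half (diffExpr (m ^ 2) u) - c • toL2Half (diffExpr (m ^ 2) w) := by
    rw [← toL2Half_smul c (hw.memLp_diffExpr hm),
      ← toL2Half_sub (hu.memLp_diffExpr hm) ((hw.memLp_diffExpr hm).const_mul c)]
    exact toL2Half_congr (ae_halfLine_of_forall fun x hx => hu.diffExpr_sub_const_mul hw _ c hx)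
  refine Submodule.mem_sup.2 ⟨_, hcore, c • (toL2Half w, toL2Half (diffExpr (m ^ 2) w)),
    Submodule.smul_mem _ _ (Submodule.mem_span_singleton_self _), ?_⟩
  rw [e1, e2]
  ext1 <;> simp

theorem gaussL2_mem_coreSupGraph (hm : -1 < m.re) {w : ℝ → ℂ}
    (hw : IsAdmissible m w) {ε : ℝ} (hε : 0 < ε)
    (hw0 : ∀ x ∈ Ioo 0 ε, w x = (x : ℂ) ^ (m + 1 / 2)) {s : ℝ} (hs : 0 < s) :
    (gaussL2 (m + 1 / 2) s, diffGaussL2 m s) ∈ coreSupGraph m w :=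
  (isClosed_coreSupGraph m w).mem_of_tendsto
    ((tendsto_cutGauss_L2 hm hs).prodMk_nhds (tendsto_diffExpr_cutGauss_L2 hm hs))
    (Eventually.of_forall fun _ =>
      (isAdmissible_cutGauss s (by positivity)).mem_coreSupGraph hm hw hε hw0)

/-- The vectors are (1 + x²) g, so density says that the Gaussians span a core for x². If f
annihilates them, f(1 + x²) has vanishing Gaussian integrals; it need not be in L², but the
uniqueness result covers it. -/
theorem dense_span_gaussL2_add {p : ℂ} (hp : -1 / 2 < p.re) :
    Dense (Submodule.span ℂ ((fun s => gaussL2 p s + gaussL2 (p + 2) s) '' Ioi 0) : Set L2Half) := by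
  refine dense_span_of_pairing fun f hf => ?_
  have hp2 : -1 / 2 < (p + 2).re := by simp; linarith
  have e : ∀ s x : ℝ, 0 < x → f x * gaussPow p s x + f x * gaussPow (p + 2) s x =
      f x * (1 + (x : ℂ) ^ 2) * gaussPow p s x := fun s x hx => by
    rw [gaussPow_add_two _ _ hx]; ring
  have i1 : ∀ s, 0 < s → Integrable (fun x => f x * gaussPow p s x) halfLine := fun s hs =>
    (Lp.memLp f).integrable_mul (memLp_gaussPow hp hs)
  have i2 : ∀ s, 0 < s → Integrable (fun x => f x * gaussPow (p + 2) s x) halfLine := fun s hs =>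
    (Lp.memLp f).integrable_mul (memLp_gaussPow hp2 hs)
  have h := ae_eq_zero_of_integral_mul_gaussPow_eq_zero (s₀ := 1) (p := p)
    (h := fun x => f x * (1 + (x : ℂ) ^ 2))
    (((i1 1 one_pos).add (i2 1 one_pos)).congr (ae_halfLine_of_forall fun x hx => e 1 x hx))
    (fun s hs => by
      have hs0 : 0 < s := one_pos.trans_le hs
      rw [← integral_congr_ae (ae_halfLine_of_forall fun x hx => e s x hx),
        integral_add (i1 s hs0) (i2 s hs0), ← pairing_toL2Half_right (memLp_gaussPow hp hs0),
        ← pairing_toL2Half_right (memLp_gaussPow hp2 hs0), ← gaussL2, ← gaussL2,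
        pairing_comm, pairing_comm _ (gaussL2 (p + 2) s), ← map_add, pairing_comm]
      exact hf _ ⟨s, hs0, rfl⟩)
  refine Lp.ext ?_
  filter_upwards [h, Lp.coeFn_zero ℂ 2 halfLine] with x hx h0
  rw [h0]
  exact (mul_eq_zero.1 hx).resolve_right (one_add_sq_ne_zero x)

/-- The graph of F k² F is the range of the bounded map B v = (F R v, F(v - R v)), with R = (1 +
k²)⁻¹. The preimage of the closed target under B contains every (1 + k²) g_s, which B sends to
s^(-m-1)(g_(1/s), L g_(1/s)), and such vectors span a dense subspace. -/
theorem hankelGraph_le_coreSupGraph (hm : -1 < m.re) {w : ℝ → ℂ}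
    (hw : IsAdmissible m w) {ε : ℝ} (hε : 0 < ε)
    (hw0 : ∀ x ∈ Ioo 0 ε, w x = (x : ℂ) ^ (m + 1 / 2)) :
    hankelGraph hm ≤ coreSupGraph m w := by
  have hp := hankel_order hm
  let B : L2Half →L[ℂ] L2Half × L2Half := ((hankel hm).comp mulResolvent).prod
    ((hankel hm).comp (ContinuousLinearMap.id ℂ L2Half - mulResolvent))
  have hB : ∀ f g, (f, g) ∈ mulSqGraph → B (f + g) = (hankel hm f, hankel hm g) := by
    intro f g hfg
    have h : mulResolvent (f + g) = f := by
      rw [map_add, mem_mulSqGraph_iff.1 hfg]; abel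
    simp [B, h]
  have hclosed : IsClosed (((coreSupGraph m w).comap (B : L2Half →ₗ[ℂ] L2Half × L2Half) :
      Submodule ℂ L2Half) : Set L2Half) := (isClosed_coreSupGraph m w).preimage B.continuous
  have hall : ∀ v, B v ∈ coreSupGraph m w := by
    intro v
    refine closure_minimal ?_ hclosed (dense_span_gaussL2_add hp v)
    refine Submodule.span_le.2 ?_
    rintro _ ⟨s, hs, rfl⟩
    have hs0 : 0 < s := hs
    change B _ ∈ coreSupGraph m w
    rw [hB _ _ (gaussL2_mem_mulSqGraph hp hs0), hankel_gaussL2 hm hs0, hankel_gaussL2_add_two hm hs0]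
    exact Submodule.smul_mem _ ((s : ℂ) ^ (-m - 1))
      (gaussL2_mem_coreSupGraph hm hw hε hw0 (inv_pos.2 hs0))
  rintro ⟨f, g⟩ hfg
  have := hall (hankel hm f + hankel hm g)
  rwa [hB _ _ ((mem_hankelGraph hm).1 hfg), hankel_hankel, hankel_hankel] at this

theorem powerLine_eq (hm : -1 < m.re) {ξ : ℝ → ℝ} (hξ : IsCutoffAtZero ξ) :
    powerLine m ξ = Submodule.span ℂ {toL2Half fun x => (x : ℂ) ^ (1 / 2 + m) * (ξ x : ℂ)} := by
  rw [powerLine]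
  congr 1
  ext f
  refine ⟨fun h => (toL2Half_eq_of_ae h).symm, fun h => ?_⟩
  rw [mem_singleton_iff.1 h]
  exact coeFn_toL2Half (hξ.isAdmissible.memLp hm)

/-- One inclusion holds because L^min and the cutoff power lie in F k² F, the other because F k² F
lies in their sum. Only domains need comparing: both operators are restrictions of the single-valued
L^max. -/
theorem homSchrodinger_graph (hm : -1 < m.re) {ξ : ℝ → ℝ} (hξ : IsCutoffAtZero ξ) :
    (homSchrodinger m ξ).graph = hankelGraph hm := by
  have hw := hξ.isAdmissible (m := m)
  obtain ⟨ε, hε, hz⟩ := Metric.eventually_nhds_iff.1 hξ.eq_one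
  have hw0 : ∀ x ∈ Ioo 0 ε, (x : ℂ) ^ (1 / 2 + m) * (ξ x : ℂ) = (x : ℂ) ^ (m + 1 / 2) := by
    intro x hx
    rw [hz (by rw [Real.dist_0_eq_abs, abs_of_pos hx.1]; exact hx.2), add_comm m]
    simp
  have hmax : ∀ f g, (f, g) ∈ maxGraph (m ^ 2) → ∃ hf : f ∈ (maxOp (m ^ 2)).domain,
      maxOp (m ^ 2) ⟨f, hf⟩ = g := by
    intro f g h
    rw [← maxOp_graph, LinearPMap.mem_graph_iff] at h
    obtain ⟨y, rfl, h2⟩ := h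
    exact ⟨y.2, h2⟩
  have hgraph : ∀ f g, (f, g) ∈ (homSchrodinger m ξ).graph ↔
      f ∈ (minOp (m ^ 2)).domain ⊔ powerLine m ξ ∧ (f, g) ∈ maxGraph (m ^ 2) := by
    intro f g
    constructor
    · intro h
      rw [LinearPMap.mem_graph_iff] at h
      obtain ⟨y, rfl, rfl⟩ := h
      refine ⟨y.2.1, ?_⟩
      rw [← maxOp_graph, LinearPMap.mem_graph_iff]
      exact ⟨⟨y, y.2.2⟩, rfl, rfl⟩
    · rintro ⟨h1, h2⟩
      obtain ⟨hf, rfl⟩ := hmax f g h2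
      rw [LinearPMap.mem_graph_iff]
      exact ⟨⟨f, h1, hf⟩, rfl, rfl⟩
  have huniq : ∀ f g g', (f, g) ∈ maxGraph (m ^ 2) → (f, g') ∈ maxGraph (m ^ 2) → g = g' := by
    intro f g g' h1 h2
    obtain ⟨hf, rfl⟩ := hmax f g h1
    obtain ⟨hf', rfl⟩ := hmax f g' h2
    rfl
  have hdom : ∀ f, f ∈ (minOp (m ^ 2)).domain ↔ ∃ g, (f, g) ∈ minGraph (m ^ 2) := by
    intro f
    rw [← minOp_graph]
    exact LinearPMap.mem_domain_iff
  ext ⟨f, g⟩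
  rw [hgraph, powerLine_eq hm hξ]
  constructor
  · rintro ⟨h1, h2⟩
    obtain ⟨f₁, h3, f₂, h4, rfl⟩ := Submodule.mem_sup.1 h1
    obtain ⟨g₁, hg₁⟩ := (hdom f₁).1 h3
    obtain ⟨c, rfl⟩ := Submodule.mem_span_singleton.1 h4
    have h5 := (hankelGraph hm).add_mem (minGraph_le_hankelGraph hm hg₁)
      ((hankelGraph hm).smul_mem c (hw.mem_hankelGraph hm))
    rw [huniq _ _ _ h2 (hankelGraph_le_maxGraph hm h5)]
    exact h5
  · intro h
    refine ⟨?_, hankelGraph_le_maxGraph hm h⟩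
    obtain ⟨⟨f₁, g₁⟩, h3, q, h4, h5⟩ :=
      Submodule.mem_sup.1 (hankelGraph_le_coreSupGraph hm hw hε hw0 h)
    obtain ⟨c, rfl⟩ := Submodule.mem_span_singleton.1 h4
    obtain rfl : f₁ + c • toL2Half (fun x => (x : ℂ) ^ (1 / 2 + m) * (ξ x : ℂ)) = f :=
      congrArg Prod.fst h5
    exact Submodule.add_mem_sup ((hdom _).2 ⟨_, h3⟩)
      (Submodule.smul_mem _ c (Submodule.mem_span_singleton_self _))

end Graph

/-! ### Bessel functions on the half-line -/

/-- The coefficients of the power series of `z ↦ (z/2)^(-m) J_m(z)` in `z²/4`. -/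
def besselCoeff (m : ℂ) (n : ℕ) : ℂ :=
  (-1 : ℂ) ^ n / ((n.factorial : ℂ) * Complex.Gamma ((n : ℂ) + m + 1))

/-- The power series `∑ₙ (-t)ⁿ / (n! Γ(n + m + 1))`. -/
def besselSeries (m : ℂ) (t : ℝ) : ℂ := ∑' n : ℕ, besselCoeff m n * (t : ℂ) ^ n

/-- The function `√z J_m(z)`, `z > 0`. -/
def sqrtBessel (m : ℂ) (z : ℝ) : ℂ :=
  (2 : ℂ) ^ (-m) * ((z : ℂ) ^ (m + 1 / 2) * besselSeries m (z ^ 2 / 4))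

section Bessel

variable {m : ℂ}

theorem exists_le_norm_Gamma_natCast_add (hm : -1 < m.re) :
    ∃ c, 0 < c ∧ ∀ n : ℕ, c ≤ ‖Complex.Gamma ((n : ℂ) + m + 1)‖ := by
  have hre : ∀ n : ℕ, 0 < ((n : ℂ) + m + 1).re := fun n => by
    have : (0 : ℝ) ≤ n := n.cast_nonneg
    simp; linarith
  have hpos : ∀ n : ℕ, 0 < ‖Complex.Gamma ((n : ℂ) + m + 1)‖ := fun n =>
    norm_pos_iff.2 (Complex.Gamma_ne_zero_of_re_pos (hre n))
  have hstep : ∀ n : ℕ, ‖Complex.Gamma (((1 : ℕ) : ℂ) + m + 1)‖ ≤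
      ‖Complex.Gamma (((n + 1 : ℕ) : ℂ) + m + 1)‖ := by
    intro n
    induction n with
    | zero => simp
    | succ k ih =>
      refine ih.trans ?_
      have h0 : ((k + 1 : ℕ) : ℂ) + m + 1 ≠ 0 := fun h => by
        have := hre (k + 1)
        rw [h] at this
        simp at this
      have e : ((k + 1 + 1 : ℕ) : ℂ) + m + 1 = (((k + 1 : ℕ) : ℂ) + m + 1) + 1 := by
        push_cast; ring
      rw [e, Complex.Gamma_add_one _ h0, norm_mul]
      refine le_mul_of_one_le_left (norm_nonneg _) ?_
      refine le_trans ?_ (Complex.re_le_norm _)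
      have : (0 : ℝ) ≤ k := k.cast_nonneg
      simp; linarith
  -- The moduli increase only from n = 1 on, since |m + 1| may be less than 1; hence the minimum
  -- over the first two.
  refine ⟨min ‖Complex.Gamma (((0 : ℕ) : ℂ) + m + 1)‖ ‖Complex.Gamma (((1 : ℕ) : ℂ) + m + 1)‖,
    lt_min (hpos 0) (hpos 1), fun n => ?_⟩
  rcases n with _ | n
  · exact min_le_left _ _
  · exact (min_le_right _ _).trans (hstep n)

theorem exists_norm_besselCoeff_le (hm : -1 < m.re) :
    ∃ C, 0 ≤ C ∧ ∀ n, ‖besselCoeff m n‖ ≤ C * (1 / n.factorial) := by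
  obtain ⟨c, hc, h⟩ := exists_le_norm_Gamma_natCast_add hm
  refine ⟨1 / c, by positivity, fun n => ?_⟩
  have hn : (0 : ℝ) < n.factorial := by exact_mod_cast n.factorial_pos
  rw [besselCoeff, norm_div, norm_mul, norm_pow, norm_neg, norm_one, one_pow, Complex.norm_natCast,
    div_mul_div_comm, one_mul, mul_comm]
  exact one_div_le_one_div_of_le (by positivity) (mul_le_mul_of_nonneg_right (h n) hn.le)

theorem hasSum_pow_div_factorial (C t : ℝ) :
    HasSum (fun n : ℕ => C * (1 / n.factorial) * t ^ n) (C * Real.exp t) := by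
  have h := (NormedSpace.expSeries_div_hasSum_exp t).mul_left C
  rw [← Real.exp_eq_exp_ℝ] at h
  have e : (fun n : ℕ => C * (1 / n.factorial) * t ^ n) = fun n : ℕ => C * (t ^ n / n.factorial) := by
    funext n; ring
  rwa [e]

theorem norm_besselTerm_le {C : ℝ} (hC : ∀ n, ‖besselCoeff m n‖ ≤ C * (1 / n.factorial))
    {t R : ℝ} (ht : |t| ≤ R) (n : ℕ) :
    ‖besselCoeff m n * (t : ℂ) ^ n‖ ≤ C * (1 / n.factorial) * R ^ n := by
  rw [norm_mul, norm_pow, Complex.norm_real, Real.norm_eq_abs]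
  exact mul_le_mul (hC n) (pow_le_pow_left₀ (abs_nonneg _) ht n) (by positivity)
    ((norm_nonneg _).trans (hC n))

theorem hasSum_besselSeries (hm : -1 < m.re) (t : ℝ) :
    HasSum (fun n : ℕ => besselCoeff m n * (t : ℂ) ^ n) (besselSeries m t) := by
  obtain ⟨C, -, hC⟩ := exists_norm_besselCoeff_le hm
  exact (Summable.of_norm_bounded (hasSum_pow_div_factorial C |t|).summable
    (norm_besselTerm_le hC le_rfl)).hasSum

theorem exists_norm_besselSeries_le (hm : -1 < m.re) :
    ∃ C, 0 ≤ C ∧ ∀ t, 0 ≤ t → ‖besselSeries m t‖ ≤ C * Real.exp t := by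
  obtain ⟨C, hC0, hC⟩ := exists_norm_besselCoeff_le hm
  refine ⟨C, hC0, fun t ht => ?_⟩
  exact tsum_of_norm_bounded (hasSum_pow_div_factorial C t)
    (norm_besselTerm_le hC (abs_of_nonneg ht).le)

theorem continuous_besselSeries (hm : -1 < m.re) : Continuous (besselSeries m) := by
  obtain ⟨C, -, hC⟩ := exists_norm_besselCoeff_le hm
  rw [continuous_iff_continuousAt]
  intro t
  have h : ContinuousOn (besselSeries m) (Icc (-(|t| + 1)) (|t| + 1)) :=
    continuousOn_tsum (fun n => by fun_prop) (hasSum_pow_div_factorial C (|t| + 1)).summable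
      fun n x hx => norm_besselTerm_le hC (abs_le.2 hx) n
  refine h.continuousAt (Icc_mem_nhds ?_ ?_)
  · have := neg_abs_le t; linarith
  · have := le_abs_self t; linarith

theorem measurable_sqrtBessel (hm : -1 < m.re) : Measurable (sqrtBessel m) := by
  have h1 : Measurable fun z : ℝ => (z : ℂ) ^ (m + 1 / 2) :=
    Complex.measurable_ofReal.pow_const _
  have h2 : Measurable fun z : ℝ => besselSeries m (z ^ 2 / 4) :=
    ((continuous_besselSeries hm).comp (by fun_prop)).measurable
  exact measurable_const.mul (h1.mul h2)

theorem sqrtBessel_eq (m : ℂ) {z : ℝ} (hz : 0 < z) :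
    sqrtBessel m z = (√z : ℂ) * besselJ m z := by
  have hz0 : (z : ℂ) ≠ 0 := by exact_mod_cast hz.ne'
  have hz2 : (z : ℂ) / 2 ≠ 0 := by simp [hz0]
  have hJ : besselJ m z = ((z : ℂ) / 2) ^ m * besselSeries m (z ^ 2 / 4) := by
    rw [besselJ, besselSeries, ← tsum_mul_left]
    refine tsum_congr fun n => ?_
    rw [Complex.cpow_add _ _ hz2, besselCoeff,
      show 2 * (n : ℂ) = ((2 * n : ℕ) : ℂ) by push_cast; ring, Complex.cpow_natCast, pow_mul]
    push_cast
    ring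
  have h2 : ((z : ℂ) / 2) ^ m = (2 : ℂ) ^ (-m) * (z : ℂ) ^ m := by
    have h20 : (2 : ℂ) ^ m ≠ 0 := by simp [Complex.cpow_eq_zero_iff]
    have h := Complex.mul_cpow_ofReal_nonneg (a := 2) (b := z / 2) (by norm_num) (by positivity) m
    push_cast at h
    rw [mul_div_cancel₀ _ two_ne_zero] at h
    rw [h, Complex.cpow_neg, inv_mul_cancel_left₀ h20]
  have h3 : (√z : ℂ) = (z : ℂ) ^ (1 / 2 : ℂ) := by
    rw [Real.sqrt_eq_rpow, Complex.ofReal_cpow hz.le]; norm_num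
  rw [hJ, sqrtBessel, h2, h3, Complex.cpow_add _ _ hz0]
  ring

theorem exists_norm_sqrtBessel_le (hm : -1 < m.re) :
    ∃ C, 0 ≤ C ∧ ∀ z, 0 < z →
      ‖sqrtBessel m z‖ ≤ C * (z ^ (m.re + 1 / 2) * Real.exp (z ^ 2 / 4)) := by
  obtain ⟨C, hC0, hC⟩ := exists_norm_besselSeries_le hm
  refine ⟨‖(2 : ℂ) ^ (-m)‖ * C, by positivity, fun z hz => ?_⟩
  rw [sqrtBessel, norm_mul, norm_mul, Complex.norm_cpow_eq_rpow_re_of_pos hz]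
  have := hC (z ^ 2 / 4) (by positivity)
  have e : (m + 1 / 2).re = m.re + 1 / 2 := by simp
  rw [e]
  calc _ ≤ ‖(2 : ℂ) ^ (-m)‖ * (z ^ (m.re + 1 / 2) * (C * Real.exp (z ^ 2 / 4))) := by gcongr
    _ = _ := by ring

end Bessel

/-! ### The Hankel transform of compactly supported functions -/

section HankelKernel

variable {m : ℂ}

theorem gaussPow_add_two_mul_natCast (p : ℂ) (s : ℝ) (n : ℕ) {x : ℝ} (hx : 0 < x) :
    gaussPow (p + 2 * n) s x = ((x : ℂ) ^ 2) ^ n * gaussPow p s x := by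
  induction n with
  | zero => simp
  | succ n ih =>
    rw [show p + 2 * ((n + 1 : ℕ) : ℂ) = p + 2 * n + 2 by push_cast; ring, gaussPow_add_two _ _ hx,
      ih, pow_succ]
    ring

/-- The series is dominated by a multiple of exp(k²x²/4), which the Gaussian exp(-s x²/2) absorbs
precisely when k²/2 < s. -/
theorem hasSum_integral_besselTerm (hm : -1 < m.re) {k s : ℝ} (hks : k ^ 2 / 2 < s) :
    HasSum (fun n : ℕ => ∫ x, besselCoeff m n * ((((k * x) ^ 2 / 4 : ℝ) : ℂ)) ^ n *
        gaussPow (2 * m + 1) s x ∂halfLine)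
      (∫ x, besselSeries m ((k * x) ^ 2 / 4) * gaussPow (2 * m + 1) s x ∂halfLine) := by
  obtain ⟨C, hC0, hC⟩ := exists_norm_besselCoeff_le hm
  have hre : (2 * m + 1).re = 2 * m.re + 1 := by simp
  have hsum : ∀ x : ℝ, HasSum (fun n : ℕ => C * (1 / n.factorial) * ((k * x) ^ 2 / 4) ^ n *
      ‖gaussPow (2 * m + 1) s x‖)
      (C * Real.exp ((k * x) ^ 2 / 4) * ‖gaussPow (2 * m + 1) s x‖) := fun x =>
    (hasSum_pow_div_factorial C _).mul_right _
  refine hasSum_integral_of_dominated_convergence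
    (fun n x => C * (1 / n.factorial) * ((k * x) ^ 2 / 4) ^ n * ‖gaussPow (2 * m + 1) s x‖)
    ?_ ?_ ?_ ?_ ?_
  · intro n
    refine AEStronglyMeasurable.mul (Continuous.aestronglyMeasurable ?_)
      (aestronglyMeasurable_gaussPow _ _)
    fun_prop
  · refine fun n => Eventually.of_forall fun x => ?_
    rw [norm_mul]
    exact mul_le_mul_of_nonneg_right (norm_besselTerm_le hC (abs_of_nonneg (by positivity)).le n)
      (norm_nonneg _)
  · exact Eventually.of_forall fun x => (hsum x).summable
  · have hi := (integrable_gaussPow (p := 2 * m + 1) (s := s - k ^ 2 / 2)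
      (by rw [hre]; linarith) (by linarith)).norm.const_mul C
    refine hi.congr (ae_halfLine_of_forall fun x hx => ?_)
    simp only
    rw [(hsum x).tsum_eq, norm_gaussPow _ _ hx, norm_gaussPow _ _ hx,
      show -((s - k ^ 2 / 2) / 2) * x ^ 2 = (k * x) ^ 2 / 4 + -(s / 2) * x ^ 2 by ring, Real.exp_add]
    ring
  · exact Eventually.of_forall fun x => (hasSum_besselSeries hm _).mul_right _

/-- The Gaussian moment produces Γ(n + m + 1), which cancels the Gamma factor of the coefficient and
leaves a term of an exponential series. -/
theorem integral_besselTerm (hm : -1 < m.re) (k : ℝ) {s : ℝ} (hs : 0 < s) (n : ℕ) :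
    ∫ x, besselCoeff m n * ((((k * x) ^ 2 / 4 : ℝ) : ℂ)) ^ n * gaussPow (2 * m + 1) s x ∂halfLine =
      1 / 2 * (2 / s : ℝ) ^ (m + 1) * (((-(k ^ 2 / (2 * s)) : ℝ) : ℂ) ^ n / n.factorial) := by
  have hw : 0 < ((n : ℂ) + m + 1).re := by
    have : (0 : ℝ) ≤ n := n.cast_nonneg
    simp; linarith
  have hG := Complex.Gamma_ne_zero_of_re_pos hw
  have h2s : ((2 / s : ℝ) : ℂ) ≠ 0 := by exact_mod_cast (by positivity : (2 / s : ℝ) ≠ 0)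
  have hs0 : (s : ℂ) ≠ 0 := by exact_mod_cast hs.ne'
  have hn : (n.factorial : ℂ) ≠ 0 := by exact_mod_cast n.factorial_ne_zero
  have h := integral_gaussPow hw hs
  have e : ∀ x : ℝ, 0 < x → besselCoeff m n * ((((k * x) ^ 2 / 4 : ℝ) : ℂ)) ^ n *
      gaussPow (2 * m + 1) s x = besselCoeff m n * ((k : ℂ) ^ 2 / 4) ^ n *
      gaussPow (2 * ((n : ℂ) + m + 1) - 1) s x := by
    intro x hx
    rw [show 2 * ((n : ℂ) + m + 1) - 1 = 2 * m + 1 + 2 * n by ring,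
      gaussPow_add_two_mul_natCast _ _ _ hx]
    push_cast
    rw [show ((k : ℂ) * x) ^ 2 / 4 = (k : ℂ) ^ 2 / 4 * (x : ℂ) ^ 2 by ring, mul_pow]
    ring
  rw [integral_congr_ae (ae_halfLine_of_forall e), integral_const_mul, h, besselCoeff,
    show (n : ℂ) + m + 1 = m + 1 + n by ring] at *
  rw [Complex.cpow_add _ _ h2s, Complex.cpow_natCast,
    show ((-(k ^ 2 / (2 * s)) : ℝ) : ℂ) = (-1) * ((k : ℂ) ^ 2 / 4) * ((2 / s : ℝ) : ℂ) by
      push_cast; field_simp; ring, mul_pow, mul_pow]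
  field_simp

/-- Weber's integral, obtained by summing the exponential series. Its value is that of F g_s at k,
so the Bessel integral and F agree on Gaussians. The restriction on s is harmless when k² ≤ b. -/
theorem integral_sqrtBessel_mul_gaussPow (hm : -1 < m.re) {k s : ℝ} (hk : 0 < k)
    (hks : k ^ 2 / 2 < s) :
    ∫ x, sqrtBessel m (k * x) * gaussPow (m + 1 / 2) s x ∂halfLine =
      (s : ℂ) ^ (-m - 1) * gaussPow (m + 1 / 2) s⁻¹ k := by
  have hs : 0 < s := (by positivity : 0 ≤ k ^ 2 / 2).trans_lt hks
  have h1 := hasSum_integral_besselTerm hm hks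
  simp only [integral_besselTerm hm k hs] at h1
  have h2 := (NormedSpace.expSeries_div_hasSum_exp (((-(k ^ 2 / (2 * s)) : ℝ) : ℂ))).mul_left
    (1 / 2 * ((2 / s : ℝ) : ℂ) ^ (m + 1))
  rw [← Complex.exp_eq_exp_ℂ, ← Complex.ofReal_exp] at h2
  have e : ∀ x : ℝ, 0 < x → sqrtBessel m (k * x) * gaussPow (m + 1 / 2) s x =
      (2 : ℂ) ^ (-m) * (k : ℂ) ^ (m + 1 / 2) *
        (besselSeries m ((k * x) ^ 2 / 4) * gaussPow (2 * m + 1) s x) := by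
    intro x hx
    have hx0 : (x : ℂ) ≠ 0 := by exact_mod_cast hx.ne'
    rw [sqrtBessel, Complex.ofReal_mul k x, Complex.mul_cpow_ofReal_nonneg hk.le hx.le, gaussPow,
      gaussPow, show 2 * m + 1 = (m + 1 / 2) + (m + 1 / 2) by ring,
      Complex.cpow_add (m + 1 / 2) (m + 1 / 2) hx0]
    ring
  rw [integral_congr_ae (ae_halfLine_of_forall e), integral_const_mul, h1.unique h2, gaussPow]
  have h2s : ((2 / s : ℝ) : ℂ) ^ (m + 1) = 2 * (2 : ℂ) ^ m * (s : ℂ) ^ (-m - 1) := by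
    have h3 := Complex.mul_cpow_ofReal_nonneg (a := 2 / s) (b := s) (by positivity) hs.le (m + 1)
    have hs0 : (s : ℂ) ≠ 0 := by exact_mod_cast hs.ne'
    have hs1 : (s : ℂ) ^ (m + 1) ≠ 0 := by simp [Complex.cpow_eq_zero_iff, hs0]
    rw [← Complex.ofReal_mul, div_mul_cancel₀ _ hs.ne', Complex.ofReal_ofNat,
      Complex.cpow_add _ _ two_ne_zero, Complex.cpow_one] at h3
    rw [show -m - 1 = -(m + 1) by ring, Complex.cpow_neg, eq_mul_inv_iff_mul_eq₀ hs1, ← h3]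
    ring
  have h20 : (2 : ℂ) ^ m ≠ 0 := by simp [Complex.cpow_eq_zero_iff]
  rw [h2s, Complex.cpow_neg, show -(s⁻¹ / 2) * k ^ 2 = -(k ^ 2 / (2 * s)) by field_simp]
  field_simp

/-- The Hankel kernel at `x`, restricted to `a ≤ k² ≤ b`. -/
def hankelKernel (m : ℂ) (a b x k : ℝ) : ℂ := sqIndicator (Icc a b) k * sqrtBessel m (k * x)

theorem measurable_hankelKernel (hm : -1 < m.re) (a b : ℝ) :
    Measurable (fun q : ℝ × ℝ => hankelKernel m a b q.1 q.2) :=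
  ((measurable_sqIndicator measurableSet_Icc).comp measurable_snd).mul
    ((measurable_sqrtBessel hm).comp (measurable_snd.mul measurable_fst))

theorem exists_norm_hankelKernel_le (hm : -1 < m.re) (a b : ℝ) :
    ∃ C, 0 ≤ C ∧ ∀ x k, 0 < x → 0 < k → ‖hankelKernel m a b x k‖ ≤
      C * (x ^ (m.re + 1 / 2) * Real.exp (b / 4 * x ^ 2)) * ‖gaussPow (m + 1 / 2) 1 k‖ := by
  obtain ⟨C, hC0, hC⟩ := exists_norm_sqrtBessel_le hm
  -- On the support k² ≤ b, so 1 ≤ exp(b/2) exp(-k²/2). This inserts the Gaussian in k that makes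
  -- the bound square integrable.
  refine ⟨C * Real.exp (b / 2), by positivity, fun x k hx hk => ?_⟩
  by_cases hb : k ^ 2 ∈ Icc a b
  · rw [hankelKernel, sqIndicator_of_mem hb, one_mul, norm_gaussPow _ _ hk]
    refine (hC _ (mul_pos hk hx)).trans ?_
    have e : (m + 1 / 2).re = m.re + 1 / 2 := by simp
    rw [e, Real.mul_rpow hk.le hx.le]
    have h1 : Real.exp ((k * x) ^ 2 / 4) ≤
        Real.exp (b / 2) * Real.exp (b / 4 * x ^ 2) * Real.exp (-(1 / 2) * k ^ 2) := by
      rw [← Real.exp_add, ← Real.exp_add]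
      refine Real.exp_le_exp.2 ?_
      nlinarith [hb.2, mul_le_mul_of_nonneg_right hb.2 (sq_nonneg x)]
    calc C * (k ^ (m.re + 1 / 2) * x ^ (m.re + 1 / 2) * Real.exp ((k * x) ^ 2 / 4)) ≤
        C * (k ^ (m.re + 1 / 2) * x ^ (m.re + 1 / 2) *
          (Real.exp (b / 2) * Real.exp (b / 4 * x ^ 2) * Real.exp (-(1 / 2) * k ^ 2))) := by gcongr
      _ = _ := by ring
  · rw [hankelKernel, sqIndicator_of_notMem hb, zero_mul, norm_zero]
    positivity

theorem memLp_hankelKernel (hm : -1 < m.re) (a b : ℝ) {x : ℝ} (hx : 0 < x) :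
    MemLp (hankelKernel m a b x) 2 halfLine := by
  obtain ⟨C, hC0, hC⟩ := exists_norm_hankelKernel_le hm a b
  refine ((memLp_gaussPow (hankel_order hm) one_pos).norm.const_mul
    (C * (x ^ (m.re + 1 / 2) * Real.exp (b / 4 * x ^ 2)))).mono
    ((measurable_hankelKernel hm a b).comp measurable_prodMk_left).aestronglyMeasurable
    (ae_halfLine_of_forall fun k hk => (hC x k hx hk).trans (le_abs_self _))

theorem integrable_hankelKernel_prod (hm : -1 < m.re) (a b : ℝ) (g : L2Half) {s : ℝ}
    (hs : b / 2 < s) : Integrable (fun q : ℝ × ℝ =>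
      g q.2 * hankelKernel m a b q.1 q.2 * gaussPow (m + 1 / 2) s q.1) (halfLine.prod halfLine) := by
  obtain ⟨C, hC0, hC⟩ := exists_norm_hankelKernel_le hm a b
  have h1 : Integrable (gaussPow (2 * m + 1) (s - b / 2)) halfLine :=
    integrable_gaussPow (by simp; linarith) (by linarith)
  have h2 : Integrable (fun k => ‖g k‖ * ‖gaussPow (m + 1 / 2) 1 k‖) halfLine :=
    (Lp.memLp g).norm.integrable_mul (memLp_gaussPow (hankel_order hm) one_pos).norm
  refine ((h1.norm.const_mul C).mul_prod h2).mono' ?_ ?_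
  · exact ((Lp.aestronglyMeasurable g).comp_snd.mul
      (measurable_hankelKernel hm a b).aestronglyMeasurable).mul
      (aestronglyMeasurable_gaussPow _ _).comp_fst
  · rw [Measure.prod_restrict, ae_restrict_iff' (measurableSet_Ioi.prod measurableSet_Ioi)]
    refine Eventually.of_forall fun q hq => ?_
    have hx : 0 < q.1 := hq.1
    have hk : 0 < q.2 := hq.2
    have e1 : (m + 1 / 2).re = m.re + 1 / 2 := by simp
    have e2 : (2 * m + 1).re = (m.re + 1 / 2) + (m.re + 1 / 2) := by simp; ring
    rw [norm_mul, norm_mul, norm_gaussPow (2 * m + 1) _ hx, norm_gaussPow _ s hx, e1, e2,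
      Real.rpow_add hx (m.re + 1 / 2) (m.re + 1 / 2), show -((s - b / 2) / 2) * q.1 ^ 2 = b / 4 * q.1 ^ 2 + -(s / 2) * q.1 ^ 2 by
        ring, Real.exp_add]
    have h3 := hC q.1 q.2 hx hk
    calc _ ≤ ‖g q.2‖ * (C * (q.1 ^ (m.re + 1 / 2) * Real.exp (b / 4 * q.1 ^ 2)) *
          ‖gaussPow (m + 1 / 2) 1 q.2‖) *
          (q.1 ^ (m.re + 1 / 2) * Real.exp (-(s / 2) * q.1 ^ 2)) := by gcongr
      _ = _ := by ring

theorem integral_hankelKernel_mul_gaussPow (hm : -1 < m.re) (a : ℝ) {b k s : ℝ} (hk : 0 < k)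
    (hs : b / 2 < s) :
    ∫ x, hankelKernel m a b x k * gaussPow (m + 1 / 2) s x ∂halfLine =
      sqIndicator (Icc a b) k * ((s : ℂ) ^ (-m - 1) * gaussPow (m + 1 / 2) s⁻¹ k) := by
  simp only [hankelKernel, mul_assoc]
  rw [integral_const_mul]
  by_cases hb : k ^ 2 ∈ Icc a b
  · rw [integral_sqrtBessel_mul_gaussPow hm hk (by linarith [hb.2])]
  · rw [sqIndicator_of_notMem hb, zero_mul, zero_mul]

/-- The Hankel transform of a function supported in `a ≤ k² ≤ b`, as an integral. -/
theorem hankel_sqProj_ae_eq (hm : -1 < m.re) (a b : ℝ) (g : L2Half) :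
    hankel hm (sqProj (Icc a b) g) =ᵐ[halfLine]
      fun x => ∫ k, g k * hankelKernel m a b x k ∂halfLine := by
  have hp := hankel_order hm
  -- This choice ensures s > 0 and s > b/2 for every s ≥ s₀, whatever the sign of b.
  set s₀ := max 1 b with hs₀
  have hs : ∀ s, s₀ ≤ s → 0 < s ∧ b / 2 < s := by
    intro s h
    have h1 : 1 ≤ s := (le_max_left _ _).trans h
    have h2 : b ≤ s := (le_max_right _ _).trans h
    exact ⟨by linarith, by linarith⟩
  set G : ℝ → ℂ := fun x => ∫ k, g k * hankelKernel m a b x k ∂halfLine with hG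
  have i1 : ∀ s, s₀ ≤ s → Integrable (fun x => hankel hm (sqProj (Icc a b) g) x *
      gaussPow (m + 1 / 2) s x) halfLine := fun s h =>
    (Lp.memLp _).integrable_mul (memLp_gaussPow hp (hs s h).1)
  have e : ∀ s x, ∫ k, g k * hankelKernel m a b x k * gaussPow (m + 1 / 2) s x ∂halfLine =
      G x * gaussPow (m + 1 / 2) s x := fun s x => integral_mul_const _ _
  have i2 : ∀ s, s₀ ≤ s → Integrable (fun x => G x * gaussPow (m + 1 / 2) s x) halfLine := by
    intro s h
    have := (integrable_hankelKernel_prod hm a b g (hs s h).2).integral_prod_left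
    simpa only [e] using this
  -- Fubini and Weber's integral for each k evaluate the left side; symmetry of F and its action on
  -- Gaussians evaluate the right side. Agreement for s ≥ s₀ identifies the two functions, although
  -- G is not known to be in L².
  have key : ∀ s, s₀ ≤ s → ∫ x, G x * gaussPow (m + 1 / 2) s x ∂halfLine =
      ∫ x, hankel hm (sqProj (Icc a b) g) x * gaussPow (m + 1 / 2) s x ∂halfLine := by
    intro s h
    obtain ⟨hs0, hsb⟩ := hs s h
    simp only [← e s]
    rw [integral_integral_swap (integrable_hankelKernel_prod hm a b g hsb),
      ← pairing_toL2Half_right (memLp_gaussPow hp hs0), ← gaussL2, pairing_hankel,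
      hankel_gaussL2 hm hs0, pairing_apply]
    refine integral_congr_ae ?_
    filter_upwards [ae_restrict_mem measurableSet_Ioi,
      coeFn_sqProj (B := Icc a b) measurableSet_Icc (f := g) EventuallyEq.rfl,
      Lp.coeFn_smul ((s : ℂ) ^ (-m - 1)) (gaussL2 (m + 1 / 2) s⁻¹),
      coeFn_gaussL2 hp (inv_pos.2 hs0)] with k hk h1 h2 h3
    simp only [mul_assoc]
    rw [integral_const_mul, integral_hankelKernel_mul_gaussPow hm a hk hsb, h1, h2, Pi.smul_apply,
      h3, smul_eq_mul]
    ring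
  have h := ae_eq_zero_of_integral_mul_gaussPow_eq_zero (s₀ := s₀) (p := m + 1 / 2)
    (h := fun x => hankel hm (sqProj (Icc a b) g) x - G x)
    (by simpa only [sub_mul] using! (i1 s₀ le_rfl).sub (i2 s₀ le_rfl))
    (fun s h => by
      simp only [sub_mul]
      rw [integral_sub (i1 s h) (i2 s h), key s h, sub_self])
  filter_upwards [h] with x hx
  exact sub_eq_zero.1 hx

theorem sqProj_hankelKernel (hm : -1 < m.re) (a b : ℝ) {x : ℝ} (hx : 0 < x) :
    sqProj (Icc a b) (toL2Half (hankelKernel m a b x)) = toL2Half (hankelKernel m a b x) := by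
  have h := coeFn_toL2Half (memLp_hankelKernel hm a b hx)
  refine Lp.ext ?_
  filter_upwards [h, coeFn_sqProj (B := Icc a b) measurableSet_Icc h] with k h1 h2
  rw [h1, h2, hankelKernel]
  by_cases hb : k ^ 2 ∈ Icc a b
  · rw [sqIndicator_of_mem hb, one_mul]
  · rw [sqIndicator_of_notMem hb, zero_mul, zero_mul]

theorem integral_hankelKernel_mul (m : ℂ) {a b : ℝ} (ha : 0 < a) (hab : a ≤ b) {x y : ℝ}
    (hx : 0 < x) (hy : 0 < y) :
    ∫ k, hankelKernel m a b x k * hankelKernel m a b y k ∂halfLine = besselKernel m a b x y := by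
  have hsub : Ioi 0 ∩ Icc (√a) (√b) = Icc (√a) (√b) :=
    inter_eq_right.2 fun k hk => (Real.sqrt_pos.2 ha).trans_le hk.1
  rw [besselKernel, intervalIntegral.integral_of_le (Real.sqrt_le_sqrt hab),
    ← integral_Icc_eq_integral_Ioc, ← hsub, ← setIntegral_indicator measurableSet_Icc]
  refine integral_congr_ae (ae_halfLine_of_forall fun k hk => ?_)
  have hiff : k ^ 2 ∈ Icc a b ↔ k ∈ Icc (√a) (√b) := by
    rw [mem_Icc, mem_Icc, Real.sqrt_le_left hk.le, Real.le_sqrt' hk]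
  by_cases hb : k ^ 2 ∈ Icc a b
  · have hsq : (√(k * x) : ℂ) * (√(k * y) : ℂ) = (√(x * y) : ℂ) * k := by
      rw [← Complex.ofReal_mul, ← Complex.ofReal_mul, ← Real.sqrt_mul (by positivity),
        show k * x * (k * y) = x * y * k ^ 2 by ring, Real.sqrt_mul (by positivity),
        Real.sqrt_sq hk.le]
    simp only [hankelKernel]
    rw [sqIndicator_of_mem hb, indicator_of_mem (hiff.1 hb), sqrtBessel_eq m (mul_pos hk hx),
      sqrtBessel_eq m (mul_pos hk hy), one_mul, one_mul, mul_mul_mul_comm, hsq]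
    ring
  · simp only [hankelKernel]
    rw [sqIndicator_of_notMem hb, indicator_of_notMem fun h => hb (hiff.2 h), zero_mul, zero_mul]

/-- The integral kernel of `F 1_[a,b](k²) F`. -/
theorem hasIntegralKernel_hankel_sqProj (hm : -1 < m.re) {a b : ℝ} (ha : 0 < a) (hab : a ≤ b) :
    HasIntegralKernel ((hankel hm).comp ((sqProj (Icc a b)).comp (hankel hm)))
      (besselKernel m a b) := by
  intro f
  filter_upwards [hankel_sqProj_ae_eq hm a b (hankel hm f), ae_restrict_mem measurableSet_Ioi]
    with x h1 hx
  have hx0 : 0 < x := hx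
  have hmem := memLp_hankelKernel hm a b hx0
  -- For κ the truncated Hankel kernel at x, the value at x is ⟨κ, Ff⟩ = ⟨Fκ, f⟩, so the kernel
  -- sought is Fκ. It lies in L², which gives absolute convergence.
  have h2 : hankel hm (toL2Half (hankelKernel m a b x)) =ᵐ[halfLine] besselKernel m a b x := by
    have := hankel_sqProj_ae_eq hm a b (toL2Half (hankelKernel m a b x))
    rw [sqProj_hankelKernel hm a b hx0] at this
    filter_upwards [this, ae_restrict_mem measurableSet_Ioi] with y hy hy0
    rw [hy, ← integral_hankelKernel_mul m ha hab hx0 hy0]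
    refine integral_congr_ae ?_
    filter_upwards [coeFn_toL2Half hmem] with k hk
    rw [hk]
  have h3 : (fun y => hankel hm (toL2Half (hankelKernel m a b x)) y * f y) =ᵐ[halfLine]
      fun y => besselKernel m a b x y * f y := by
    filter_upwards [h2] with y hy
    rw [hy]
  refine ⟨(integrable_coeFn_mul _ f).congr h3, ?_⟩
  rw [ContinuousLinearMap.comp_apply, ContinuousLinearMap.comp_apply, h1,
    ← pairing_toL2Half_right hmem, pairing_hankel, pairing_comm, pairing_apply]
  exact integral_congr_ae h3

end HankelKernel

/-! ### Spectral projections of `H_m` -/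

theorem tendsto_sqProj {J : ℕ → Set ℝ} {B : Set ℝ} (hJ : ∀ n, MeasurableSet (J n))
    (hB : MeasurableSet B) (h : ∀ t, ∀ᶠ n in atTop, (t ∈ J n ↔ t ∈ B)) (f : L2Half) :
    Tendsto (fun n => sqProj (J n) f) atTop (𝓝 (sqProj B f)) := by
  have hle : ∀ C x, ‖sqIndicator C x * f x‖ ≤ ‖f x‖ := fun C x => by
    rw [norm_mul]
    exact mul_le_of_le_one_left (norm_nonneg _) (norm_sqIndicator_le C x)
  have hcoe : ∀ C, MeasurableSet C → sqProj C f =ᵐ[halfLine] fun x => sqIndicator C x * f x :=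
    fun C hC => coeFn_sqProj hC EventuallyEq.rfl
  refine tendsto_L2Half_of_dominated (Lp.memLp f).norm ?_ ?_ ?_
  · intro n
    filter_upwards [hcoe _ (hJ n)] with x hx
    rw [hx]; exact hle _ x
  · filter_upwards [hcoe _ hB] with x hx
    rw [hx]; exact hle _ x
  · filter_upwards [hcoe _ hB, ae_all_iff.2 fun n => hcoe _ (hJ n)] with x h1 h2
    simp only [h1, h2]
    refine tendsto_const_nhds.congr' ?_
    filter_upwards [h (x ^ 2)] with n hn
    by_cases hx : x ^ 2 ∈ B
    · rw [sqIndicator_of_mem hx, sqIndicator_of_mem (hn.2 hx)]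
    · rw [sqIndicator_of_notMem hx, sqIndicator_of_notMem fun h' => hx (hn.1 h')]

theorem norm_sqIndicator_mul_sub_le (c : ℝ) (r : NNReal) (k : ℝ) :
    ‖sqIndicator (Icc (c - r) (c + r)) k * ((k : ℂ) ^ 2 - c)‖ ≤ r := by
  by_cases h : k ^ 2 ∈ Icc (c - (r : ℝ)) (c + r)
  · rw [sqIndicator_of_mem h, one_mul]
    have e : (k : ℂ) ^ 2 - c = ((k ^ 2 - c : ℝ) : ℂ) := by push_cast; rfl
    rw [e, Complex.norm_real, Real.norm_eq_abs, abs_le]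
    constructor <;> linarith [h.1, h.2]
  · rw [sqIndicator_of_notMem h, zero_mul, norm_zero]
    exact r.2

/-- Multiplication by `k² - c`, cut off to `|k² - c| ≤ r`. -/
def shiftSq (c : ℝ) (r : NNReal) : L2Half →L[ℂ] L2Half :=
  boundedMul (fun k => sqIndicator (Icc (c - r) (c + r)) k * ((k : ℂ) ^ 2 - c)) r
    ((measurable_sqIndicator measurableSet_Icc).mul
      (by fun_prop : Measurable fun k : ℝ => (k : ℂ) ^ 2 - c)).aestronglyMeasurable
    (Eventually.of_forall (norm_sqIndicator_mul_sub_le c r))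

theorem coeFn_shiftSq (c : ℝ) (r : NNReal) (f : L2Half) : shiftSq c r f =ᵐ[halfLine]
    fun k => sqIndicator (Icc (c - r) (c + r)) k * ((k : ℂ) ^ 2 - c) * f k :=
  coeFn_boundedMul _ _ EventuallyEq.rfl

theorem norm_shiftSq_le (c : ℝ) (r : NNReal) (f : L2Half) : ‖shiftSq c r f‖ ≤ r * ‖f‖ := by
  refine Lp.norm_le_mul_norm_of_ae_le_mul ?_
  filter_upwards [coeFn_shiftSq c r f] with k hk
  rw [hk, norm_mul]
  exact mul_le_mul_of_nonneg_right (norm_sqIndicator_mul_sub_le c r k) (norm_nonneg _)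

theorem shiftSq_mem_mulSqGraph {c : ℝ} {r : NNReal} {f : L2Half}
    (hf : sqProj (Icc (c - r) (c + r)) f = f) :
    (f, shiftSq c r f + (c : ℂ) • f) ∈ mulSqGraph := by
  rw [mem_mulSqGraph]
  have h1 : f =ᵐ[halfLine] fun k => sqIndicator (Icc (c - r) (c + r)) k * f k := by
    have := coeFn_sqProj (B := Icc (c - (r : ℝ)) (c + r)) measurableSet_Icc (f := f) EventuallyEq.rfl
    rwa [hf] at this
  filter_upwards [h1, coeFn_shiftSq c r f, Lp.coeFn_add (shiftSq c r f) ((c : ℂ) • f),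
    Lp.coeFn_smul (c : ℂ) f] with k h1 h2 h3 h4
  rw [h3, Pi.add_apply, h2, h4, Pi.smul_apply, smul_eq_mul]
  linear_combination (c - (k : ℂ) ^ 2) * h1

theorem sqProj_shiftSq (c : ℝ) (r : NNReal) (f : L2Half) :
    sqProj (Icc (c - r) (c + r)) (shiftSq c r f) = shiftSq c r f := by
  refine Lp.ext ?_
  filter_upwards [coeFn_shiftSq c r f, coeFn_sqProj (B := Icc (c - (r : ℝ)) (c + r))
    measurableSet_Icc (coeFn_shiftSq c r f)] with k h1 h2
  rw [h1, h2]
  by_cases h : k ^ 2 ∈ Icc (c - (r : ℝ)) (c + r)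
  · rw [sqIndicator_of_mem h]; ring
  · rw [sqIndicator_of_notMem h]; ring

/-! ### Similarity preserves spectral subspaces -/

section Similarity

variable {T : L2Half →ₗ.[ℂ] L2Half} {S : L2Half ≃L[ℂ] L2Half} {A : L2Half →ₗ.[ℂ] L2Half}
  {E : Set ℝ → L2Half →L[ℂ] L2Half}

/-- If a self-adjoint operator is similar to multiplication by `k²`, then the similarity maps
functions supported in `c ≤ k² ≤ d` into the spectral subspace of `[c, d]`. -/
theorem IsSpectralMeasureOf.apply_similar_eq_self (hE : IsSpectralMeasureOf E A)
    (hA : IsSelfAdjoint A) (hS : ∀ f g, (f, g) ∈ mulSqGraph → (S f, S g) ∈ A.graph)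
    {c d : ℝ} (hcd : c < d) {f : L2Half} (hf : sqProj (Icc c d) f = f) :
    E (Icc c d) (S f) = S f := by
  let r : NNReal := ⟨(d - c) / 2, by linarith⟩
  have hr : (r : ℝ) = (d - c) / 2 := rfl
  set e := (c + d) / 2 with he
  have hc : e - r = c := by rw [he, hr]; ring
  have hd : e + r = d := by rw [he, hr]; ring
  -- The vectors (k² - e)^n f, with e the midpoint and r the half-length of [c, d], grow at most
  -- like r^n. Their images under S form the analogous sequence for A with the same rate r and
  -- constant ‖S‖ ‖f‖.
  set u : ℕ → L2Half := fun n => (shiftSq e r)^[n] f with hu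
  have hu1 : ∀ n, u (n + 1) = shiftSq e r (u n) := fun n => Function.iterate_succ_apply' _ _ _
  have hproj : ∀ n, sqProj (Icc (e - r) (e + r)) (u n) = u n := by
    intro n
    cases n with
    | zero => rw [hc, hd]; exact hf
    | succ n => rw [hu1, sqProj_shiftSq]
  have hnorm : ∀ n, ‖u n‖ ≤ ‖f‖ * (r : ℝ) ^ n := by
    intro n
    induction n with
    | zero => simp [hu]
    | succ n ih =>
      rw [hu1]
      calc _ ≤ r * ‖u n‖ := norm_shiftSq_le _ _ _
        _ ≤ r * (‖f‖ * (r : ℝ) ^ n) := by gcongr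
        _ = _ := by ring
  have hgraph : ∀ n, (S (u n), S (u (n + 1) + (e : ℂ) • u n)) ∈ A.graph := fun n => by
    rw [hu1]
    exact hS _ _ (shiftSq_mem_mulSqGraph (hproj n))
  have key := hE.apply_Icc_eq_self_of_growth hA.dense_domain (c := e) (r := r)
    (C := ‖(S : L2Half →L[ℂ] L2Half)‖ * ‖f‖) (by rw [hr]; linarith) (fun n => S (u n))
    (fun n => LinearPMap.mem_domain_of_mem_graph (hgraph n))
    (fun n => by
      have : A ⟨S (u n), LinearPMap.mem_domain_of_mem_graph (hgraph n)⟩ =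
          S (u (n + 1) + (e : ℂ) • u n) :=
        A.mem_graph_snd_inj (A.mem_graph ⟨S (u n), _⟩) (hgraph n) rfl
      rw [this, map_add, map_smul, add_sub_cancel_right])
    (fun n => by
      refine ((S : L2Half →L[ℂ] L2Half).le_opNorm (u n)).trans ?_
      rw [mul_assoc]
      exact mul_le_mul_of_nonneg_left (hnorm n) (norm_nonneg _))
  rwa [hc, hd] at key

/-- Meant for C a half-line outside B = [a,b]. Compact intervals converging to C stay disjoint from
B; S maps functions supported over them into spectral subspaces killed by E(B), and continuity
passes to the limit. -/
theorem IsSpectralMeasureOf.apply_similar_eq_zero (hE : IsSpectralMeasureOf E A)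
    (hA : IsSelfAdjoint A) (hS : ∀ f g, (f, g) ∈ mulSqGraph → (S f, S g) ∈ A.graph)
    {B : Set ℝ} (hB : MeasurableSet B) {C : Set ℝ} (hC : MeasurableSet C) {c d : ℕ → ℝ}
    (hcd : ∀ n, c n < d n) (hdisj : ∀ n, Disjoint (Icc (c n) (d n)) B)
    (hlim : ∀ t, ∀ᶠ n in atTop, (t ∈ Icc (c n) (d n) ↔ t ∈ C)) (f : L2Half) :
    E B (S (sqProj C f)) = 0 := by
  obtain ⟨hE', -, -⟩ := id hE
  have h0 : ∀ n, E B (S (sqProj (Icc (c n) (d n)) f)) = 0 := fun n => by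
    rw [← hE.apply_similar_eq_self hA hS (hcd n)
      (isProjectionValuedMeasure_sqProj.idem measurableSet_Icc f)]
    exact hE'.apply_apply_of_disjoint measurableSet_Icc hB (hdisj n) _
  have ht := ((E B).continuous.comp S.continuous).continuousAt.tendsto.comp
    (tendsto_sqProj (fun n => measurableSet_Icc) hC hlim f)
  refine tendsto_nhds_unique ht ?_
  simp only [Function.comp_def, h0]
  exact tendsto_const_nhds

/-- A similarity between multiplication by `k²` and a self-adjoint operator intertwines the spectral
projections of intervals. -/
theorem IsSpectralMeasureOf.apply_similar (hE : IsSpectralMeasureOf E A)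
    (hA : IsSelfAdjoint A) (hS : ∀ f g, (f, g) ∈ mulSqGraph → (S f, S g) ∈ A.graph)
    {a b : ℝ} (hab : a < b) (f : L2Half) :
    E (Icc a b) (S f) = S (sqProj (Icc a b) f) := by
  have hP := isProjectionValuedMeasure_sqProj
  have hcompl : (Icc a b)ᶜ = Iio a ∪ Ioi b := by
    ext t; simp only [mem_compl_iff, mem_Icc, mem_union, mem_Iio, mem_Ioi, not_and_or, not_le]
  have hlim0 : Tendsto (fun n : ℕ => (1 : ℝ) / ((n : ℝ) + 1)) atTop (𝓝 0) :=
    tendsto_one_div_add_atTop_nhds_zero_nat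
  have hpos : ∀ n : ℕ, (0 : ℝ) < 1 / ((n : ℝ) + 1) := fun n => by positivity
  have hle : ∀ n : ℕ, (1 : ℝ) / ((n : ℝ) + 1) ≤ 1 := fun n => by
    rw [div_le_one (by positivity)]
    have : (0 : ℝ) ≤ n := n.cast_nonneg
    linarith
  have hlow : E (Icc a b) (S (sqProj (Iio a) f)) = 0 := by
    -- The right endpoint stays strictly below a, for disjointness from [a,b]; the shift by 2 on the
    -- left keeps the interval nondegenerate already for n = 0.
    refine hE.apply_similar_eq_zero hA hS measurableSet_Icc measurableSet_Iio
      (c := fun n => a - n - 2) (d := fun n => a - 1 / ((n : ℝ) + 1)) (fun n => ?_) (fun n => ?_)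
      (fun t => ?_) f
    · have := hle n
      have : (0 : ℝ) ≤ n := n.cast_nonneg
      linarith
    · refine disjoint_left.2 fun t h1 h2 => ?_
      linarith [h1.2, h2.1, hpos n]
    · rcases lt_or_ge t a with h | h
      · filter_upwards [hlim0.eventually_lt_const (sub_pos.2 h),
          tendsto_natCast_atTop_atTop.eventually_gt_atTop (a - t)] with n h1 h2
        refine ⟨fun _ => h, fun _ => ⟨by linarith, by linarith⟩⟩
      · refine Eventually.of_forall fun n => ⟨fun h1 => ?_, fun h1 => absurd h1 (not_lt.2 h)⟩
        linarith [h1.2, hpos n]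
  have hhigh : E (Icc a b) (S (sqProj (Ioi b) f)) = 0 := by
    refine hE.apply_similar_eq_zero hA hS measurableSet_Icc measurableSet_Ioi
      (c := fun n => b + 1 / ((n : ℝ) + 1)) (d := fun n => b + n + 2) (fun n => ?_) (fun n => ?_)
      (fun t => ?_) f
    · have := hle n
      have : (0 : ℝ) ≤ n := n.cast_nonneg
      linarith
    · refine disjoint_left.2 fun t h1 h2 => ?_
      linarith [h1.1, h2.2, hpos n]
    · rcases lt_or_ge b t with h | h
      · filter_upwards [hlim0.eventually_lt_const (sub_pos.2 h),
          tendsto_natCast_atTop_atTop.eventually_gt_atTop (t - b)] with n h1 h2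
        refine ⟨fun _ => h, fun _ => ⟨by linarith, by linarith⟩⟩
      · refine Eventually.of_forall fun n => ⟨fun h1 => ?_, fun h1 => absurd h1 (not_lt.2 h)⟩
        linarith [h1.1, hpos n]
  have hdisj : Disjoint (Iio a) (Ioi b) :=
    disjoint_left.2 fun t h1 h2 => absurd (h1.trans hab) (not_lt.2 (le_of_lt h2))
  -- Split f into its parts over [a,b], below a and above b. E([a,b]) fixes the image under S of the
  -- first and kills those of the other two.
  have hf := hP.add_compl (B := Icc a b) measurableSet_Icc f
  rw [hcompl, hP.union measurableSet_Iio measurableSet_Ioi hdisj] at hf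
  have h1 := hE.apply_similar_eq_self hA hS hab (hP.idem (B := Icc a b) measurableSet_Icc f)
  conv_lhs => rw [← hf]
  rw [map_add, map_add, map_add, map_add, h1, hlow, hhigh, add_zero, add_zero]

end Similarity

/-! ### Existence and uniqueness of the spectral projection of H_m -/

section Hankel

variable {m : ℂ}

/-- The Hankel transform as an equivalence. -/
def hankelEquiv (hm : -1 < m.re) : L2Half ≃L[ℂ] L2Half :=
  ContinuousLinearEquiv.equivOfInverse (hankel hm) (hankel hm) (hankel_hankel hm) (hankel_hankel hm)

theorem hankelEquiv_apply (hm : -1 < m.re) (f : L2Half) : hankelEquiv hm f = hankel hm f := rfl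

theorem isSpectralProjection_hankel (hm : -1 < m.re) {ξ : ℝ → ℝ} (hξ : IsCutoffAtZero ξ)
    (B : Set ℝ) : IsSpectralProjection (homSchrodinger m ξ) B
      ((hankel hm).comp ((sqProj B).comp (hankel hm))) := by
  refine ⟨hankelEquiv hm, mulSqOp, sqProj, isSelfAdjoint_mulSqOp, isSpectralMeasureOf_sqProj, ?_,
    fun f => rfl⟩
  intro f g
  rw [homSchrodinger_graph hm hξ, mulSqOp_graph]
  exact mem_hankelGraph hm

/-- For any admissible pair A, S, the composite S F is a similarity from multiplication by k² to A,
so it intertwines the two spectral projections of [a,b]. -/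
theorem IsSpectralProjection.eq_hankel (hm : -1 < m.re) {ξ : ℝ → ℝ} (hξ : IsCutoffAtZero ξ)
    {a b : ℝ} (hab : a < b) {P : L2Half →L[ℂ] L2Half}
    (hP : IsSpectralProjection (homSchrodinger m ξ) (Icc a b) P) :
    P = (hankel hm).comp ((sqProj (Icc a b)).comp (hankel hm)) := by
  obtain ⟨S, A, E, hA, hE, hgraph, hPE⟩ := hP
  rw [homSchrodinger_graph hm hξ] at hgraph
  ext1 f
  have hS : ∀ u v, (u, v) ∈ mulSqGraph →
      ((hankelEquiv hm).trans S u, (hankelEquiv hm).trans S v) ∈ A.graph := by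
    intro u v h
    refine (hgraph _ _).1 ((mem_hankelGraph hm).2 ?_)
    change (hankel hm (hankel hm u), hankel hm (hankel hm v)) ∈ mulSqGraph
    rwa [hankel_hankel, hankel_hankel]
  have h := hE.apply_similar hA hS hab (hankel hm f)
  simp only [ContinuousLinearEquiv.trans_apply, hankelEquiv_apply, hankel_hankel] at h
  rw [hPE, h, ContinuousLinearEquiv.symm_apply_apply]
  rfl

end Hankel

end

theorem mainTheorem6 (m : ℂ) (hm : -1 < m.re) (ξ : ℝ → ℝ) (hξ : IsCutoffAtZero ξ)
    (a b : ℝ) (ha : 0 < a) (hab : a < b) :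
    (∃ P : L2Half →L[ℂ] L2Half, IsSpectralProjection (homSchrodinger m ξ) (Set.Icc a b) P) ∧
    ∀ P : L2Half →L[ℂ] L2Half, IsSpectralProjection (homSchrodinger m ξ) (Set.Icc a b) P →
      HasIntegralKernel P (besselKernel m a b) := by
  refine ⟨⟨_, isSpectralProjection_hankel hm hξ (Set.Icc a b)⟩, fun P hP => ?_⟩
  rw [hP.eq_hankel hm hξ hab]
  exact hasIntegralKernel_hankel_sqProj hm ha hab.le
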